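/- **Theorem 2.1.** Let $d\ge 2$, $1<q<\infty$, $q'=\frac{q}{q-1}$, $\theta\in(0,\pi/2)$, and let $\Sigma_\theta=\{z\in\mathbb{C}\setminus\{0\}:\ |\arg z|<\pi-\theta\}$. For $1<r<\infty$ let $\dot W^{1,r}(\mathbb{R}^d;\mathbb{C})$ be the space of functions $v$ with $v\in L^r(B)$ for every ball $B$ and $\nabla v\in L^r(\mathbb{R}^d;\mathbb{C}^d)$ (functions that differ by a constant being identified), with norm $\|\nabla v\|_{L^r(\mathbb{R}^d)}$, and let $\dot W^{-1,q}(\mathbb{R}^d;\mathbb{C})$ be the dual of $\dot W^{1,q'}(\mathbb{R}^d;\mathbb{C})$. A function $g\in L^q(\mathbb{R}^d;\mathbb{C})$ belongs to $\dot W^{-1,q}(\mathbb{R}^d;\mathbb{C})$ if there is $\Lambda\in\dot W^{-1,q}(\mathbb{R}^d;\mathbb{C})$ with $\Lambda(\varphi)=\int_{\mathbb{R}^d} g\varphi$ for all $\varphi\in C_0^\infty(\mathbb{R}^d;\mathbb{C})$, and then $\|g\|_{\dot W^{-1,q}(\mathbb{R}^d)}=\|\Lambda\|$. There is a constant $C>0$,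 depending only on $d$, $q$ and $\theta$, such that the following holds for every $\lambda\in\Sigma_\theta$. For any $F\in L^q(\mathbb{R}^d;\mathbb{C}^d)$, $f=(f_{jk})\in L^q(\mathbb{R}^d;\mathbb{C}^{d\times d})$ and $g\in L^q(\mathbb{R}^d;\mathbb{C})\cap\dot W^{-1,q}(\mathbb{R}^d;\mathbb{C})$, there exists a unique $u\in W^{1,q}(\mathbb{R}^d;\mathbb{C}^d)$ such that $$-\Delta u+\nabla p+\lambda u=F+\operatorname{div}(f),\qquad \operatorname{div}(u)=g$$ hold in $\mathbb{R}^d$ in the sense of distributions for some $p\in L^1_{\rm loc}(\mathbb{R}^d;\mathbb{C})$, where the $k$-th component of $\operatorname{div}(f)$ is $\sum_{j}\partial_j f_{jk}$. Moreover, the solution satisfies $$|\lambda|^{1/2}\|\nabla u\|_{L^q(\mathbb{R}^d)}\le C\left\{\|F\|_{L^q(\mathbb{R}^d)}+|\lambda|^{1/2}\|f\|_{L^q(\mathbb{R}^d)}+|\lambda|^{1/2}\|g\|_{L^q(\mathbb{R}^d)}\right\},$$ $$|\lambda|\,\|u\|_{L^q(\mathbb{R}^d)}\le C\left\{\|F\|_{L^q(\mathbb{R}^d)}+|\lambda|^{1/2}\|f\|_{L^q(\mathbb{R}^d)}+|\lambda|\,\|g\|_{\dot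 W^{-1,q}(\mathbb{R}^d)}\right\},$$ and every such $p$ belongs to $L^q(\mathbb{R}^d;\mathbb{C})+\dot W^{1,q}(\mathbb{R}^d;\mathbb{C})$. -/

import Mathlib

open MeasureTheory Set TopologicalSpace
open scoped ENNReal ContDiff Distributions Laplacian

noncomputable section

namespace Stokes

/-- The sector of all nonzero complex numbers `z` with `|arg z| < π - θ`. -/
def Sector (θ : ℝ) : Set ℂ := {z | z ≠ 0 ∧ |Complex.arg z| < Real.pi - θ}

/-- Real `d`-space with its Euclidean norm. -/
abbrev Sp (d : ℕ) : Type := EuclideanSpace ℝ (Fin d)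

/-- Complex vectors with `d` components. -/
abbrev CVec (d : ℕ) : Type := EuclideanSpace ℂ (Fin d)

/-- Complex `d × d` matrices with the Euclidean (Frobenius) norm. -/
abbrev CMat (d : ℕ) : Type := EuclideanSpace ℂ (Fin d × Fin d)

/-- `L^q(ℝ^d; X)` with respect to Lebesgue measure. -/
abbrev LSp (d : ℕ) (X : Type) [NormedAddCommGroup X] (q : ℝ≥0∞) : Type :=
  Lp X q (volume : Measure (Sp d))

/-- Complex-valued smooth compactly supported functions on `ℝ^d`. -/
abbrev Test (d : ℕ) : Type := 𝓓((⊤ : Opens (Sp d)), ℂ)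

/-- The classical partial derivative `∂_j φ`. -/
def pd {d : ℕ} (j : Fin d) (φ : Sp d → ℂ) (x : Sp d) : ℂ :=
  fderiv ℝ φ x (EuclideanSpace.single j 1)

/-- `G = (G_1, …, G_d)` is the gradient of `v` in the sense of distributions. It is used for
locally integrable `v` and `G`. -/
def IsWeakGradient {d : ℕ} (v : Sp d → ℂ) (G : Sp d → CVec d) : Prop :=
  ∀ (j : Fin d) (φ : Test d), ∫ x, v x * pd j φ x = - ∫ x, G x j * φ x

/-- `A = (A_{jk})` with `A_{jk} = ∂_j u_k` in the sense of distributions. -/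
def IsWeakJacobian {d : ℕ} (u : Sp d → CVec d) (A : Sp d → CMat d) : Prop :=
  ∀ (j k : Fin d) (φ : Test d), ∫ x, u x k * pd j φ x = - ∫ x, A x (j, k) * φ x

/-- `u ∈ W^{1,q}(ℝ^d; ℂ^d)`: `u` is in `L^q` and has a weak gradient in `L^q`. -/
def MemW1 {d : ℕ} {q : ℝ≥0∞} (u : LSp d (CVec d) q) : Prop :=
  ∃ A : LSp d (CMat d) q, IsWeakJacobian u A

/-- `v ∈ L^q(B)` for every ball `B`. -/
def MemLqLoc {d : ℕ} (q : ℝ≥0∞) (v : Sp d → ℂ) : Prop :=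
  ∀ (x : Sp d) (r : ℝ), MemLp v q (volume.restrict (Metric.ball x r))

/-- `v` belongs to the homogeneous space `Ẇ^{1,q}(ℝ^d; ℂ)`: it is locally in `L^q`, and has a weak
gradient in `L^q`. -/
def MemHomW1 {d : ℕ} (q : ℝ≥0∞) (v : Sp d → ℂ) : Prop :=
  MemLqLoc q v ∧ ∃ G : LSp d (CVec d) q, IsWeakGradient v G

lemma MemLqLoc.locallyIntegrable {d : ℕ} {q : ℝ≥0∞} [hq : Fact (1 ≤ q)] {v : Sp d → ℂ}
    (hv : MemLqLoc q v) : LocallyIntegrable v := by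
  intro x
  have : IsFiniteMeasure ((volume : Measure (Sp d)).restrict (Metric.ball x 1)) :=
    ⟨by rw [Measure.restrict_apply_univ]; exact measure_ball_lt_top⟩
  exact ⟨Metric.ball x 1, Metric.ball_mem_nhds x one_pos, (hv x 1).integrable hq.out⟩

lemma pd_continuous {d : ℕ} (j : Fin d) (φ : Test d) : Continuous (pd j φ) := by
  have h : Continuous (fderiv ℝ φ) := φ.contDiff.continuous_fderiv (by simp)
  exact h.clm_apply continuous_const

lemma pd_hasCompactSupport {d : ℕ} (j : Fin d) (φ : Test d) : HasCompactSupport (pd j φ) :=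
  (φ.hasCompactSupport.fderiv (𝕜 := ℝ)).comp_left
    (g := fun L : Sp d →L[ℝ] ℂ => L (EuclideanSpace.single j 1)) rfl

lemma integrable_mul_test {d : ℕ} {v ψ : Sp d → ℂ} (hv : LocallyIntegrable v)
    (hc : Continuous ψ) (hs : HasCompactSupport ψ) : Integrable (fun x => v x * ψ x) := by
  have h := hv.integrable_smul_right_of_hasCompactSupport hc hs
  simpa [smul_eq_mul] using h

lemma locallyIntegrable_coord {d : ℕ} {q : ℝ≥0∞} [hq : Fact (1 ≤ q)] (G : LSp d (CVec d) q)
    (j : Fin d) : LocallyIntegrable (fun x => G x j) :=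
  ((EuclideanSpace.proj j : CVec d →L[ℂ] ℂ).comp_memLp' (Lp.memLp G)).locallyIntegrable hq.out

/-- The pairs `(v, G)` with `v ∈ Ẇ^{1,p}(ℝ^d; ℂ)` and `G = ∇v ∈ L^p`. Since the weak gradient is
unique almost everywhere, this is just `Ẇ^{1,p}` with the gradient of each element recorded. -/
def homSobolevSubmodule (d : ℕ) (p : ℝ≥0∞) [Fact (1 ≤ p)] :
    Submodule ℂ ((Sp d → ℂ) × LSp d (CVec d) p) where
  carrier := {w | MemLqLoc p w.1 ∧ IsWeakGradient w.1 w.2}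
  zero_mem' := by
    refine ⟨fun x r => MemLp.zero, fun j φ => ?_⟩
    have h : ∫ x, ((0 : LSp d (CVec d) p) : Sp d → CVec d) x j * φ x = 0 := by
      refine integral_eq_zero_of_ae ?_
      filter_upwards [Lp.coeFn_zero (CVec d) p (volume : Measure (Sp d))] with x hx
      rw [hx]
      simp
    simp only [Prod.fst_zero, Prod.snd_zero, Pi.zero_apply, zero_mul, integral_zero, h, neg_zero]
  add_mem' := by
    rintro ⟨v, G⟩ ⟨w, H⟩ ⟨hv, hG⟩ ⟨hw, hH⟩
    refine ⟨fun x r => (hv x r).add (hw x r), fun j φ => ?_⟩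
    have h : ∫ x, ((G + H : LSp d (CVec d) p) : Sp d → CVec d) x j * φ x =
        ∫ x, (G x j * φ x + H x j * φ x) := by
      refine integral_congr_ae ?_
      filter_upwards [Lp.coeFn_add G H] with x hx
      rw [hx]
      exact add_mul _ _ _
    have h1 := integrable_mul_test (locallyIntegrable_coord G j) φ.continuous φ.hasCompactSupport
    have h2 := integrable_mul_test (locallyIntegrable_coord H j) φ.continuous φ.hasCompactSupport
    have h3 := integrable_mul_test hv.locallyIntegrable (pd_continuous j φ)
      (pd_hasCompactSupport j φ)
    have h4 := integrable_mul_test hw.locallyIntegrable (pd_continuous j φ)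
      (pd_hasCompactSupport j φ)
    have e1 := hG j φ
    have e2 := hH j φ
    simp only at e1 e2 h3 h4
    simp only [Prod.mk_add_mk, Pi.add_apply, add_mul]
    rw [h, integral_add h1 h2, integral_add h3 h4, e1, e2]
    ring
  smul_mem' := by
    rintro c ⟨v, G⟩ ⟨hv, hG⟩
    refine ⟨fun x r => (hv x r).const_smul c, fun j φ => ?_⟩
    have h : ∫ x, ((c • G : LSp d (CVec d) p) : Sp d → CVec d) x j * φ x =
        ∫ x, c * (G x j * φ x) := by
      refine integral_congr_ae ?_
      filter_upwards [Lp.coeFn_smul c G] with x hx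
      rw [hx]
      exact mul_assoc _ _ _
    have e1 := hG j φ
    simp only at e1
    simp only [Prod.smul_mk, Pi.smul_apply, smul_eq_mul, mul_assoc]
    rw [h, integral_const_mul, integral_const_mul, e1]
    ring

/-- The homogeneous Sobolev space `Ẇ^{1,p}(ℝ^d; ℂ)`, seminormed by `‖∇v‖_{L^p}`. Two functions that
differ by a constant are at distance zero, so they are not distinguished by bounded functionals. -/
def HomSobolev (d : ℕ) (p : ℝ≥0∞) [Fact (1 ≤ p)] : Type := homSobolevSubmodule d p

variable {d : ℕ} {p : ℝ≥0∞} [Fact (1 ≤ p)]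

instance : AddCommGroup (HomSobolev d p) :=
  inferInstanceAs (AddCommGroup (homSobolevSubmodule d p))

instance : Module ℂ (HomSobolev d p) :=
  inferInstanceAs (Module ℂ (homSobolevSubmodule d p))

/-- The underlying function of an element of `Ẇ^{1,p}`. -/
def HomSobolev.toFun (w : HomSobolev d p) : Sp d → ℂ := w.1.1

/-- The weak gradient, as a linear map from `Ẇ^{1,p}` to `L^p`. -/
def HomSobolev.grad (d : ℕ) (p : ℝ≥0∞) [Fact (1 ≤ p)] :
    HomSobolev d p →ₗ[ℂ] LSp d (CVec d) p :=
  (LinearMap.snd ℂ (Sp d → ℂ) (LSp d (CVec d) p)).comp (homSobolevSubmodule d p).subtype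

instance : SeminormedAddCommGroup (HomSobolev d p) :=
  SeminormedAddCommGroup.induced (HomSobolev d p) (LSp d (CVec d) p) (HomSobolev.grad d p)

instance : NormedSpace ℂ (HomSobolev d p) :=
  NormedSpace.induced ℂ (HomSobolev d p) (LSp d (CVec d) p) (HomSobolev.grad d p)

instance (q : ℝ≥0∞) : Fact (1 ≤ q.conjExponent) := ⟨le_self_add⟩

/-- `Ẇ^{-1,q}(ℝ^d; ℂ)`: the dual of `Ẇ^{1,q'}(ℝ^d; ℂ)`, `1/q + 1/q' = 1`, with the dual norm. -/
abbrev NegHomSobolev (d : ℕ) (q : ℝ≥0∞) : Type := StrongDual ℂ (HomSobolev d q.conjExponent)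

/-- The functional `Λ ∈ Ẇ^{-1,q}` and the function `g` are equal as distributions: `Λ` acts on
test functions as integration against `g`. -/
def Represents {q : ℝ≥0∞} (Λ : NegHomSobolev d q) (g : Sp d → ℂ) : Prop :=
  ∀ (w : HomSobolev d q.conjExponent) (φ : Test d), w.toFun = φ → Λ w = ∫ x, g x * φ x

/-- `(u, π)` solves `-Δu + ∇π + z u = F + div f`, `div u = g` in `ℝ^d` in the sense of
distributions, where `(div f)_k = ∑_j ∂_j f_{jk}`. -/
structure IsStokesSolution (z : ℂ) (F : Sp d → CVec d) (f : Sp d → CMat d) (g : Sp d → ℂ)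
    (u : Sp d → CVec d) (π : Sp d → ℂ) : Prop where
  momentum : ∀ (k : Fin d) (φ : Test d),
    - (∫ x, u x k * Δ (φ : Sp d → ℂ) x) - (∫ x, π x * pd k φ x) + z * (∫ x, u x k * φ x)
      = (∫ x, F x k * φ x) - ∑ j, ∫ x, f x (j, k) * pd j φ x
  divergence : ∀ φ : Test d, - (∑ j, ∫ x, u x j * pd j φ x) = ∫ x, g x * φ x

end Stokes

end

noncomputable section

namespace Stokes

open Filter Topology
open scoped SchwartzMap LineDeriv FourierTransform

/-! ### Duality of `L^r` and `L^q`, and solvability from a priori bounds -/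

section Riesz

variable {X : Type*} [MeasurableSpace X] {μ : Measure X}

/-! The pressure can be eliminated. Test the `k`-th momentum equation with `Δχ`, subtract the `l`-th
ones tested with `∂_k ∂_l χ`, and use the divergence equation: the result is `⟨u_k, (z - Δ)Δχ⟩ =
ℓ_k(χ)`, where `ℓ_k` (`stokesFun`) involves only `F`, `f`, `g` (`IsStokesSolution.pairS_resLap`).
Everything about `u` is read off from this identity by duality. A bound `|z| |ℓ_k(χ)| ≤ M ‖(z -
Δ)Δχ‖` in `L^{q'}` produces `u_k` by Hahn–Banach and Riesz (`exists_pairS_eq`), and also bounds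
every given solution; `∂_j χ` in place of `χ` gives the weak derivatives and the gradient estimate.
The functions `(z - Δ)Δχ` are numerous enough: `φ - s (s - Δ)⁻¹ φ` (`lowCut`) is one of them and
tends to `φ` in `L^{q'}` as `s → 0`. This yields uniqueness, and lets the equations be checked on
such functions only (`LowCutContinuous.eq_zero`).

The bounds on `ℓ_k` rest on two facts in `L^{q'}`, with constants uniform on the sector
(`exists_resolvent_bounds`). The resolvent estimates for `|z| w`, `|z|^{1/2} ∇w` and `Δw` in terms
of `(z - Δ)w`: the resolvent is an integral of the heat semigroup over a ray of complex times, along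
which the Gaussian kernels are uniformly bounded in `L^1` (`eLpNorm_le_of_sub_lap`), and the
gradient follows by interpolation. The Calderón–Zygmund inequality `‖∂_j ∂_k φ‖ ≤ C ‖Δφ‖`, obtained
without singular integrals. Let `P_t` be the heat semigroup and `W` a Nazarov–Treil Bellman
function, whose Hessian dominates `m x² + m⁻¹ y²` (`bellman_hessian`). Then `∫ W(P_t f, P_t h)`
dissipates at least `2 ∫ |∂_j P_t f| |∂_k P_t h|`, which gives a bilinear embedding on space-time
(`integral_slab_le`). Since `∫ ∂_j φ ∂_k h` is a time integral of `∫ ∂_j P_t Δφ ∂_k P_t h`, the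
inequality follows by duality (`exists_norm_dd_dd_le`).

The divergence of the momentum equation is `Δπ = div div f + Δg + div F - z g`. The first two terms
are accounted for by a pressure in `L^q`, again by duality. The others are accounted for by `π₂` in
`Ẇ^{1,q}`: the negative norm gives `g = -div G` with `G` in `L^q`, and `∇π₂` is the gradient part of
`F + z G`, a limit of gradients of Schwartz functions (`exists_gradient_part`, `exists_potential`).
Two pressures for the same velocity differ by a constant, so every pressure splits in this way. -/

lemma tendsto_eLpNorm_sub_of_dominated {E : Type*} [NormedAddCommGroup E] {r : ℝ≥0∞}
    (hr : r ≠ ⊤) {ι : Type*}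
    {l : Filter ι} [l.IsCountablyGenerated] {F : ι → X → E} {f : X → E} {g : X → ℝ}
    (hF : ∀ i, AEStronglyMeasurable (F i) μ) (hf : MemLp f r μ) (hg : MemLp g r μ)
    (hb : ∀ i, ∀ᵐ x ∂μ, ‖F i x‖ ≤ g x)
    (hlim : ∀ᵐ x ∂μ, Tendsto (fun i => F i x) l (𝓝 (f x))) :
    Tendsto (fun i => eLpNorm (fun x => F i x - f x) r μ) l (𝓝 0) := by
  rcases eq_or_ne r 0 with rfl | hr0
  · simp [tendsto_const_nhds]
  have hrp : 0 < r.toReal := ENNReal.toReal_pos hr0 hr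
  have hG : MemLp (fun x => ‖g x‖ + ‖f x‖) r μ := hg.norm.add hf.norm
  have h1 : Tendsto (fun i => ∫⁻ x, ‖F i x - f x‖ₑ ^ r.toReal ∂μ) l
      (𝓝 (∫⁻ _, (0 : ℝ≥0∞) ∂μ)) := by
    refine tendsto_lintegral_filter_of_dominated_convergence'
      (fun x => ‖‖g x‖ + ‖f x‖‖ₑ ^ r.toReal) ?_ ?_ ?_ ?_
    · exact Eventually.of_forall fun i => ((hF i).sub hf.1).enorm.pow_const _
    · refine Eventually.of_forall fun i => ?_
      filter_upwards [hb i] with x hx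
      gcongr
      rw [enorm_le_iff_norm_le]
      calc ‖F i x - f x‖ ≤ ‖F i x‖ + ‖f x‖ := norm_sub_le _ _
        _ ≤ ‖g x‖ + ‖f x‖ := by gcongr; exact hx.trans (le_abs_self _)
        _ ≤ _ := le_abs_self _
    · exact (lintegral_rpow_enorm_lt_top_of_eLpNorm_lt_top hr0 hr hG.2).ne
    · filter_upwards [hlim] with x hx
      have h2 : Tendsto (fun i => ‖F i x - f x‖ₑ) l (𝓝 0) := by
        have := (hx.sub_const (f x)).enorm
        simpa using this
      have := h2.ennrpow_const r.toReal
      simpa [hrp] using this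
  simp only [lintegral_zero] at h1
  have h3 := h1.ennrpow_const (1 / r.toReal)
  rw [ENNReal.zero_rpow_of_pos (by positivity)] at h3
  simpa only [eLpNorm_eq_lintegral_rpow_enorm_toReal hr0 hr] using h3

lemma tendsto_toLp_of_dominated {E : Type*} [NormedAddCommGroup E] {r : ℝ≥0∞} [Fact (1 ≤ r)]
    (hr : r ≠ ⊤) {ι : Type*} {l : Filter ι} [l.IsCountablyGenerated] {F : ι → X → E} {f : X → E}
    {g : X → ℝ} (hF : ∀ i, MemLp (F i) r μ) (hf : MemLp f r μ) (hg : MemLp g r μ)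
    (hb : ∀ i, ∀ᵐ x ∂μ, ‖F i x‖ ≤ g x)
    (hlim : ∀ᵐ x ∂μ, Tendsto (fun i => F i x) l (𝓝 (f x))) :
    Tendsto (fun i => (hF i).toLp (F i)) l (𝓝 (hf.toLp f)) := by
  rw [Lp.tendsto_Lp_iff_tendsto_eLpNorm'']
  exact tendsto_eLpNorm_sub_of_dominated hr (fun i => (hF i).1) hf hg hb hlim

lemma toLp_eq_zero_of_ae {r : ℝ≥0∞} {f : X → ℂ} (hf : MemLp f r μ) (h : ∀ᵐ x ∂μ, f x = 0) :
    hf.toLp f = 0 := by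
  rw [Lp.eq_zero_iff_ae_eq_zero]
  filter_upwards [hf.coeFn_toLp, h] with x hx h0
  rw [hx, h0, Pi.zero_apply]

/-- Replaces the constant `1`, which is not in `L^r` when the measure is infinite: for a positive
weight `w` in `L^r`, the function `w 1_A` is in `L^r` for every measurable `A`. -/
lemma exists_pos_memLp [SigmaFinite μ] {r : ℝ≥0∞} (hr0 : r ≠ 0) (hr : r ≠ ⊤) :
    ∃ w : X → ℝ, Measurable w ∧ (∀ x, 0 < w x) ∧ MemLp w r μ := by
  obtain ⟨g, hg0, hgm, hg⟩ := exists_pos_lintegral_lt_of_sigmaFinite μ one_ne_zero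
  have hrp : 0 < r.toReal := ENNReal.toReal_pos hr0 hr
  have hm : Measurable fun x => (((g x) ^ (1 / r.toReal) : NNReal) : ℝ) :=
    (hgm.pow_const _).coe_nnreal_real
  refine ⟨fun x => ((g x) ^ (1 / r.toReal) : NNReal), hm,
    fun x => by exact_mod_cast NNReal.rpow_pos (hg0 x), ⟨hm.aestronglyMeasurable, ?_⟩⟩
  rw [eLpNorm_lt_top_iff_lintegral_rpow_enorm_lt_top hr0 hr]
  refine lt_of_eq_of_lt (lintegral_congr fun x => ?_) (hg.trans ENNReal.one_lt_top)
  rw [enorm_eq_nnnorm, NNReal.nnnorm_eq, ENNReal.coe_rpow_of_nonneg _ (by positivity),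
    ← ENNReal.rpow_mul, one_div, inv_mul_cancel₀ hrp.ne', ENNReal.rpow_one]

/-- `A ↦ Φ(w 1_A)` is a complex measure, countably additive by dominated convergence in `L^r`, `r ≠
⊤`, and it vanishes on null sets. Radon–Nikodym for its real and imaginary parts gives the density.
-/
lemma exists_density_of_dual [SigmaFinite μ] {r : ℝ≥0∞} [Fact (1 ≤ r)] (hr : r ≠ ⊤)
    (Φ : StrongDual ℂ (Lp ℂ r μ)) {w : X → ℂ} (hw : MemLp w r μ) :
    ∃ h : X → ℂ, Integrable h μ ∧ ∀ (A : Set X) (hA : MeasurableSet A),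
      Φ ((hw.indicator hA).toLp _) = ∫ x in A, h x ∂μ := by
  classical
  let c : ComplexMeasure X :=
    { measureOf' := fun A => if hA : MeasurableSet A then Φ ((hw.indicator hA).toLp _) else 0
      empty' := by
        rw [dif_pos MeasurableSet.empty]
        convert map_zero Φ
        simp only [Set.indicator_empty]
        exact MemLp.toLp_zero _
      not_measurable' := fun A hA => dif_neg hA
      m_iUnion' := by
        intro f hf hd
        rw [dif_pos (MeasurableSet.iUnion hf)]
        simp only [dif_pos (hf _)]
        have hmem : ∀ s : Finset ℕ, MemLp (fun x => ∑ i ∈ s, (f i).indicator w x) r μ := fun s =>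
          memLp_finsetSum s fun i _ => hw.indicator (hf i)
        have key : Tendsto (fun s : Finset ℕ => (hmem s).toLp _) atTop
            (𝓝 ((hw.indicator (MeasurableSet.iUnion hf)).toLp _)) := by
          refine tendsto_toLp_of_dominated hr hmem _ hw.norm (fun s => ?_) ?_
          · refine Eventually.of_forall fun x => ?_
            rw [← Finset.indicator_biUnion_apply s f (fun i _ j _ hij => hd hij)]
            exact norm_indicator_le_norm_self _ _
          · refine Eventually.of_forall fun x => ?_
            change HasSum (fun i => (f i).indicator w x) _
            by_cases hx : x ∈ ⋃ i, f i
            · obtain ⟨i, hi⟩ := mem_iUnion.1 hx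
              have : (⋃ i, f i).indicator w x = (f i).indicator w x := by
                rw [indicator_of_mem hx, indicator_of_mem hi]
              rw [this]
              refine hasSum_single i fun j hj => indicator_of_notMem (fun hxj => ?_) _
              exact (disjoint_left.1 (hd hj) hxj) hi
            · rw [indicator_of_notMem hx]
              convert hasSum_zero with i
              exact indicator_of_notMem (fun h => hx (mem_iUnion.2 ⟨i, h⟩)) _
        have h2 := (Φ.continuous.tendsto _).comp key
        refine h2.congr fun s => ?_
        simp only [Function.comp]
        rw [← map_sum]
        congr 1
        refine Lp.ext ?_
        refine (MemLp.coeFn_toLp _).trans ?_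
        refine EventuallyEq.trans ?_ (Lp.coeFn_finsetSum _ _).symm
        have : ∀ᵐ x ∂μ, ∀ i, ((hw.indicator (hf i)).toLp _ : X → ℂ) x = (f i).indicator w x :=
          ae_all_iff.2 fun i => MemLp.coeFn_toLp _
        filter_upwards [this] with x hx
        simp [hx] }
  have hc : ∀ A (hA : MeasurableSet A), c A = Φ ((hw.indicator hA).toLp _) :=
    fun A hA => dif_pos hA
  have hz : ∀ A, MeasurableSet A → μ A = 0 → c A = 0 := by
    intro A hA h0
    rw [hc A hA]
    convert map_zero Φ
    refine toLp_eq_zero_of_ae _ ?_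
    filter_upwards [measure_eq_zero_iff_ae_notMem.1 h0] with x hx
    simp [hx]
  have hre : c.re ≪ᵥ μ.toENNRealVectorMeasure := by
    refine VectorMeasure.AbsolutelyContinuous.mk fun A hA h0 => ?_
    rw [Measure.toENNRealVectorMeasure_apply_measurable hA] at h0
    change (c A).re = 0
    rw [hz A hA h0, Complex.zero_re]
  have him : c.im ≪ᵥ μ.toENNRealVectorMeasure := by
    refine VectorMeasure.AbsolutelyContinuous.mk fun A hA h0 => ?_
    rw [Measure.toENNRealVectorMeasure_apply_measurable hA] at h0
    change (c A).im = 0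
    rw [hz A hA h0, Complex.zero_im]
  have h1 := SignedMeasure.withDensityᵥ_rnDeriv_eq _ μ hre
  have h2 := SignedMeasure.withDensityᵥ_rnDeriv_eq _ μ him
  refine ⟨c.rnDeriv μ, c.integrable_rnDeriv μ, fun A hA => ?_⟩
  have hi := (c.integrable_rnDeriv μ).integrableOn (s := A)
  rw [← hc A hA]
  apply Complex.ext
  · have := integral_re hi
    rw [RCLike.re_eq_complex_re] at this
    rw [← this]
    change c.re A = _
    conv_lhs => rw [← h1]
    rw [withDensityᵥ_apply (SignedMeasure.integrable_rnDeriv _ _) hA]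
    rfl
  · have := integral_im hi
    rw [RCLike.im_eq_complex_im] at this
    rw [← this]
    change c.im A = _
    conv_lhs => rw [← h2]
    rw [withDensityᵥ_apply (SignedMeasure.integrable_rnDeriv _ _) hA]
    rfl

/-- `k / w` is bounded by `C`, hence a pointwise limit of simple functions bounded by `C`. Simple
functions are settled by linearity; the majorants `C w` and `C ‖h‖` allow the limit on both sides.
-/
lemma dual_eq_integral_of_le_weight {r : ℝ≥0∞} [Fact (1 ≤ r)] (hr : r ≠ ⊤)
    (Φ : StrongDual ℂ (Lp ℂ r μ)) {w : X → ℝ} (hwm : Measurable w) (hw0 : ∀ x, 0 < w x)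
    (hw : MemLp (fun x => (w x : ℂ)) r μ) {h : X → ℂ} (hh : Integrable h μ)
    (hΦ : ∀ (A : Set X) (hA : MeasurableSet A),
      Φ ((hw.indicator hA).toLp _) = ∫ x in A, h x ∂μ)
    {k : X → ℂ} (hkm : StronglyMeasurable k) {C : ℝ} (hkC : ∀ x, ‖k x‖ ≤ C * w x)
    (hk : MemLp k r μ) :
    Φ (hk.toLp k) = ∫ x, k x * (h x / w x) ∂μ := by
  have hsm : ∀ s : SimpleFunc X ℂ, MemLp (fun x => s x * w x) r μ := by
    intro s
    obtain ⟨C, hC⟩ := s.exists_forall_norm_le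
    refine hw.of_le_mul (c := C) (s.aestronglyMeasurable.mul hw.1) ?_
    refine Eventually.of_forall fun x => ?_
    rw [norm_mul]
    gcongr
    exact hC x
  have hsi : ∀ s : SimpleFunc X ℂ, Integrable (fun x => s x * h x) μ := by
    intro s
    obtain ⟨C, hC⟩ := s.exists_forall_norm_le
    exact hh.bdd_mul s.aestronglyMeasurable (Eventually.of_forall hC)
  have hsimple : ∀ s : SimpleFunc X ℂ, Φ ((hsm s).toLp _) = ∫ x, s x * h x ∂μ := by
    intro s
    induction s using SimpleFunc.induction with
    | const c hA =>
      rename_i A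
      have e1 : (hsm (SimpleFunc.piecewise A hA (SimpleFunc.const X c) (SimpleFunc.const X 0))).toLp
          _ = c • (hw.indicator hA).toLp _ := by
        rw [← MemLp.toLp_const_smul]
        refine MemLp.toLp_congr _ _ (Eventually.of_forall fun x => ?_)
        by_cases hx : x ∈ A <;> simp [hx]
      rw [e1, map_smul, hΦ A hA, ← integral_indicator hA, smul_eq_mul, ← integral_const_mul]
      congr 1
      ext x
      by_cases hx : x ∈ A <;> simp [hx]
    | add _ ihf ihg =>
      rename_i f g _
      have e1 : (hsm (f + g)).toLp _ = (hsm f).toLp _ + (hsm g).toLp _ := by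
        rw [← MemLp.toLp_add]
        refine MemLp.toLp_congr _ _ (Eventually.of_forall fun x => ?_)
        simp [add_mul]
      rw [e1, map_add, ihf, ihg, ← integral_add (hsi f) (hsi g)]
      congr 1
      ext x
      simp [add_mul]
  have hs : StronglyMeasurable fun x => k x / (w x : ℂ) :=
    (hkm.measurable.div (Complex.measurable_ofReal.comp hwm)).stronglyMeasurable
  have hwn : ∀ x, ‖(w x : ℂ)‖ = w x := fun x => by
    rw [Complex.norm_real, Real.norm_of_nonneg (hw0 x).le]
  have hsC : ∀ x, ‖k x / (w x : ℂ)‖ ≤ C := fun x => by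
    rw [norm_div, hwn, div_le_iff₀ (hw0 x)]
    exact hkC x
  have hwne : ∀ x, (w x : ℂ) ≠ 0 := fun x => by exact_mod_cast (hw0 x).ne'
  have hlim : ∀ x, Tendsto (fun n => hs.approxBounded C n x) atTop (𝓝 (k x / w x)) := fun x =>
    hs.tendsto_approxBounded_of_norm_le (hsC x)
  rcases isEmpty_or_nonempty X with hX | ⟨⟨x0⟩⟩
  · have : hk.toLp k = 0 := by
      refine toLp_eq_zero_of_ae _ ?_
      exact Eventually.of_forall fun x => (hX.false x).elim
    rw [this, map_zero]
    simp [Measure.eq_zero_of_isEmpty μ]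
  have hC0 : 0 ≤ C := (norm_nonneg _).trans (hsC x0)
  have l1 : Tendsto (fun n => (hsm (hs.approxBounded C n)).toLp _) atTop (𝓝 (hk.toLp k)) := by
    refine tendsto_toLp_of_dominated hr _ _ (hw.norm.const_mul C) (fun n => ?_) ?_
    · refine Eventually.of_forall fun x => ?_
      rw [norm_mul]
      gcongr
      exact hs.norm_approxBounded_le hC0 n x
    · refine Eventually.of_forall fun x => ?_
      have := (hlim x).mul_const (w x : ℂ)
      rwa [div_mul_cancel₀ _ (hwne x)] at this
  have l2 : Tendsto (fun n => ∫ x, hs.approxBounded C n x * h x ∂μ) atTop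
      (𝓝 (∫ x, k x / w x * h x ∂μ)) := by
    refine tendsto_integral_of_dominated_convergence (fun x => C * ‖h x‖)
      (fun n => (hsi _).1) (hh.norm.const_mul C) (fun n => ?_) ?_
    · refine Eventually.of_forall fun x => ?_
      rw [norm_mul]
      gcongr
      exact hs.norm_approxBounded_le hC0 n x
    · exact Eventually.of_forall fun x => (hlim x).mul_const _
  have l3 := (Φ.continuous.tendsto _).comp l1
  simp only [Function.comp_def, hsimple] at l3
  rw [tendsto_nhds_unique l3 l2]
  congr 1
  ext x
  ring

/-- The candidate is `G = h / w`. The integral formula is known only for functions dominated by a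
multiple of `w`, so `G` is truncated to `|G| ≤ n`, `w ≥ 1 / n`. Hölder's extremal function bounds
the truncations by `‖Φ‖`, and Fatou's lemma removes the truncation. -/
theorem exists_Lp_eq_dual [SigmaFinite μ] {r q : ℝ≥0∞} [Fact (1 ≤ r)] [Fact (1 ≤ q)]
    [hrq : ENNReal.HolderConjugate q r] (hr : r ≠ ⊤) (hq : q ≠ ⊤)
    (Φ : StrongDual ℂ (Lp ℂ r μ)) :
    ∃ u : Lp ℂ q μ, ‖u‖ ≤ ‖Φ‖ ∧ ∀ v : Lp ℂ r μ, Φ v = ∫ x, u x * v x ∂μ := by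
  have hr0 : r ≠ 0 := (zero_lt_one.trans_le Fact.out).ne'
  have hq0 : q ≠ 0 := (zero_lt_one.trans_le Fact.out).ne'
  have hconj : q.toReal.HolderConjugate r.toReal := ENNReal.HolderConjugate.toReal_of_ne_top hq hr
  have hrp := hconj.symm.pos
  have hqp := hconj.pos
  obtain ⟨w, hwm, hw0, hwL⟩ := exists_pos_memLp (μ := μ) hr0 hr
  have hw : MemLp (fun x => (w x : ℂ)) r μ := hwL.ofReal
  obtain ⟨h0, hh0, hΦ0⟩ := exists_density_of_dual hr Φ hw
  obtain ⟨h, hhm, hh0h⟩ := hh0.1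
  have hh : Integrable h μ := hh0.congr hh0h
  have hΦ : ∀ (A : Set X) (hA : MeasurableSet A),
      Φ ((hw.indicator hA).toLp _) = ∫ x in A, h x ∂μ := fun A hA => by
    rw [hΦ0 A hA]
    exact integral_congr_ae (ae_restrict_of_ae hh0h)
  set G : X → ℂ := fun x => h x / w x with hG
  have hGm : StronglyMeasurable G :=
    (hhm.measurable.div (Complex.measurable_ofReal.comp hwm)).stronglyMeasurable
  have hE : ∀ (v : X → ℂ), StronglyMeasurable v → ∀ n : ℕ,
      MeasurableSet {x | ‖v x‖ ≤ n ∧ 1 ≤ (n : ℝ) * w x} := by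
    intro v hv n
    exact (measurableSet_le hv.norm.measurable measurable_const).inter
      (measurableSet_le measurable_const (measurable_const.mul hwm))
  have hev : ∀ (v : X → ℂ) (x : X), ∀ᶠ n : ℕ in atTop, ‖v x‖ ≤ n ∧ 1 ≤ (n : ℝ) * w x := by
    intro v x
    obtain ⟨n1, h1⟩ := exists_nat_ge ‖v x‖
    obtain ⟨n2, h2⟩ := exists_nat_ge (1 / w x)
    filter_upwards [eventually_ge_atTop (max n1 n2)] with n hn
    have a1 : (n1 : ℝ) ≤ n := by exact_mod_cast (le_max_left _ _).trans hn
    have a2 : (n2 : ℝ) ≤ n := by exact_mod_cast (le_max_right _ _).trans hn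
    exact ⟨h1.trans a1, (div_le_iff₀ (hw0 x)).1 (h2.trans a2)⟩
  -- the truncations of `G` are bounded in `L^q`
  have hbound : ∀ n : ℕ,
      eLpNorm ({x | ‖G x‖ ≤ n ∧ 1 ≤ (n : ℝ) * w x}.indicator G) q μ ≤ ‖Φ‖ₑ := by
    intro n
    set E := {x | ‖G x‖ ≤ n ∧ 1 ≤ (n : ℝ) * w x} with hEdef
    have hEm : MeasurableSet E := hE G hGm n
    -- The extremal function in Hölder's inequality: on `E`, both `k G` and `|k|^r` equal `|G|^q`.
    -- Hence `I ≤ ‖Φ‖ I^{1/r}` for `I = ∫_E |G|^q`.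
    set k : X → ℂ := E.indicator fun x => ((‖G x‖ ^ (q.toReal - 2) : ℝ) : ℂ) *
      (starRingEnd ℂ) (G x) with hkdef
    have hkm : StronglyMeasurable k := by
      refine StronglyMeasurable.indicator ?_ hEm
      refine Measurable.stronglyMeasurable ?_
      exact (Complex.measurable_ofReal.comp (hGm.norm.measurable.pow_const _)).mul
        (Complex.continuous_conj.measurable.comp hGm.measurable)
    have hkn : ∀ x ∈ E, ‖k x‖ = ‖G x‖ ^ (q.toReal - 1) := by
      intro x hx
      rw [hkdef, indicator_of_mem hx, norm_mul, Complex.norm_real, RCLike.norm_conj,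
        Real.norm_of_nonneg (by positivity)]
      rcases eq_or_lt_of_le (norm_nonneg (G x)) with h0 | h0
      · rw [← h0, mul_zero, Real.zero_rpow (sub_pos.2 hconj.lt).ne']
      · nth_rw 2 [← Real.rpow_one ‖G x‖]
        rw [← Real.rpow_add h0]
        ring_nf
    have hkC : ∀ x, ‖k x‖ ≤ ((n : ℝ) ^ (q.toReal - 1) * n) * w x := by
      intro x
      by_cases hx : x ∈ E
      · rw [hkn x hx, mul_assoc]
        calc ‖G x‖ ^ (q.toReal - 1) ≤ (n : ℝ) ^ (q.toReal - 1) * 1 := by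
              rw [mul_one]
              exact Real.rpow_le_rpow (norm_nonneg _) hx.1 (sub_pos.2 hconj.lt).le
          _ ≤ _ := by
              gcongr
              exact hx.2
      · rw [hkdef, indicator_of_notMem hx, norm_zero]
        have := (hw0 x).le
        positivity
    have hk : MemLp k r μ := by
      refine hw.of_le_mul (c := (n : ℝ) ^ (q.toReal - 1) * n) hkm.aestronglyMeasurable
        (Eventually.of_forall fun x => ?_)
      rw [Complex.norm_real, Real.norm_of_nonneg (hw0 x).le]
      exact hkC x
    have key := dual_eq_integral_of_le_weight hr Φ hwm hw0 hw hh hΦ hkm hkC hk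
    have hkG : ∀ x, k x * G x = ((‖E.indicator G x‖ ^ q.toReal : ℝ) : ℂ) := by
      intro x
      by_cases hx : x ∈ E
      · rw [hkdef, indicator_of_mem hx, indicator_of_mem hx, mul_assoc, Complex.conj_mul',
          ← Complex.ofReal_pow, ← Complex.ofReal_mul]
        congr 1
        rcases eq_or_lt_of_le (norm_nonneg (G x)) with h0 | h0
        · rw [← h0, Real.zero_rpow hqp.ne']
          simp
        · rw [← Real.rpow_natCast, ← Real.rpow_add h0]
          norm_num
      · rw [hkdef, indicator_of_notMem hx, indicator_of_notMem hx, zero_mul, norm_zero,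
          Real.zero_rpow hqp.ne', Complex.ofReal_zero]
    set I := ∫⁻ x, ‖E.indicator G x‖ₑ ^ q.toReal ∂μ with hI
    have hkr : ∀ x, ‖k x‖ₑ ^ r.toReal = ‖E.indicator G x‖ₑ ^ q.toReal := by
      intro x
      by_cases hx : x ∈ E
      · rw [indicator_of_mem hx, ← ofReal_norm, ← ofReal_norm,
          ENNReal.ofReal_rpow_of_nonneg (norm_nonneg _) hrp.le,
          ENNReal.ofReal_rpow_of_nonneg (norm_nonneg _) hqp.le, hkn x hx,
          ← Real.rpow_mul (norm_nonneg _), hconj.sub_one_mul_conj]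
      · rw [hkdef, indicator_of_notMem hx, indicator_of_notMem hx, enorm_zero,
          ENNReal.zero_rpow_of_pos hrp, ENNReal.zero_rpow_of_pos hqp]
    have hkI : eLpNorm k r μ = I ^ (1 / r.toReal) := by
      rw [eLpNorm_eq_lintegral_rpow_enorm_toReal hr0 hr]
      simp only [hkr, hI]
    -- Finiteness comes from the truncation and is what allows division by `I^{1/r}`.
    have hIfin : I ≠ ⊤ := by
      have := hk.2
      rw [hkI] at this
      intro h
      rw [h, ENNReal.top_rpow_of_pos (by positivity)] at this
      exact lt_irrefl _ this
    have hΦk : ‖Φ (hk.toLp k)‖ₑ = I := by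
      have hnn : 0 ≤ᵐ[μ] fun x => ‖E.indicator G x‖ ^ q.toReal :=
        Eventually.of_forall fun x => by positivity
      have hm : AEStronglyMeasurable (fun x => ‖E.indicator G x‖ ^ q.toReal) μ :=
        ((hGm.indicator hEm).norm.measurable.pow_const _).aestronglyMeasurable
      have hI' : ∫⁻ x, ENNReal.ofReal (‖E.indicator G x‖ ^ q.toReal) ∂μ = I := by
        refine lintegral_congr fun x => ?_
        rw [← ofReal_norm, ENNReal.ofReal_rpow_of_nonneg (norm_nonneg _) hqp.le]
      rw [key]
      have : (fun x => k x * (h x / w x)) =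
          fun x => ((‖E.indicator G x‖ ^ q.toReal : ℝ) : ℂ) := funext hkG
      rw [this, integral_complex_ofReal, integral_eq_lintegral_of_nonneg_ae hnn hm, hI',
        ← ofReal_norm, Complex.norm_real, Real.norm_of_nonneg ENNReal.toReal_nonneg,
        ENNReal.ofReal_toReal hIfin]
    have hle : I ≤ ‖Φ‖ₑ * I ^ (1 / r.toReal) := by
      rw [← hkI, ← hΦk]
      refine (Φ.le_opENorm _).trans ?_
      rw [Lp.enorm_toLp]
    rw [eLpNorm_eq_lintegral_rpow_enorm_toReal hq0 hq, ← hI]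
    rcases eq_or_ne I 0 with h0 | h0
    · rw [h0, ENNReal.zero_rpow_of_pos (by positivity)]
      exact zero_le
    · have e : (1 / q.toReal) = 1 - 1 / r.toReal := by
        rw [one_div, one_div]
        linarith [hconj.inv_add_inv_eq_one]
      rw [e, ENNReal.rpow_sub _ _ h0 hIfin, ENNReal.rpow_one]
      exact ENNReal.div_le_of_le_mul hle
  have hGL : eLpNorm G q μ ≤ ‖Φ‖ₑ := by
    have := Lp.eLpNorm_lim_le_liminf_eLpNorm (p := q) (μ := μ)
      (f := fun n : ℕ => {x | ‖G x‖ ≤ n ∧ 1 ≤ (n : ℝ) * w x}.indicator G)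
      (fun n => (hGm.indicator (hE G hGm n)).aestronglyMeasurable) G
      (Eventually.of_forall fun x => ?_)
    · refine this.trans ?_
      refine liminf_le_of_frequently_le' (Frequently.of_forall hbound)
    · refine tendsto_const_nhds.congr' ?_
      filter_upwards [hev G x] with n hn
      rw [indicator_of_mem]
      exact hn
  have hGmem : MemLp G q μ := ⟨hGm.aestronglyMeasurable, hGL.trans_lt enorm_lt_top⟩
  refine ⟨hGmem.toLp G, ?_, fun v => ?_⟩
  · have : ‖hGmem.toLp G‖ₑ ≤ ‖Φ‖ₑ := by rwa [Lp.enorm_toLp]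
    exact enorm_le_iff_norm_le.1 this
  · obtain ⟨v', hv'm, hvv'⟩ := (Lp.memLp v).1
    have hv' : MemLp v' r μ := (Lp.memLp v).ae_eq hvv'
    have hvn : ∀ n : ℕ, MemLp ({x | ‖v' x‖ ≤ n ∧ 1 ≤ (n : ℝ) * w x}.indicator v') r μ := fun n =>
      hv'.indicator (hE v' hv'm n)
    have e1 : ∀ n, Φ ((hvn n).toLp _) =
        ∫ x, {x | ‖v' x‖ ≤ n ∧ 1 ≤ (n : ℝ) * w x}.indicator v' x * G x ∂μ := by
      intro n
      refine dual_eq_integral_of_le_weight hr Φ hwm hw0 hw hh hΦ (hv'm.indicator (hE v' hv'm n))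
        (C := n * n) (fun x => ?_) _
      by_cases hx : ‖v' x‖ ≤ n ∧ 1 ≤ (n : ℝ) * w x
      · rw [indicator_of_mem (by exact hx)]
        calc ‖v' x‖ ≤ n * 1 := by rw [mul_one]; exact hx.1
          _ ≤ n * (n * w x) := by gcongr; exact hx.2
          _ = _ := by ring
      · rw [indicator_of_notMem (by exact hx), norm_zero]
        have := (hw0 x).le
        positivity
    have hlim : ∀ x, Tendsto (fun n : ℕ => {x | ‖v' x‖ ≤ n ∧ 1 ≤ (n : ℝ) * w x}.indicator v' x)
        atTop (𝓝 (v' x)) := by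
      intro x
      refine tendsto_const_nhds.congr' ?_
      filter_upwards [hev v' x] with n hn
      rw [indicator_of_mem]
      exact hn
    have l1 : Tendsto (fun n => (hvn n).toLp _) atTop (𝓝 (hv'.toLp v')) :=
      tendsto_toLp_of_dominated hr _ _ hv'.norm
        (fun n => Eventually.of_forall fun x => norm_indicator_le_norm_self _ _)
        (Eventually.of_forall hlim)
    have hint : Integrable (fun x => v' x * G x) μ := by
      have : ENNReal.HolderConjugate r q := hrq.symm
      exact hv'.integrable_mul hGmem
    have l2 : Tendsto (fun n : ℕ =>
        ∫ x, {x | ‖v' x‖ ≤ n ∧ 1 ≤ (n : ℝ) * w x}.indicator v' x * G x ∂μ) atTop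
        (𝓝 (∫ x, v' x * G x ∂μ)) := by
      refine tendsto_integral_of_dominated_convergence (fun x => ‖v' x * G x‖)
        (fun n => ((hvn n).1.mul hGmem.1)) hint.norm (fun n => ?_)
        (Eventually.of_forall fun x => (hlim x).mul_const _)
      refine Eventually.of_forall fun x => ?_
      rw [norm_mul, norm_mul]
      gcongr
      exact norm_indicator_le_norm_self _ _
    have l3 := (Φ.continuous.tendsto _).comp l1
    simp only [Function.comp_def, e1] at l3
    have hv : hv'.toLp v' = v := by
      refine Lp.ext ((MemLp.coeFn_toLp _).trans hvv'.symm)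
    rw [hv] at l3
    rw [tendsto_nhds_unique l3 l2]
    refine integral_congr_ae ?_
    filter_upwards [hvv', hGmem.coeFn_toLp] with x h1 h2
    rw [h1, h2, mul_comm]

/-- The bound makes `L` vanish on the kernel of `S`, so `L` descends to the range of `S` and
Hahn–Banach extends it. `S` need not be injective; `g` is any linear section over the range. -/
lemma exists_dual_of_bound {V Y : Type*} [AddCommGroup V] [Module ℂ V] [NormedAddCommGroup Y]
    [NormedSpace ℂ Y] (S : V →ₗ[ℂ] Y) (L : V →ₗ[ℂ] ℂ) {M : ℝ} (hM : 0 ≤ M)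
    (h : ∀ v, ‖L v‖ ≤ M * ‖S v‖) :
    ∃ Φ : StrongDual ℂ Y, ‖Φ‖ ≤ M ∧ ∀ v, Φ (S v) = L v := by
  obtain ⟨g, hg⟩ := S.rangeRestrict.exists_rightInverse_of_surjective S.range_rangeRestrict
  have hSg : ∀ y, S (g y) = y := fun y => congrArg Subtype.val (LinearMap.congr_fun hg y)
  obtain ⟨Φ, hΦ, hn⟩ := exists_extension_norm_eq (LinearMap.range S)
    ((L.comp g).mkContinuous M fun y => by
      have := h (g y)
      rw [hSg] at this
      exact this)
  refine ⟨Φ, hn.le.trans (LinearMap.mkContinuous_norm_le _ hM _), fun v => ?_⟩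
  have e : Φ (S v) = L (g ⟨S v, v, rfl⟩) := hΦ ⟨S v, v, rfl⟩
  rw [e, ← sub_eq_zero, ← map_sub, ← norm_le_zero_iff]
  refine (h _).trans ?_
  rw [map_sub, hSg, sub_self, norm_zero, mul_zero]

theorem exists_Lp_of_bound [SigmaFinite μ] {r q : ℝ≥0∞} [Fact (1 ≤ r)] [Fact (1 ≤ q)]
    [ENNReal.HolderConjugate q r] (hr : r ≠ ⊤) (hq : q ≠ ⊤) {V : Type*} [AddCommGroup V]
    [Module ℂ V] (S : V →ₗ[ℂ] Lp ℂ r μ) (L : V →ₗ[ℂ] ℂ) {M : ℝ} (hM : 0 ≤ M)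
    (h : ∀ v, ‖L v‖ ≤ M * ‖S v‖) :
    ∃ u : Lp ℂ q μ, ‖u‖ ≤ M ∧ ∀ v, L v = ∫ x, u x * S v x ∂μ := by
  obtain ⟨Φ, hn, hΦ⟩ := exists_dual_of_bound S L hM h
  obtain ⟨u, hu, hu'⟩ := exists_Lp_eq_dual hr hq Φ
  exact ⟨u, hu.trans hn, fun v => by rw [← hΦ, hu']⟩

end Riesz

/-- Minkowski's inequality for superpositions of translates: Jensen for the measure `‖k‖ ν`, then
Tonelli and translation invariance. The free parameter space `Y` lets it serve convolutions,
integrals over complex times and Taylor remainders alike. -/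
lemma eLpNorm_integral_mul_translate_le {d : ℕ} {Y : Type*} [MeasurableSpace Y] {ν : Measure Y}
    [SFinite ν] {k : Y → ℂ} (hk : AEMeasurable k ν) {τ : Y → Sp d} (hτ : Measurable τ)
    {φ : Sp d → ℂ} (hφ : Measurable φ) {r : ℝ≥0∞} (hr1 : 1 ≤ r) (hr : r ≠ ⊤) :
    eLpNorm (fun x => ∫ y, k y * φ (x - τ y) ∂ν) r volume ≤
      (∫⁻ y, ‖k y‖ₑ ∂ν) * eLpNorm φ r volume := by
  have hr0 : r ≠ 0 := (zero_lt_one.trans_le hr1).ne'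
  set R := r.toReal with hR
  have hR1 : 1 ≤ R := by
    rw [hR]
    simpa using ENNReal.toReal_mono hr hr1
  have hR0 : 0 < R := by linarith
  set K := ∫⁻ y, ‖k y‖ₑ ∂ν with hK
  set κ := ν.withDensity fun y => ‖k y‖ₑ with hκ
  have hKu : κ univ = K := by rw [hκ, withDensity_apply _ MeasurableSet.univ, setLIntegral_univ]
  have hm : Measurable fun p : Sp d × Y => ‖φ (p.1 - τ p.2)‖ₑ :=
    (hφ.comp (measurable_fst.sub (hτ.comp measurable_snd))).enorm
  have hκs : SFinite κ := by rw [hκ]; infer_instance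
  have h1 : ∀ x, ‖∫ y, k y * φ (x - τ y) ∂ν‖ₑ ^ R ≤
      K ^ (R - 1) * ∫⁻ y, ‖φ (x - τ y)‖ₑ ^ R ∂κ := by
    intro x
    have hmx : Measurable fun y => φ (x - τ y) := hφ.comp (measurable_const.sub hτ)
    have a1 : ‖∫ y, k y * φ (x - τ y) ∂ν‖ₑ ≤ ∫⁻ y, ‖φ (x - τ y)‖ₑ ∂κ := by
      refine (enorm_integral_le_lintegral_enorm _).trans (le_of_eq ?_)
      rw [hκ, lintegral_withDensity_eq_lintegral_mul₀ hk.enorm hmx.enorm.aemeasurable]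
      simp only [enorm_mul, Pi.mul_apply]
    have a2 := eLpNorm'_le_eLpNorm'_mul_rpow_measure_univ (μ := κ) (p := 1) (q := R)
      one_pos hR1 hmx.aestronglyMeasurable
    simp only [eLpNorm', ENNReal.rpow_one, div_one, hKu] at a2
    calc _ ≤ ((∫⁻ y, ‖φ (x - τ y)‖ₑ ^ R ∂κ) ^ (1 / R) * K ^ (1 - 1 / R)) ^ R := by
          gcongr
          exact a1.trans a2
      _ = _ := by
          rw [ENNReal.mul_rpow_of_nonneg _ _ hR0.le, ← ENNReal.rpow_mul, ← ENNReal.rpow_mul,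
            one_div, inv_mul_cancel₀ hR0.ne', ENNReal.rpow_one, mul_comm, sub_mul,
            inv_mul_cancel₀ hR0.ne', one_mul]
  rw [eLpNorm_eq_lintegral_rpow_enorm_toReal hr0 hr, eLpNorm_eq_lintegral_rpow_enorm_toReal hr0 hr]
  calc (∫⁻ x, ‖∫ y, k y * φ (x - τ y) ∂ν‖ₑ ^ R) ^ (1 / R)
      ≤ (∫⁻ x, K ^ (R - 1) * ∫⁻ y, ‖φ (x - τ y)‖ₑ ^ R ∂κ) ^ (1 / R) := by
        gcongr with x
        exact h1 x
    _ = (K ^ R * ∫⁻ x, ‖φ x‖ₑ ^ R) ^ (1 / R) := by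
        congr 1
        rw [lintegral_const_mul _ (hm.pow_const R).lintegral_prod_right',
          lintegral_lintegral_swap (hm.pow_const R).aemeasurable]
        have : ∀ y, ∫⁻ x, ‖φ (x - τ y)‖ₑ ^ R = ∫⁻ x, ‖φ x‖ₑ ^ R := fun y =>
          lintegral_sub_right_eq_self (fun x => ‖φ x‖ₑ ^ R) (τ y)
        simp only [this, lintegral_const, hKu]
        rw [mul_comm _ K, ← mul_assoc]
        congr 1
        nth_rw 2 [← ENNReal.rpow_one K]
        rw [← ENNReal.rpow_add_of_nonneg _ _ (by linarith) zero_le_one, sub_add_cancel]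
    _ = _ := by
        rw [ENNReal.mul_rpow_of_nonneg _ _ (by positivity), ← ENNReal.rpow_mul, one_div,
          mul_inv_cancel₀ hR0.ne', ENNReal.rpow_one]

/-! ### Schwartz functions, their derivatives, and the heat and resolvent multipliers -/

/-- Complex-valued Schwartz functions on `ℝ^d`. -/
abbrev Sch (d : ℕ) : Type := 𝓢(Sp d, ℂ)

/-- The partial derivative `∂_j` on Schwartz functions. -/
def dd {d : ℕ} (j : Fin d) : Sch d →L[ℂ] Sch d :=
  LineDeriv.lineDerivOpCLM ℂ (Sch d) (EuclideanSpace.single j (1 : ℝ))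

/-- The Laplacian on Schwartz functions. -/
def lap {d : ℕ} : Sch d →L[ℂ] Sch d := LineDeriv.laplacianCLM ℂ (Sp d) (Sch d)

section Basic

variable {d : ℕ}

lemma dd_eq (j : Fin d) (φ : Sch d) : dd j φ = ∂_{EuclideanSpace.single j (1 : ℝ)} φ := rfl

lemma dd_apply (j : Fin d) (φ : Sch d) (x : Sp d) : dd j φ x = pd j φ x := by
  rw [dd_eq, SchwartzMap.lineDerivOp_apply_eq_fderiv]
  rfl

lemma lap_eq (φ : Sch d) : lap φ = Δ φ := SchwartzMap.laplacianCLM_eq ℂ φ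

lemma lap_apply (φ : Sch d) (x : Sp d) : lap φ x = Δ (φ : Sp d → ℂ) x := by
  rw [lap_eq, SchwartzMap.laplacian_apply]

lemma lap_eq_sum (φ : Sch d) : lap φ = ∑ j, dd j (dd j φ) := by
  rw [lap_eq, SchwartzMap.laplacian_eq_sum (EuclideanSpace.basisFun (Fin d) ℝ)]
  simp [dd_eq]

lemma fourier_dd (j : Fin d) (φ : Sch d) (ξ : Sp d) :
    (𝓕 (dd j φ)) ξ = 2 * Real.pi * Complex.I * (ξ j : ℂ) * (𝓕 φ) ξ := by
  rw [dd_eq, SchwartzMap.fourier_lineDerivOp_eq]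
  have e : (fun x : Sp d => inner ℝ x (EuclideanSpace.single j (1 : ℝ))) = fun x => x j := by
    ext x
    simp [EuclideanSpace.inner_single_right]
  rw [smul_apply, SchwartzMap.smulLeftCLM_apply_apply (by fun_prop), congrFun e ξ]
  simp [mul_assoc]

lemma fourier_apply_ext {φ ψ : Sch d} (h : ∀ ξ, (𝓕 φ) ξ = (𝓕 ψ) ξ) : φ = ψ := by
  have : (𝓕 φ : Sch d) = 𝓕 ψ := by
    ext ξ
    exact h ξ
  have h2 : (𝓕⁻ (𝓕 φ : Sch d) : Sch d) = 𝓕⁻ (𝓕 ψ : Sch d) := by rw [this]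
  simpa using h2

lemma dd_comm (j k : Fin d) (φ : Sch d) : dd j (dd k φ) = dd k (dd j φ) := by
  refine fourier_apply_ext fun ξ => ?_
  rw [fourier_dd, fourier_dd, fourier_dd, fourier_dd]
  ring

lemma lap_dd (j : Fin d) (φ : Sch d) : lap (dd j φ) = dd j (lap φ) := by
  rw [lap_eq_sum, lap_eq_sum, map_sum]
  refine Finset.sum_congr rfl fun i _ => ?_
  rw [dd_comm i j, dd_comm i j]

lemma fourier_lap (φ : Sch d) (ξ : Sp d) :
    (𝓕 (lap φ)) ξ = -((4 * Real.pi ^ 2 * ‖ξ‖ ^ 2 : ℝ) : ℂ) * (𝓕 φ) ξ := by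
  rw [lap_eq_sum]
  have : (𝓕 (∑ j, dd j (dd j φ)) : Sch d) = ∑ j, (𝓕 (dd j (dd j φ)) : Sch d) := map_sum
    (FourierTransform.fourierCLM ℂ (Sch d)) _ _
  rw [this, sum_apply]
  simp only [fourier_dd]
  rw [EuclideanSpace.norm_sq_eq]
  push_cast
  rw [Finset.mul_sum, ← Finset.sum_neg_distrib, Finset.sum_mul]
  refine Finset.sum_congr rfl fun j _ => ?_
  have := Complex.I_sq
  simp only [Real.norm_eq_abs, ← Complex.ofReal_pow, sq_abs]
  push_cast
  linear_combination (4 * Real.pi ^ 2 * (ξ j : ℂ) ^ 2 * (𝓕 φ) ξ) * this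

lemma integral_mul_dd (j : Fin d) (φ ψ : Sch d) :
    ∫ x, φ x * dd j ψ x = -∫ x, dd j φ x * ψ x :=
  SchwartzMap.integral_mul_lineDerivOp_right_eq_neg_left φ ψ _

lemma integral_mul_lap (φ ψ : Sch d) : ∫ x, φ x * lap ψ x = ∫ x, lap φ x * ψ x := by
  simp only [lap_eq]
  exact SchwartzMap.integral_mul_laplacian_right_eq_left φ ψ

lemma sch_eq_integral (φ : Sch d) (x : Sp d) :
    φ x = ∫ ξ, Complex.exp (2 * Real.pi * Complex.I * (inner ℝ ξ x : ℝ)) * (𝓕 φ) ξ := by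
  have h : (𝓕⁻ (𝓕 φ : Sch d) : Sch d) = φ := FourierTransform.fourierInv_fourier_eq φ
  conv_lhs => rw [← h]
  rw [SchwartzMap.fourierInv_coe, Real.fourierInv_eq']
  refine integral_congr_ae (Eventually.of_forall fun ξ => ?_)
  simp only [smul_eq_mul]
  congr 2
  push_cast
  ring

lemma mult_apply {g : Sp d → ℂ} (hg : g.HasTemperateGrowth) (φ : Sch d) (ξ : Sp d) :
    (𝓕 (SchwartzMap.fourierMultiplierCLM ℂ g φ)) ξ = g ξ * (𝓕 φ) ξ := by
  rw [SchwartzMap.fourierMultiplierCLM_apply, FourierTransform.fourier_fourierInv_eq,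
    SchwartzMap.smulLeftCLM_apply_apply hg, smul_eq_mul]

/-- `F n` is the `n`-th derivative of `F 0`. Only the half-line is involved because the profiles
used below may be singular (resolvent) or unbounded (heat) at negative arguments. -/
lemma hasTemperateGrowth_comp_norm_sq {F : ℕ → ℝ → ℂ} (h0 : ContDiffOn ℝ ∞ (F 0) (Ici 0))
    (hF : ∀ n, ∀ y ∈ Ici (0 : ℝ), HasDerivWithinAt (F n) (F (n + 1) y) (Ici 0) y)
    (hb : ∀ n, ∃ C, ∀ y ∈ Ici (0 : ℝ), ‖F n y‖ ≤ C) :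
    (fun x : Sp d => F 0 (‖x‖ ^ 2)).HasTemperateGrowth := by
  have hu : UniqueDiffOn ℝ (Ici (0 : ℝ)) := uniqueDiffOn_Ici 0
  have hit : ∀ n, ∀ y ∈ Ici (0 : ℝ), iteratedDerivWithin n (F 0) (Ici 0) y = F n y := by
    intro n
    induction n with
    | zero => intro y _; rw [iteratedDerivWithin_zero]
    | succ n ih =>
      intro y hy
      rw [iteratedDerivWithin_succ, derivWithin_congr ih (ih y hy)]
      exact (hF n y hy).derivWithin (hu y hy)
  have hN := Function.hasTemperateGrowth_norm_sq (H := Sp d)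
  refine Function.HasTemperateGrowth.comp' (g := F 0) (f := fun x : Sp d => ‖x‖ ^ 2)
    (t := Ici 0) ?_ hu h0 ?_ hN
  · rintro _ ⟨x, rfl⟩
    change (0 : ℝ) ≤ ‖x‖ ^ 2
    positivity
  · intro N
    choose C hC using hb
    refine ⟨0, ∑ i ∈ Finset.range (N + 1), |C i|, Finset.sum_nonneg fun i _ => abs_nonneg (C i), fun n hn y hy => ?_⟩
    rw [norm_iteratedFDerivWithin_eq_norm_iteratedDerivWithin, hit n y hy, pow_zero, mul_one]
    refine (hC n y hy).trans ((le_abs_self _).trans ?_)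
    have h1 : n ∈ Finset.range (N + 1) := Finset.mem_range.2 (by omega)
    exact Finset.single_le_sum (f := fun i => |C i|) (fun i _ => abs_nonneg (C i)) h1

/-- The symbol of the heat semigroup. -/
def heatSymbol {d : ℕ} (t : ℝ) (ξ : Sp d) : ℂ :=
  Complex.exp (-(4 * Real.pi ^ 2 * t * ‖ξ‖ ^ 2 : ℝ))

lemma heatSymbol_hasTemperateGrowth {t : ℝ} (ht : 0 ≤ t) :
    (heatSymbol t : Sp d → ℂ).HasTemperateGrowth := by
  set a : ℝ := 4 * Real.pi ^ 2 * t with ha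
  have ha0 : 0 ≤ a := by positivity
  have := hasTemperateGrowth_comp_norm_sq (d := d)
    (F := fun n y => (-a : ℂ) ^ n * Complex.exp (-(a * y : ℝ))) ?_ ?_ ?_
  · simp only [pow_zero, one_mul] at this
    exact this
  · refine ContDiff.contDiffOn ?_
    simp only [pow_zero, one_mul]
    exact (Complex.ofRealCLM.contDiff.comp (contDiff_const.mul contDiff_id)).neg.cexp
  · intro n y _
    have h1 : HasDerivAt (fun y : ℝ => (-((a * y : ℝ) : ℂ))) (-((a * 1 : ℝ) : ℂ)) y :=
      (((hasDerivAt_id y).const_mul a).ofReal_comp).neg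
    have h2 := (h1.cexp.const_mul ((-a : ℂ) ^ n)).hasDerivWithinAt (s := Ici 0)
    refine h2.congr_deriv ?_
    push_cast
    ring
  · intro n
    refine ⟨a ^ n, fun y hy => ?_⟩
    rw [norm_mul, norm_pow, norm_neg, Complex.norm_real, Real.norm_of_nonneg ha0,
      Complex.norm_exp]
    have : Real.exp (-(a * y : ℝ) : ℂ).re ≤ 1 := by
      rw [← Complex.ofReal_neg, Complex.ofReal_re, Real.exp_le_one_iff]
      have := mul_nonneg ha0 (mem_Ici.1 hy)
      linarith
    exact mul_le_of_le_one_right (by positivity) this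

/-- The symbol of the resolvent of the Laplacian. -/
def resSymbol {d : ℕ} (z : ℂ) (ξ : Sp d) : ℂ := (z + (4 * Real.pi ^ 2 * ‖ξ‖ ^ 2 : ℝ))⁻¹

lemma exists_le_norm_add {z : ℂ} (hz : z ∈ Complex.slitPlane) :
    ∃ c > 0, ∀ y : ℝ, 0 ≤ y → c ≤ ‖z + y‖ := by
  rcases hz with h | h
  · refine ⟨z.re, h, fun y hy => ?_⟩
    calc z.re ≤ (z + y).re := by simpa using hy
      _ ≤ _ := Complex.re_le_norm _
  · refine ⟨|z.im|, abs_pos.2 h, fun y hy => ?_⟩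
    calc |z.im| = |(z + y).im| := by simp
      _ ≤ _ := Complex.abs_im_le_norm _

lemma resSymbol_hasTemperateGrowth {z : ℂ} (hz : z ∈ Complex.slitPlane) :
    (resSymbol z : Sp d → ℂ).HasTemperateGrowth := by
  set a : ℝ := 4 * Real.pi ^ 2 with ha
  have ha0 : 0 < a := by positivity
  obtain ⟨c, hc, hcz⟩ := exists_le_norm_add hz
  have hb : ∀ y ∈ Ici (0 : ℝ), c ≤ ‖z + (a * y : ℝ)‖ := fun y hy =>
    hcz _ (mul_nonneg ha0.le hy)
  have hne : ∀ y ∈ Ici (0 : ℝ), z + (a * y : ℝ) ≠ 0 := fun y hy =>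
    norm_pos_iff.1 (hc.trans_le (hb y hy))
  have := hasTemperateGrowth_comp_norm_sq (d := d)
    (F := fun n y => (-a : ℂ) ^ n * (n.factorial : ℂ) * ((z + (a * y : ℝ)) ^ (n + 1))⁻¹) ?_ ?_ ?_
  · simp only [pow_zero, one_mul, zero_add, pow_one, Nat.factorial_zero, Nat.cast_one] at this
    exact this
  · simp only [pow_zero, one_mul, zero_add, pow_one, Nat.factorial_zero, Nat.cast_one]
    refine ContDiffOn.inv (ContDiff.contDiffOn ?_) hne
    exact contDiff_const.add (Complex.ofRealCLM.contDiff.comp (contDiff_const.mul contDiff_id))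
  · intro n y hy
    have h1 : HasDerivAt (fun y : ℝ => z + ((a * y : ℝ) : ℂ)) ((a * 1 : ℝ) : ℂ) y :=
      (((hasDerivAt_id y).const_mul a).ofReal_comp).const_add z
    have h2 := (((h1.pow (n + 1)).inv (pow_ne_zero _ (hne y hy))).const_mul
      ((-a : ℂ) ^ n * (n.factorial : ℂ))).hasDerivWithinAt (s := Ici 0)
    refine h2.congr_deriv ?_
    have := hne y hy
    rw [Nat.factorial_succ]
    push_cast
    push_cast at this
    rw [Pi.pow_apply]
    field_simp
    ring
  · intro n
    refine ⟨a ^ n * n.factorial * (c ^ (n + 1))⁻¹, fun y hy => ?_⟩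
    rw [norm_mul, norm_mul, norm_pow, norm_neg, Complex.norm_real, Real.norm_of_nonneg ha0.le,
      norm_inv, norm_pow, Complex.norm_natCast]
    gcongr
    exact hb y hy

/-- The resolvent `(z - Δ)⁻¹` on Schwartz functions. -/
def res {d : ℕ} (z : ℂ) : Sch d →L[ℂ] Sch d := SchwartzMap.fourierMultiplierCLM ℂ (resSymbol z)

/-- The heat semigroup on Schwartz functions. -/
def heat {d : ℕ} (t : ℝ) : Sch d →L[ℂ] Sch d := SchwartzMap.fourierMultiplierCLM ℂ (heatSymbol t)

lemma fourier_res {z : ℂ} (hz : z ∈ Complex.slitPlane) (φ : Sch d) (ξ : Sp d) :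
    (𝓕 (res z φ)) ξ = resSymbol z ξ * (𝓕 φ) ξ := mult_apply (resSymbol_hasTemperateGrowth hz) φ ξ

lemma fourier_heat {t : ℝ} (ht : 0 ≤ t) (φ : Sch d) (ξ : Sp d) :
    (𝓕 (heat t φ)) ξ = heatSymbol t ξ * (𝓕 φ) ξ := mult_apply (heatSymbol_hasTemperateGrowth ht) φ ξ

lemma fourier_sub_lap (z : ℂ) (φ : Sch d) (ξ : Sp d) :
    (𝓕 (z • φ - lap φ)) ξ = (z + (4 * Real.pi ^ 2 * ‖ξ‖ ^ 2 : ℝ)) * (𝓕 φ) ξ := by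
  have : (𝓕 (z • φ - lap φ) : Sch d) = z • (𝓕 φ : Sch d) - (𝓕 (lap φ) : Sch d) := by
    have h := map_sub (FourierTransform.fourierCLM ℂ (Sch d)) (z • φ) (lap φ)
    rw [map_smul] at h
    exact h
  rw [this, sub_apply, smul_apply, fourier_lap, smul_eq_mul]
  ring

lemma res_sub_lap {z : ℂ} (hz : z ∈ Complex.slitPlane) (φ : Sch d) :
    z • res z φ - lap (res z φ) = φ := by
  refine fourier_apply_ext fun ξ => ?_
  rw [fourier_sub_lap, fourier_res hz, resSymbol, ← mul_assoc, mul_inv_cancel₀, one_mul]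
  obtain ⟨c, hc, hcz⟩ := exists_le_norm_add hz
  exact norm_pos_iff.1 (hc.trans_le (hcz _ (by positivity)))

lemma res_dd {z : ℂ} (hz : z ∈ Complex.slitPlane) (j : Fin d) (φ : Sch d) :
    res z (dd j φ) = dd j (res z φ) := by
  refine fourier_apply_ext fun ξ => ?_
  rw [fourier_res hz, fourier_dd, fourier_dd, fourier_res hz]
  ring

lemma heat_dd {t : ℝ} (ht : 0 ≤ t) (j : Fin d) (φ : Sch d) :
    heat t (dd j φ) = dd j (heat t φ) := by
  refine fourier_apply_ext fun ξ => ?_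
  rw [fourier_heat ht, fourier_dd, fourier_dd, fourier_heat ht]
  ring

lemma heat_lap {t : ℝ} (ht : 0 ≤ t) (φ : Sch d) : heat t (lap φ) = lap (heat t φ) := by
  refine fourier_apply_ext fun ξ => ?_
  rw [fourier_heat ht, fourier_lap, fourier_lap, fourier_heat ht]
  ring

lemma heat_zero (φ : Sch d) : heat 0 φ = φ := by
  refine fourier_apply_ext fun ξ => ?_
  rw [fourier_heat le_rfl, heatSymbol]
  simp

lemma heat_apply {t : ℝ} (ht : 0 ≤ t) (φ : Sch d) (x : Sp d) :
    heat t φ x = ∫ ξ, Complex.exp (2 * Real.pi * Complex.I * (inner ℝ ξ x : ℝ)) *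
      (heatSymbol t ξ * (𝓕 φ) ξ) := by
  rw [sch_eq_integral]
  simp only [fourier_heat ht]

end Basic

/-! ### Gaussian kernels at complex times and the `L^r` resolvent estimate -/

section HeatKernel

variable {d : ℕ}

/-- The Fourier transform of the complex Gaussian `exp (-b ‖·‖ ^ 2)`. -/
def gaussKernel (b : ℂ) (y : Sp d) : ℂ :=
  (Real.pi / b) ^ ((d / 2 : ℝ) : ℂ) * Complex.exp (-Real.pi ^ 2 * ‖y‖ ^ 2 / b)

lemma measurable_gaussKernel {α : Type*} [MeasurableSpace α] {f : α → ℂ} {g : α → Sp d}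
    (hf : Measurable f) (hg : Measurable g) : Measurable fun a => gaussKernel (f a) (g a) := by
  unfold gaussKernel
  refine Measurable.mul ?_ ?_
  · exact (measurable_const.div hf).pow_const _
  · refine Complex.continuous_exp.measurable.comp ?_
    refine Measurable.div ?_ hf
    exact measurable_const.mul ((Complex.measurable_ofReal.comp hg.norm).pow_const 2)

/-- The Fourier transform is moved from a modulated Gaussian to `ψ`. Complex `b` covers the heat
semigroup at complex times. -/
lemma integral_gaussKernel_mul {b : ℂ} (hb : 0 < b.re) (ψ : Sch d) (x : Sp d) :
    ∫ y, gaussKernel b y * ψ (x - y) =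
      ∫ v, Complex.exp (2 * Real.pi * Complex.I * (inner ℝ v x : ℝ)) *
        (Complex.exp (-b * ‖v‖ ^ 2) * (𝓕 ψ) v) := by
  set g : Sp d → ℂ := fun v => Complex.exp (-b * ‖v‖ ^ 2 +
    2 * Real.pi * Complex.I * (inner ℝ x v : ℝ)) with hg
  have hgi : Integrable g := GaussianFourier.integrable_cexp_neg_mul_sq_norm_add hb _ x
  have hF : ∀ w, (𝓕 g) w = gaussKernel b (x - w) := by
    intro w
    rw [hg, fourier_gaussian_innerProductSpace' hb, gaussKernel]
    simp
  have h1 : ∫ w, (𝓕 g) w • ψ w = ∫ v, g v • (𝓕 (ψ : Sp d → ℂ)) v := by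
    have := VectorFourier.integral_fourierIntegral_smul_eq_flip (L := innerₗ (Sp d)) (μ := volume)
      (ν := volume) Real.continuous_fourierChar continuous_inner hgi ψ.integrable
    simpa using! this
  rw [← integral_sub_left_eq_self _ volume x]
  simp only [hF, smul_eq_mul, sub_sub_cancel] at h1 ⊢
  rw [h1]
  refine integral_congr_ae (Eventually.of_forall fun v => ?_)
  simp only [hg, ← SchwartzMap.fourier_coe]
  rw [Complex.exp_add, real_inner_comm]
  ring

/-- The modulus of the kernel is a real Gaussian with parameter `π² Re b / |b|²`. The value is `1`
for real `b`, whence the heat flow is contractive; in general it depends only on the argument of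
`b`. -/
lemma lintegral_enorm_gaussKernel {b : ℂ} (hb : 0 < b.re) :
    ∫⁻ y : Sp d, ‖gaussKernel b y‖ₑ = ENNReal.ofReal ((‖b‖ / b.re) ^ (d / 2 : ℝ)) := by
  have hb0 : b ≠ 0 := by
    rintro rfl
    simp at hb
  have hbn : 0 < ‖b‖ := norm_pos_iff.2 hb0
  set c : ℝ := Real.pi ^ 2 * b.re / ‖b‖ ^ 2 with hc
  have hc0 : 0 < c := by positivity
  have hn : ∀ y : Sp d, ‖gaussKernel b y‖ =
      (Real.pi / ‖b‖) ^ (d / 2 : ℝ) * Real.exp (-c * ‖y‖ ^ 2) := by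
    intro y
    rw [gaussKernel, norm_mul, Complex.norm_cpow_real, norm_div, Complex.norm_real,
      Real.norm_of_nonneg Real.pi_pos.le, Complex.norm_exp]
    congr 2
    have : (-(Real.pi : ℂ) ^ 2 * (‖y‖ : ℂ) ^ 2 / b) =
        ((-(Real.pi ^ 2 * ‖y‖ ^ 2) : ℝ) : ℂ) * b⁻¹ := by
      push_cast
      ring
    rw [this, Complex.re_ofReal_mul, Complex.inv_re, Complex.normSq_eq_norm_sq, hc]
    ring
  have hint : Integrable fun y : Sp d => Real.exp (-c * ‖y‖ ^ 2) := by
    have := (GaussianFourier.integrable_cexp_neg_mul_sq_norm_add (b := (c : ℂ)) (by simpa) 0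
      (0 : Sp d)).norm
    refine this.congr (Eventually.of_forall fun y => ?_)
    simp only [Complex.norm_exp]
    congr 1
    simp [← Complex.ofReal_pow, ← Complex.ofReal_mul]
  calc ∫⁻ y : Sp d, ‖gaussKernel b y‖ₑ
      = ∫⁻ y : Sp d, ENNReal.ofReal ((Real.pi / ‖b‖) ^ (d / 2 : ℝ) * Real.exp (-c * ‖y‖ ^ 2)) := by
        refine lintegral_congr fun y => ?_
        rw [← hn, ofReal_norm]
    _ = ENNReal.ofReal (∫ y : Sp d, (Real.pi / ‖b‖) ^ (d / 2 : ℝ) * Real.exp (-c * ‖y‖ ^ 2)) := by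
        rw [ofReal_integral_eq_lintegral_ofReal (hint.const_mul _)]
        exact Eventually.of_forall fun y => by positivity
    _ = _ := by
        congr 1
        rw [integral_const_mul, GaussianFourier.integral_rexp_neg_mul_sq_norm hc0,
          finrank_euclideanSpace_fin, ← Real.mul_rpow (by positivity) (by positivity)]
        congr 1
        rw [hc]
        field_simp

lemma eLpNorm_heat_le {r : ℝ≥0∞} (hr1 : 1 ≤ r) (hr : r ≠ ⊤) {t : ℝ} (ht : 0 < t) (φ : Sch d) :
    eLpNorm (heat t φ) r volume ≤ eLpNorm φ r volume := by
  set b : ℂ := ((4 * Real.pi ^ 2 * t : ℝ) : ℂ) with hbdef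
  have hbr : b.re = 4 * Real.pi ^ 2 * t := by rw [hbdef, Complex.ofReal_re]
  have hb : 0 < b.re := by rw [hbr]; positivity
  have h : (heat t φ : Sp d → ℂ) = fun x => ∫ y, gaussKernel b y * φ (x - y) := by
    ext x
    rw [integral_gaussKernel_mul hb, heat_apply ht.le]
    refine integral_congr_ae (Eventually.of_forall fun v => ?_)
    simp only [heatSymbol, hbdef]
    congr 3
    push_cast
    ring
  have hL : ∫⁻ y : Sp d, ‖gaussKernel b y‖ₑ = 1 := by
    rw [lintegral_enorm_gaussKernel hb, hbdef, Complex.norm_real, Complex.ofReal_re,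
      Real.norm_of_nonneg (by positivity), div_self (by positivity), Real.one_rpow,
      ENNReal.ofReal_one]
  rw [h]
  refine (eLpNorm_integral_mul_translate_le (measurable_gaussKernel measurable_const measurable_id').aemeasurable
    measurable_id' φ.continuous.measurable hr1 hr).trans ?_
  rw [hL, one_mul]

/-- `(z - Δ)⁻¹ = ∫₀^∞ ρ exp(-ρ s (z - Δ)) ds` on the ray of direction `ρ = exp(-i arg z / 2)`. Half
of the argument is spent on `z` and half on the semigroup: `Re (z ρ) = |z| cos(arg z / 2)` and `Re ρ
= cos(arg z / 2)`. The exponential factor then decays, and the Gaussian kernels have constant `L^1`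
norm along the ray. -/
lemma eLpNorm_le_of_sub_lap {r : ℝ≥0∞} (hr1 : 1 ≤ r) (hr : r ≠ ⊤) {z : ℂ} (hz : z ≠ 0)
    {c : ℝ} (hc : 0 < c) (hzc : c ≤ Real.cos (z.arg / 2)) (w : Sch d) :
    eLpNorm w r volume ≤
      ENNReal.ofReal ((1 / c) ^ (d / 2 : ℝ) * (1 / (‖z‖ * c))) *
        eLpNorm (z • w - lap w : Sch d) r volume := by
  set β := z.arg with hβ
  set ψ : Sch d := z • w - lap w with hψ
  set ρ : ℂ := Complex.exp (-(β / 2 : ℝ) * Complex.I) with hρ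
  set C := Real.cos (β / 2) with hC
  have hC0 : 0 < C := hc.trans_le hzc
  have hzn : 0 < ‖z‖ := norm_pos_iff.2 hz
  have hρn : ‖ρ‖ = 1 := by
    rw [hρ, ← Complex.ofReal_neg, Complex.norm_exp_ofReal_mul_I]
  have hρr : ρ.re = C := by
    rw [hρ, ← Complex.ofReal_neg, Complex.exp_ofReal_mul_I_re, Real.cos_neg]
  have hzρ : z * ρ = ‖z‖ * Complex.exp ((β / 2 : ℝ) * Complex.I) := by
    conv_lhs => rw [← Complex.norm_mul_exp_arg_mul_I z, ← hβ]
    rw [hρ, mul_assoc, ← Complex.exp_add]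
    congr 2
    push_cast
    ring
  have hzρr : (z * ρ).re = ‖z‖ * C := by
    rw [hzρ, Complex.re_ofReal_mul, Complex.exp_ofReal_mul_I_re]
  set k : ℝ × Sp d → ℂ := fun p => ρ * Complex.exp (-(z * ρ) * p.1) *
    gaussKernel (4 * Real.pi ^ 2 * ρ * p.1) p.2 with hk
  set ν : Measure (ℝ × Sp d) := (volume.restrict (Ioi (0 : ℝ))).prod volume with hν
  have hkm : Measurable k := by
    refine Measurable.mul ?_ ?_
    · fun_prop
    · exact measurable_gaussKernel (by fun_prop) measurable_snd
  have hb : ∀ s : ℝ, 0 < s → 0 < (4 * Real.pi ^ 2 * ρ * s : ℂ).re ∧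
      ‖(4 * Real.pi ^ 2 * ρ * s : ℂ)‖ / (4 * Real.pi ^ 2 * ρ * s : ℂ).re = 1 / C := by
    intro s hs
    have e : (4 * Real.pi ^ 2 * ρ * s : ℂ) = ((4 * Real.pi ^ 2 * s : ℝ) : ℂ) * ρ := by
      push_cast
      ring
    rw [e, Complex.re_ofReal_mul, hρr, norm_mul, hρn, Complex.norm_real,
      Real.norm_of_nonneg (by positivity)]
    refine ⟨by positivity, ?_⟩
    field_simp
  have hexpn : ∀ s : ℝ, ‖Complex.exp (-(z * ρ) * s)‖ = Real.exp (-(‖z‖ * C) * s) := by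
    intro s
    rw [Complex.norm_exp, neg_mul, Complex.neg_re, Complex.re_mul_ofReal, hzρr, neg_mul]
  have hexpi : IntegrableOn (fun s : ℝ => Real.exp (-(‖z‖ * C) * s)) (Ioi 0) :=
    exp_neg_integrableOn_Ioi 0 (by positivity)
  have hkL : ∫⁻ p, ‖k p‖ₑ ∂ν = ENNReal.ofReal ((1 / C) ^ (d / 2 : ℝ) * (1 / (‖z‖ * C))) := by
    rw [hν, lintegral_prod _ hkm.enorm.aemeasurable]
    have : ∀ s ∈ Ioi (0 : ℝ), ∫⁻ y : Sp d, ‖k (s, y)‖ₑ =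
        ENNReal.ofReal ((1 / C) ^ (d / 2 : ℝ) * Real.exp (-(‖z‖ * C) * s)) := by
      intro s hs
      simp only [hk, enorm_mul]
      rw [lintegral_const_mul _ (measurable_gaussKernel measurable_const measurable_id').enorm,
        lintegral_enorm_gaussKernel (hb s hs).1,
        (hb s hs).2, ← ofReal_norm, ← ofReal_norm, hρn, hexpn, ENNReal.ofReal_one, one_mul,
        ← ENNReal.ofReal_mul (by positivity), mul_comm]
    rw [setLIntegral_congr_fun measurableSet_Ioi this,
      ← ofReal_integral_eq_lintegral_ofReal (hexpi.const_mul _)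
        (Eventually.of_forall fun s => by positivity), integral_const_mul]
    congr 2
    rw [integral_exp_mul_Ioi (by simp; positivity)]
    simp
  have hkI : Integrable k ν :=
    ⟨hkm.aestronglyMeasurable, by rw [hasFiniteIntegral_iff_enorm, hkL]; exact ENNReal.ofReal_lt_top⟩
  -- Checked on the Fourier side: integrating `ρ exp(-(z + 4π²‖v‖²) ρ s)` in `s` gives the resolvent
  -- symbol, which cancels the factor that `𝓕 ψ` carries.
  have hrepr : (w : Sp d → ℂ) = fun x => ∫ p, k p * ψ (x - p.2) ∂ν := by
    ext x
    have hi1 : Integrable (fun p : ℝ × Sp d => k p * ψ (x - p.2)) ν := by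
      refine hkI.mul_bdd (c := SchwartzMap.seminorm ℝ 0 0 ψ) ?_ ?_
      · exact (ψ.continuous.comp (continuous_const.sub continuous_snd)).aestronglyMeasurable
      · exact Eventually.of_forall fun p => SchwartzMap.norm_le_seminorm ℝ ψ _
    rw [hν, integral_prod _ hi1]
    have e1 : ∀ s ∈ Ioi (0 : ℝ), ∫ y, k (s, y) * ψ (x - y) =
        ∫ v, ρ * Complex.exp (-(z * ρ) * s) *
          (Complex.exp (2 * Real.pi * Complex.I * (inner ℝ v x : ℝ)) *
          (Complex.exp (-(4 * Real.pi ^ 2 * ρ * s) * ‖v‖ ^ 2) * (𝓕 ψ) v)) := by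
      intro s hs
      simp only [hk, mul_assoc (ρ * Complex.exp _)]
      rw [integral_const_mul, integral_const_mul, integral_gaussKernel_mul (hb s hs).1]
    rw [setIntegral_congr_fun measurableSet_Ioi e1, integral_integral_swap]
    · rw [sch_eq_integral w x]
      refine integral_congr_ae (Eventually.of_forall fun v => ?_)
      set A : ℂ := z + (4 * Real.pi ^ 2 * ‖v‖ ^ 2 : ℝ) with hA
      have hAr : 0 < (A * ρ).re := by
        rw [hA, add_mul, Complex.add_re, hzρr, Complex.re_ofReal_mul, hρr]
        positivity
      have hA0 : A * ρ ≠ 0 := by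
        intro h
        rw [h] at hAr
        simp at hAr
      have e2 : ∀ s : ℝ, ρ * Complex.exp (-(z * ρ) * s) *
          (Complex.exp (2 * Real.pi * Complex.I * (inner ℝ v x : ℝ)) *
          (Complex.exp (-(4 * Real.pi ^ 2 * ρ * s) * ‖v‖ ^ 2) * (𝓕 ψ) v)) =
          (ρ * Complex.exp (2 * Real.pi * Complex.I * (inner ℝ v x : ℝ)) * (𝓕 ψ) v) *
            Complex.exp (-(A * ρ) * s) := by
        intro s
        have : Complex.exp (-(A * ρ) * s) = Complex.exp (-(z * ρ) * s) *
            Complex.exp (-(4 * Real.pi ^ 2 * ρ * s) * ‖v‖ ^ 2) := by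
          rw [← Complex.exp_add, hA]
          congr 1
          push_cast
          ring
        rw [this]
        ring
      simp only [e2]
      rw [integral_const_mul, integral_exp_mul_complex_Ioi (by simpa using hAr), hψ,
        fourier_sub_lap, ← hA]
      simp only [Complex.ofReal_zero, mul_zero, Complex.exp_zero]
      have hA1 : A ≠ 0 := left_ne_zero_of_mul hA0
      have hρ0 : ρ ≠ 0 := right_ne_zero_of_mul hA0
      field_simp
    · refine Integrable.mono' (hexpi.integrable.mul_prod (𝓕 ψ).integrable.norm) ?_ ?_
      · refine Continuous.aestronglyMeasurable ?_
        have := (𝓕 ψ).continuous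
        simp only [Function.uncurry_def]
        fun_prop
      · have : ∀ᵐ p ∂((volume.restrict (Ioi (0 : ℝ))).prod (volume : Measure (Sp d))),
            p.1 ∈ Ioi (0 : ℝ) :=
          Measure.quasiMeasurePreserving_fst.ae (ae_restrict_mem measurableSet_Ioi)
        filter_upwards [this] with p hp
        simp only [Function.uncurry_def, norm_mul, hρn, hexpn, one_mul]
        have h1 : ‖Complex.exp (2 * Real.pi * Complex.I * (inner ℝ p.2 x : ℝ))‖ = 1 := by
          have : (2 * Real.pi * Complex.I * (inner ℝ p.2 x : ℝ) : ℂ) =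
              ((2 * Real.pi * inner ℝ p.2 x : ℝ) : ℂ) * Complex.I := by
            push_cast
            ring
          rw [this, Complex.norm_exp_ofReal_mul_I]
        have h2 : ‖Complex.exp (-(4 * Real.pi ^ 2 * ρ * p.1) * ‖p.2‖ ^ 2)‖ ≤ 1 := by
          rw [Complex.norm_exp, Real.exp_le_one_iff]
          have : (-(4 * Real.pi ^ 2 * ρ * p.1) * ‖p.2‖ ^ 2 : ℂ) =
              ((-(‖p.2‖ ^ 2) : ℝ) : ℂ) * (4 * Real.pi ^ 2 * ρ * p.1) := by
            push_cast
            ring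
          rw [this, Complex.re_ofReal_mul]
          have := (hb p.1 hp).1
          nlinarith [sq_nonneg ‖p.2‖]
        rw [h1, one_mul]
        refine mul_le_mul_of_nonneg_left ?_ (Real.exp_pos _).le
        exact mul_le_of_le_one_left (norm_nonneg _) h2
  rw [hrepr]
  refine (eLpNorm_integral_mul_translate_le hkm.aemeasurable measurable_snd
    ψ.continuous.measurable hr1 hr).trans ?_
  rw [hkL]
  gcongr

end HeatKernel

/-! ### A Bellman function and the lower bound for its Hessian -/

section Bellman

/-- `g` is differentiable with derivative `g'`, and `g'` has derivative `g''` at `0`. -/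
structure HasTwoDerivs (g g' : ℝ → ℝ) (g'' : ℝ) : Prop where
  fst : ∀ s, HasDerivAt g (g' s) s
  snd : HasDerivAt g' g'' 0

namespace HasTwoDerivs

variable {f f' g g' : ℝ → ℝ} {f'' g'' : ℝ}

lemma add (hf : HasTwoDerivs f f' f'') (hg : HasTwoDerivs g g' g'') :
    HasTwoDerivs (fun s => f s + g s) (fun s => f' s + g' s) (f'' + g'') :=
  ⟨fun s => (hf.fst s).add (hg.fst s), hf.snd.add hg.snd⟩

lemma mul (hf : HasTwoDerivs f f' f'') (hg : HasTwoDerivs g g' g'') :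
    HasTwoDerivs (fun s => f s * g s) (fun s => f' s * g s + f s * g' s)
      (f'' * g 0 + 2 * (f' 0 * g' 0) + f 0 * g'') := by
  refine ⟨fun s => (hf.fst s).mul (hg.fst s), ?_⟩
  have := (hf.snd.mul (hg.fst 0)).add ((hf.fst 0).mul hg.snd)
  exact this.congr_deriv (by ring)

lemma const_mul (c : ℝ) (hf : HasTwoDerivs f f' f'') :
    HasTwoDerivs (fun s => c * f s) (fun s => c * f' s) (c * f'') :=
  ⟨fun s => (hf.fst s).const_mul c, hf.snd.const_mul c⟩

lemma rpow (hf : HasTwoDerivs f f' f'') (h0 : ∀ s, 0 < f s) (α : ℝ) :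
    HasTwoDerivs (fun s => f s ^ α) (fun s => f' s * α * f s ^ (α - 1))
      (f'' * α * f 0 ^ (α - 1) + f' 0 * α * (f' 0 * (α - 1) * f 0 ^ (α - 1 - 1))) := by
  refine ⟨fun s => (hf.fst s).rpow_const (Or.inl (h0 s).ne'), ?_⟩
  exact (hf.snd.mul_const α).mul ((hf.fst 0).rpow_const (Or.inl (h0 0).ne'))

lemma sq_add (a x ε : ℝ) :
    HasTwoDerivs (fun s => (a + s * x) ^ 2 + ε ^ 2) (fun s => 2 * (a + s * x) * x) (2 * x ^ 2) := by
  have h : ∀ s : ℝ, HasDerivAt (fun s => a + s * x) x s := fun s => by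
    simpa using ((hasDerivAt_id s).mul_const x).const_add a
  refine ⟨fun s => ?_, ?_⟩
  · simpa using ((h s).pow 2).add_const (ε ^ 2)
  · exact (((h 0).const_mul 2).mul_const x).congr_deriv (by ring)

/-- Reduces the Hessian on the diagonal to calculus in one variable along the line `z + s v`, where
`add`, `mul` and `rpow` above compute it. -/
lemma fderiv_fderiv {W : ℝ × ℝ → ℝ} (hW : ContDiff ℝ 2 W) {z v : ℝ × ℝ} {g' : ℝ → ℝ} {g'' : ℝ}
    (hg : HasTwoDerivs (fun s => W (z + s • v)) g' g'') :
    fderiv ℝ (fderiv ℝ W) z v v = g'' := by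
  have hl : ∀ s : ℝ, HasDerivAt (fun s : ℝ => z + s • v) v s := fun s => by
    simpa using ((hasDerivAt_id s).smul_const v).const_add z
  have h1 : ∀ s, fderiv ℝ W (z + s • v) v = g' s := fun s =>
    (((hW.differentiable (by simp)).differentiableAt.hasFDerivAt).comp_hasDerivAt s (hl s)).unique
      (hg.fst s)
  have hd : Differentiable ℝ (fderiv ℝ W) :=
    (hW.fderiv_right (m := 1) (by norm_num)).differentiable (by simp)
  have h2 : HasDerivAt (fun s : ℝ => fderiv ℝ W (z + s • v) v)
      (fderiv ℝ (fderiv ℝ W) (z + (0 : ℝ) • v) v v) 0 := by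
    have := (hd.differentiableAt.hasFDerivAt).comp_hasDerivAt (0 : ℝ) (hl 0)
    exact (ContinuousLinearMap.apply ℝ ℝ v).hasFDerivAt.comp_hasDerivAt _ this
  simp only [h1] at h2
  simpa using h2.unique hg.snd

end HasTwoDerivs

/-- A Nazarov–Treil type Bellman function for the exponents `p` and `q`. -/
def bellman (p q K ε : ℝ) (z : ℝ × ℝ) : ℝ :=
  (z.1 ^ 2 + ε ^ 2) * ((z.1 ^ 2 + ε ^ 2) ^ ((p - 1) / 2) + (z.2 ^ 2 + ε ^ 2) ^ (1 / 2 : ℝ)) ^ (2 - q) +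
    K * (z.2 ^ 2 + ε ^ 2) ^ (q / 2)

variable {p q K : ℝ}

lemma contDiff_bellman {ε : ℝ} (hε : 0 < ε) {n : WithTop ℕ∞} : ContDiff ℝ n (bellman p q K ε) := by
  have hA : ∀ z : ℝ × ℝ, z.1 ^ 2 + ε ^ 2 ≠ 0 := fun z => by positivity
  have hB : ∀ z : ℝ × ℝ, z.2 ^ 2 + ε ^ 2 ≠ 0 := fun z => by positivity
  have hA' : ContDiff ℝ n fun z : ℝ × ℝ => z.1 ^ 2 + ε ^ 2 := by fun_prop
  have hB' : ContDiff ℝ n fun z : ℝ × ℝ => z.2 ^ 2 + ε ^ 2 := by fun_prop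
  unfold bellman
  refine (hA'.mul (ContDiff.rpow_const_of_ne ?_ ?_)).add
    (contDiff_const.mul (hB'.rpow_const_of_ne hB))
  · exact (hA'.rpow_const_of_ne hA).add (hB'.rpow_const_of_ne hB)
  · intro z
    have h1 : 0 < z.1 ^ 2 + ε ^ 2 := by positivity
    have h2 : 0 < z.2 ^ 2 + ε ^ 2 := by positivity
    positivity

/-- Since `q ≤ 2`, all exponents are nonnegative, so the powers stay continuous at `ε = 0`, where
their bases may vanish. This is what later removes the regularisation. -/
lemma continuous_bellman (hp : 2 ≤ p) (hpq : p.HolderConjugate q) :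
    Continuous fun w : ℝ × ℝ × ℝ => bellman p q K w.1 w.2 := by
  have hq0 := hpq.symm.pos
  have hq2 : q ≤ 2 := by
    have := hpq.inv_add_inv_eq_one
    have h1 : p⁻¹ ≤ 2⁻¹ := inv_anti₀ (by norm_num) hp
    have h2 : (2 : ℝ)⁻¹ ≤ q⁻¹ := by linarith [this, (by norm_num : (2 : ℝ)⁻¹ + 2⁻¹ = 1)]
    exact (inv_le_inv₀ (by norm_num) hq0).1 h2
  unfold bellman
  have hA : Continuous fun w : ℝ × ℝ × ℝ => w.2.1 ^ 2 + w.1 ^ 2 := by fun_prop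
  have hB : Continuous fun w : ℝ × ℝ × ℝ => w.2.2 ^ 2 + w.1 ^ 2 := by fun_prop
  refine (hA.mul (((hA.rpow_const fun w => Or.inr (by linarith)).add
    (hB.rpow_const fun w => Or.inr (by norm_num))).rpow_const fun w => Or.inr (by linarith))).add
    (continuous_const.mul (hB.rpow_const fun w => Or.inr (by linarith)))

/-- Nonnegative exponents make the function increasing in `|z.1|` and `|z.2|`. It bounds the energy
from below at the final time of the heat flow. -/
lemma bellman_zero_le (hp : 2 ≤ p) (hpq : p.HolderConjugate q) (hq2 : q ≤ 2) (hK : 0 ≤ K) (ε : ℝ)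
    (z : ℝ × ℝ) : bellman p q K ε 0 ≤ bellman p q K ε z := by
  have hq0 := hpq.symm.pos
  unfold bellman
  simp only [Prod.fst_zero, Prod.snd_zero]
  have h1 : (0 : ℝ) ^ 2 + ε ^ 2 ≤ z.1 ^ 2 + ε ^ 2 := by nlinarith [sq_nonneg z.1]
  have h2 : (0 : ℝ) ^ 2 + ε ^ 2 ≤ z.2 ^ 2 + ε ^ 2 := by nlinarith [sq_nonneg z.2]
  have h3 : 0 ≤ (p - 1) / 2 := by linarith
  have h4 : 0 ≤ 2 - q := by linarith
  gcongr

/-- The right side is the second derivative of `A X^σ` in the direction `(x, y)`, with `σ = 2 - q`,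
`Q = X^{σ-1}`, `A = a² + ε²` and `X = A^{(p-1)/2} + B^{1/2}`; `P₁`, `P₂` and `R₁`, `R₂` are the
first and second derivatives of the two summands of `X`. The negative term in `(P₁ + R₁)²`, due to
concavity of `X ↦ X^σ`, is absorbed by the cross term `4 a x P₁ Q`. -/
lemma hessian_ineq {a x y A S X Q κ σ P₁ P₂ R₁ R₂ p : ℝ} (hσ0 : 0 ≤ σ) (hσ1 : σ ≤ 1)
    (hp : (1 - σ) * (p - 1) = 1) (hp1 : 0 < p - 1)
    (hQ : 0 < Q) (hX : 0 < X) (hκ : 0 ≤ κ) (hS : 0 ≤ S) (hSA : S ^ 2 = A) (haS : |a| ≤ S)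
    (hSQ : S * Q ≤ 1) (hκA : κ * A ≤ X) (hP₁ : P₁ = (p - 1) * (a * x * κ)) (hP₂ : 0 ≤ P₂)
    (hR₁ : |R₁| ≤ |y|) (hR₂ : 0 ≤ R₂) :
    x ^ 2 * (Q * X) - 10 * (y ^ 2 * (Q * X)⁻¹) ≤
      2 * x ^ 2 * (Q * X) + 2 * (2 * a * x * ((P₁ + R₁) * σ * Q)) +
        A * ((P₂ + R₂) * σ * Q + (P₁ + R₁) * σ * ((P₁ + R₁) * (σ - 1) * (Q / X))) := by
  have hA : 0 ≤ A := hSA ▸ sq_nonneg S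
  have h0 : 0 ≤ A * ((P₂ + R₂) * σ * Q) := by positivity
  have hxy : |a * x * R₁ * Q| ≤ |x| * |y| := by
    rw [abs_mul, abs_mul, abs_mul, abs_of_pos hQ]
    calc |a| * |x| * |R₁| * Q = (|a| * Q) * (|x| * |R₁|) := by ring
      _ ≤ (S * Q) * (|x| * |y|) := by gcongr
      _ ≤ _ := mul_le_of_le_one_left (by positivity) hSQ
  have hQX : 0 < Q * X := by positivity
  have hyy : A * (Q / X) * R₁ ^ 2 ≤ y ^ 2 * (Q * X)⁻¹ := by
    have e : A * (Q / X) = (S * Q) ^ 2 * (Q * X)⁻¹ := by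
      rw [← hSA]
      field_simp
    have hy2 : R₁ ^ 2 ≤ y ^ 2 := sq_le_sq.2 hR₁
    have h1 : (S * Q) ^ 2 ≤ 1 := pow_le_one₀ (by positivity) hSQ
    calc A * (Q / X) * R₁ ^ 2 = (S * Q) ^ 2 * ((Q * X)⁻¹ * R₁ ^ 2) := by rw [e]; ring
      _ ≤ (Q * X)⁻¹ * R₁ ^ 2 := mul_le_of_le_one_left (by positivity) h1
      _ ≤ (Q * X)⁻¹ * y ^ 2 := by gcongr
      _ = _ := by ring
  have hκ1 : κ * A / X ≤ 1 := (div_le_one hX).2 hκA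
  have hκ0 : 0 ≤ κ * A / X := by positivity
  set ρ := κ * A / X with hρ
  -- `(1 - σ)(p - 1) = 1` removes the factor `p - 1` of one `P₁`, so the bad term is at most the
  -- quantity `Q a x P₁` of the cross term, with no constant depending on `p`.
  have e1 : (1 - σ) * A * (Q / X) * P₁ ^ 2 = ρ * (Q * (a * x * P₁)) := by
    rw [hρ, hP₁]
    linear_combination (A * Q / X * (p - 1) * (a * x * κ) ^ 2) * hp
  have e2 : (1 - σ) * A * (Q / X) * (P₁ * R₁) = ρ * (a * x * R₁ * Q) := by
    rw [hρ, hP₁]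
    linear_combination (A * Q / X * (a * x * κ) * R₁) * hp
  have hpos : 0 ≤ Q * (a * x * P₁) := by
    rw [hP₁]
    have : a * x * ((p - 1) * (a * x * κ)) = (p - 1) * κ * (a * x) ^ 2 := by ring
    rw [this]
    positivity
  have h1 : ρ * (Q * (a * x * P₁)) ≤ Q * (a * x * P₁) := mul_le_of_le_one_left hpos hκ1
  have h2 : |ρ * (a * x * R₁ * Q)| ≤ |x| * |y| := by
    rw [abs_mul, abs_of_nonneg hκ0]
    exact (mul_le_of_le_one_left (abs_nonneg _) hκ1).trans hxy
  have h3 : (1 - σ) * (A * (Q / X) * R₁ ^ 2) ≤ y ^ 2 * (Q * X)⁻¹ :=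
    (mul_le_of_le_one_left (by positivity) (by linarith)).trans hyy
  have hmain : 2 * (2 * a * x * ((P₁ + R₁) * σ * Q)) +
        A * ((P₁ + R₁) * σ * ((P₁ + R₁) * (σ - 1) * (Q / X))) =
      σ * (4 * (Q * (a * x * P₁)) + 4 * (a * x * R₁ * Q) - ρ * (Q * (a * x * P₁))
        - 2 * (ρ * (a * x * R₁ * Q)) - (1 - σ) * (A * (Q / X) * R₁ ^ 2)) := by
    rw [← e1, ← e2]
    ring
  -- The terms in `Q a x P₁` have a nonnegative sum. The mixed terms cost `4 + 2 = 6` times `|x|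
  -- |y|`, and the term in `R₁²` costs one `y² / (Q X)`. After AM-GM the total loss in `y` is `9 + 1
  -- = 10`.
  have hfin : -(6 * (|x| * |y|) + y ^ 2 * (Q * X)⁻¹) ≤
      (4 * (Q * (a * x * P₁)) + 4 * (a * x * R₁ * Q) - ρ * (Q * (a * x * P₁))
        - 2 * (ρ * (a * x * R₁ * Q)) - (1 - σ) * (A * (Q / X) * R₁ ^ 2)) := by
    have := neg_le_of_abs_le hxy
    have := le_of_abs_le h2
    linarith
  have hnn : 0 ≤ 6 * (|x| * |y|) + y ^ 2 * (Q * X)⁻¹ := by positivity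
  have hfin2 : -(6 * (|x| * |y|) + y ^ 2 * (Q * X)⁻¹) ≤
      2 * (2 * a * x * ((P₁ + R₁) * σ * Q)) +
        A * ((P₁ + R₁) * σ * ((P₁ + R₁) * (σ - 1) * (Q / X))) := by
    rw [hmain]
    calc -(6 * (|x| * |y|) + y ^ 2 * (Q * X)⁻¹)
        ≤ σ * -(6 * (|x| * |y|) + y ^ 2 * (Q * X)⁻¹) := by nlinarith
      _ ≤ _ := mul_le_mul_of_nonneg_left hfin hσ0
  have hamgm : 6 * (|x| * |y|) ≤ x ^ 2 * (Q * X) + 9 * (y ^ 2 * (Q * X)⁻¹) := by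
    have h := sq_nonneg (|x| * (Q * X) - 3 * |y|)
    have e : x ^ 2 * (Q * X) + 9 * (y ^ 2 * (Q * X)⁻¹) - 6 * (|x| * |y|) =
        (|x| * (Q * X) - 3 * |y|) ^ 2 * (Q * X)⁻¹ := by
      rw [← sq_abs x, ← sq_abs y]
      field_simp
      ring
    have : 0 ≤ (|x| * (Q * X) - 3 * |y|) ^ 2 * (Q * X)⁻¹ := by positivity
    linarith
  have : A * ((P₂ + R₂) * σ * Q + (P₁ + R₁) * σ * ((P₁ + R₁) * (σ - 1) * (Q / X))) =
    A * ((P₂ + R₂) * σ * Q) + A * ((P₁ + R₁) * σ * ((P₁ + R₁) * (σ - 1) * (Q / X))) := by ring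
  rw [this]
  linarith

-- The weight is `m = X^{2-q}`. The first summand contributes at least `m x² - 10 y² / m`; the
-- second at least `11 y² / m`, by the size of `K` and because `B^{1/2} ≤ X` gives `B^{q/2-1} ≥ 1 /
-- m`. That the two weights are reciprocal is the point: they recombine to `2 |x| |y|`.
set_option maxHeartbeats 1000000 in
lemma bellman_hessian (hp : 2 ≤ p) (hpq : p.HolderConjugate q) (hK : 11 ≤ K * (q * (q - 1)))
    {ε : ℝ} (hε : 0 < ε) (z : ℝ × ℝ) : ∃ m : ℝ, 0 < m ∧ ∀ v : ℝ × ℝ,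
      m * v.1 ^ 2 + m⁻¹ * v.2 ^ 2 ≤
        fderiv ℝ (fderiv ℝ (bellman p q K ε)) z v v := by
  obtain ⟨a, b⟩ := z
  have hq1 := hpq.symm.lt
  have hq0 := hpq.symm.pos
  have hpq1 : (q - 1) * (p - 1) = 1 := by
    have := hpq.mul_eq_add
    linarith
  have hq2 : q ≤ 2 := by nlinarith
  set A := a ^ 2 + ε ^ 2 with hAd
  set B := b ^ 2 + ε ^ 2 with hBd
  have hA : 0 < A := by positivity
  have hB : 0 < B := by positivity
  set X := A ^ ((p - 1) / 2) + B ^ (1 / 2 : ℝ) with hXd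
  have hX : 0 < X := by positivity
  have hPX : A ^ ((p - 1) / 2) ≤ X := le_add_of_nonneg_right (by positivity)
  have hRX : B ^ (1 / 2 : ℝ) ≤ X := le_add_of_nonneg_left (by positivity)
  have hQX : X ^ (2 - q - 1) * X = X ^ (2 - q) := by
    rw [← Real.rpow_add_one hX.ne']
    congr 1
    ring
  refine ⟨X ^ (2 - q), by positivity, ?_⟩
  rintro ⟨x, y⟩
  have tA := HasTwoDerivs.sq_add a x ε
  have tB := HasTwoDerivs.sq_add b y ε
  have pA : ∀ s : ℝ, 0 < (a + s * x) ^ 2 + ε ^ 2 := fun s => by positivity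
  have pB : ∀ s : ℝ, 0 < (b + s * y) ^ 2 + ε ^ 2 := fun s => by positivity
  have tX := (tA.rpow pA ((p - 1) / 2)).add (tB.rpow pB (1 / 2))
  have tW := (tA.mul (tX.rpow (fun s => add_pos (Real.rpow_pos_of_pos (pA s) _)
    (Real.rpow_pos_of_pos (pB s) _)) (2 - q))).add ((tB.rpow pB (q / 2)).const_mul K)
  have hW := HasTwoDerivs.fderiv_fderiv (W := bellman p q K ε) (z := (a, b)) (v := (x, y))
    (contDiff_bellman hε) tW
  rw [hW]
  simp only [zero_mul, add_zero, ← hAd, ← hBd, ← hXd]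
  have rB : ∀ α : ℝ, B ^ (α - 1) = B ^ α / B := fun α => Real.rpow_sub_one hB.ne' _
  have rA : ∀ α : ℝ, A ^ (α - 1) = A ^ α / A := fun α => Real.rpow_sub_one hA.ne' _
  have hAa : a ^ 2 ≤ A := le_add_of_nonneg_right (sq_nonneg _)
  have hBb : b ^ 2 ≤ B := le_add_of_nonneg_right (sq_nonneg _)
  have key := hessian_ineq (a := a) (x := x) (y := y) (A := A) (S := Real.sqrt A) (X := X)
    (Q := X ^ (2 - q - 1)) (κ := A ^ ((p - 1) / 2 - 1)) (σ := 2 - q)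
    (P₁ := 2 * a * x * ((p - 1) / 2) * A ^ ((p - 1) / 2 - 1))
    (P₂ := 2 * x ^ 2 * ((p - 1) / 2) * A ^ ((p - 1) / 2 - 1) +
      2 * a * x * ((p - 1) / 2) * (2 * a * x * ((p - 1) / 2 - 1) * A ^ ((p - 1) / 2 - 1 - 1)))
    (R₁ := 2 * b * y * (1 / 2) * B ^ (1 / 2 - 1 : ℝ))
    (R₂ := 2 * y ^ 2 * (1 / 2) * B ^ (1 / 2 - 1 : ℝ) +
      2 * b * y * (1 / 2) * (2 * b * y * (1 / 2 - 1) * B ^ (1 / 2 - 1 - 1 : ℝ)))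
    (p := p) (by linarith) (by linarith) (by linarith) (by linarith) (by positivity) hX
    (by positivity) (Real.sqrt_nonneg _) (Real.sq_sqrt hA.le) (Real.abs_le_sqrt hAa) ?_ ?_ ?_ ?_ ?_ ?_
  · have rX : X ^ (2 - q - 1 - 1) = X ^ (2 - q - 1) / X := Real.rpow_sub_one hX.ne' _
    rw [rX]
    rw [hQX] at key
    have hlast : 11 * (y ^ 2 * (X ^ (2 - q))⁻¹) ≤ K * (2 * y ^ 2 * (q / 2) * B ^ (q / 2 - 1) +
        2 * b * y * (q / 2) * (2 * b * y * (q / 2 - 1) * B ^ (q / 2 - 1 - 1))) := by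
      have hBX : (X ^ (2 - q))⁻¹ ≤ B ^ (q / 2 - 1) := by
        have e : B ^ (q / 2 - 1) = ((B ^ (1 / 2 : ℝ)) ^ (2 - q))⁻¹ := by
          rw [← Real.rpow_mul hB.le, ← Real.rpow_neg hB.le]
          congr 1
          ring
        rw [e]
        refine inv_anti₀ (by positivity) ?_
        exact Real.rpow_le_rpow (by positivity) hRX (by linarith)
      have e : 2 * y ^ 2 * (q / 2) * B ^ (q / 2 - 1) +
          2 * b * y * (q / 2) * (2 * b * y * (q / 2 - 1) * B ^ (q / 2 - 1 - 1)) =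
          (q * (q - 1) + q * (2 - q) * (1 - b ^ 2 / B)) * (y ^ 2 * B ^ (q / 2 - 1)) := by
        rw [rB (q / 2 - 1)]
        field_simp
        ring
      have hK0 : 0 ≤ K := by
        by_contra hneg
        have : 0 < q * (q - 1) := mul_pos hq0 (by linarith)
        nlinarith
      have h1 : 0 ≤ q * (2 - q) * (1 - b ^ 2 / B) := by
        have : b ^ 2 / B ≤ 1 := (div_le_one hB).2 hBb
        exact mul_nonneg (mul_nonneg hq0.le (by linarith)) (by linarith)
      rw [e]
      calc 11 * (y ^ 2 * (X ^ (2 - q))⁻¹) ≤ (K * (q * (q - 1))) * (y ^ 2 * B ^ (q / 2 - 1)) := by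
            gcongr
        _ ≤ _ := by
            rw [mul_assoc]
            gcongr
            linarith
    linarith
  · have e : X ^ (2 - q - 1) = (X ^ (q - 1))⁻¹ := by
      rw [← Real.rpow_neg hX.le]
      congr 1
      ring
    rw [e, ← div_eq_mul_inv, div_le_one (by positivity), Real.sqrt_eq_rpow]
    calc A ^ (1 / 2 : ℝ) = (A ^ ((p - 1) / 2)) ^ (q - 1) := by
          rw [← Real.rpow_mul hA.le]
          congr 1
          linarith
      _ ≤ _ := Real.rpow_le_rpow (by positivity) hPX (by linarith)
  · rw [← Real.rpow_add_one hA.ne', sub_add_cancel]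
    exact hPX
  · ring
  · have e : 2 * x ^ 2 * ((p - 1) / 2) * A ^ ((p - 1) / 2 - 1) +
      2 * a * x * ((p - 1) / 2) * (2 * a * x * ((p - 1) / 2 - 1) * A ^ ((p - 1) / 2 - 1 - 1)) =
      (p - 1) * (x ^ 2 * A ^ ((p - 1) / 2 - 1)) * ((1 - a ^ 2 / A) + (p - 2) * (a ^ 2 / A)) := by
      rw [rA ((p - 1) / 2 - 1)]
      field_simp
      ring
    rw [e]
    have : a ^ 2 / A ≤ 1 := (div_le_one hA).2 hAa
    have h2 : 0 ≤ a ^ 2 / A := by positivity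
    have h3 : 0 ≤ (1 - a ^ 2 / A) + (p - 2) * (a ^ 2 / A) :=
      add_nonneg (by linarith) (mul_nonneg (by linarith) h2)
    have h4 : 0 ≤ p - 1 := by linarith
    positivity
  · have e : B ^ (1 / 2 - 1 : ℝ) = (Real.sqrt B)⁻¹ := by
      rw [Real.sqrt_eq_rpow, ← Real.rpow_neg hB.le]
      norm_num
    rw [e]
    have : 2 * b * y * (1 / 2) * (Real.sqrt B)⁻¹ = (b / Real.sqrt B) * y := by
      field_simp
    rw [this, abs_mul]
    refine mul_le_of_le_one_left (abs_nonneg _) ?_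
    rw [abs_div, abs_of_nonneg (Real.sqrt_nonneg B), div_le_one (Real.sqrt_pos.2 hB)]
    exact Real.abs_le_sqrt hBb
  · have e : 2 * y ^ 2 * (1 / 2) * B ^ (1 / 2 - 1 : ℝ) +
      2 * b * y * (1 / 2) * (2 * b * y * (1 / 2 - 1) * B ^ (1 / 2 - 1 - 1 : ℝ)) =
      (y ^ 2 * B ^ (1 / 2 - 1 : ℝ)) * (1 - b ^ 2 / B) := by
      rw [rB (1 / 2 - 1)]
      field_simp
      ring
    rw [e]
    have : b ^ 2 / B ≤ 1 := (div_le_one hB).2 hBb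
    exact mul_nonneg (by positivity) (by linarith)

/-- Compare `|a|^{p-1}` with `|b|`. If `|b|` is larger, then `|a| ≤ |b|^{q-1}` and the mixed term is
of size `|b|^q`; otherwise it is of size `|a|^p`. -/
lemma bellman_eps_zero_le (hp : 2 ≤ p) (hpq : p.HolderConjugate q) (z : ℝ × ℝ) :
    bellman p q K 0 z ≤ 2 ^ (2 - q) * |z.1| ^ p + (2 ^ (2 - q) + K) * |z.2| ^ q := by
  obtain ⟨a, b⟩ := z
  have hq1 := hpq.symm.lt
  have hpq1 : (q - 1) * (p - 1) = 1 := by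
    have := hpq.mul_eq_add
    linarith
  have hq2 : q ≤ 2 := by nlinarith
  have e : ∀ (c α : ℝ), (c ^ 2 + 0 ^ 2) ^ (α / 2) = |c| ^ α := fun c α => by
    rw [zero_pow two_ne_zero, add_zero, ← sq_abs, ← Real.rpow_natCast, ← Real.rpow_mul (abs_nonneg _)]
    congr 1
    push_cast
    ring
  unfold bellman
  simp only [e, Real.rpow_one]
  rw [zero_pow two_ne_zero, add_zero]
  have hmax : a ^ 2 * (|a| ^ (p - 1) + |b|) ^ (2 - q) ≤
      2 ^ (2 - q) * |a| ^ p + 2 ^ (2 - q) * |b| ^ q := by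
    rcases le_total (|a| ^ (p - 1)) |b| with h | h
    · have h1 : |a| ≤ |b| ^ (q - 1) := by
        calc |a| = (|a| ^ (p - 1)) ^ (q - 1) := by
              rw [← Real.rpow_mul (abs_nonneg _), mul_comm, hpq1, Real.rpow_one]
          _ ≤ _ := Real.rpow_le_rpow (by positivity) h (by linarith)
      have h2 : a ^ 2 * (|a| ^ (p - 1) + |b|) ^ (2 - q) ≤ 2 ^ (2 - q) * |b| ^ q := by
        rcases (abs_nonneg b).eq_or_lt with hb | hb
        · rw [← hb, Real.zero_rpow (by linarith)] at h1
          have : a = 0 := abs_eq_zero.1 (le_antisymm h1 (abs_nonneg _))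
          rw [this]
          simp only [ne_eq, OfNat.ofNat_ne_zero, not_false_eq_true, zero_pow, zero_mul]
          positivity
        · calc a ^ 2 * (|a| ^ (p - 1) + |b|) ^ (2 - q)
              ≤ (|b| ^ (q - 1)) ^ 2 * (2 * |b|) ^ (2 - q) := by
                rw [← sq_abs a]
                have : 0 ≤ 2 - q := by linarith
                gcongr
                linarith
            _ = 2 ^ (2 - q) * |b| ^ q := by
                rw [Real.mul_rpow (by norm_num) hb.le, ← Real.rpow_natCast, ← Real.rpow_mul hb.le,
                  mul_left_comm, ← Real.rpow_add hb]
                congr 2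
                push_cast
                ring
      exact h2.trans (le_add_of_nonneg_left (by positivity))
    · have h2 : a ^ 2 * (|a| ^ (p - 1) + |b|) ^ (2 - q) ≤ 2 ^ (2 - q) * |a| ^ p := by
        rcases (abs_nonneg a).eq_or_lt with ha | ha
        · rw [← sq_abs, ← ha]
          simp only [ne_eq, OfNat.ofNat_ne_zero, not_false_eq_true, zero_pow, zero_mul]
          positivity
        · calc a ^ 2 * (|a| ^ (p - 1) + |b|) ^ (2 - q)
              ≤ |a| ^ 2 * (2 * |a| ^ (p - 1)) ^ (2 - q) := by
                rw [← sq_abs a]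
                have : 0 ≤ 2 - q := by linarith
                gcongr
                linarith
            _ = 2 ^ (2 - q) * |a| ^ p := by
                rw [Real.mul_rpow (by norm_num) (by positivity), ← Real.rpow_natCast,
                  ← Real.rpow_mul ha.le, mul_left_comm, ← Real.rpow_add ha]
                congr 2
                push_cast
                linarith
      exact h2.trans (le_add_of_nonneg_right (by positivity))
  linarith

end Bellman

/-! ### The heat extension to space-time -/

section HeatFlow

variable {d : ℕ}

lemma norm_exp_two_pi_I_mul (s : ℝ) : ‖Complex.exp (2 * Real.pi * Complex.I * (s : ℝ))‖ = 1 := by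
  have : (2 * Real.pi * Complex.I * (s : ℝ) : ℂ) = ((2 * Real.pi * s : ℝ) : ℂ) * Complex.I := by
    push_cast
    ring
  rw [this, Complex.norm_exp_ofReal_mul_I]

lemma norm_heatSymbol (t : ℝ) (ξ : Sp d) :
    ‖heatSymbol t ξ‖ = Real.exp (-(4 * Real.pi ^ 2 * t * ‖ξ‖ ^ 2)) := by
  rw [heatSymbol, ← Complex.ofReal_neg, ← Complex.ofReal_exp, Complex.norm_real,
    Real.norm_of_nonneg (Real.exp_pos _).le]

lemma norm_heatSymbol_le {t : ℝ} (ht : 0 ≤ t) (ξ : Sp d) : ‖heatSymbol t ξ‖ ≤ 1 := by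
  rw [norm_heatSymbol, Real.exp_le_one_iff]
  have : 0 ≤ 4 * Real.pi ^ 2 * t * ‖ξ‖ ^ 2 := by positivity
  linarith

lemma integrable_norm_fourier (φ : Sch d) : Integrable fun ξ => ‖(𝓕 φ : Sch d) ξ‖ :=
  (𝓕 φ : Sch d).integrable.norm

lemma norm_heat_integrand_le {t : ℝ} (ht : 0 ≤ t) (φ : Sch d) (x ξ : Sp d) :
    ‖Complex.exp (2 * Real.pi * Complex.I * (inner ℝ ξ x : ℝ)) * (heatSymbol t ξ * (𝓕 φ) ξ)‖ ≤
      ‖(𝓕 φ : Sch d) ξ‖ := by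
  rw [norm_mul, norm_exp_two_pi_I_mul, one_mul, norm_mul]
  exact mul_le_of_le_one_left (norm_nonneg _) (norm_heatSymbol_le ht ξ)

lemma norm_heat_apply_le {t : ℝ} (ht : 0 ≤ t) (φ : Sch d) (x : Sp d) :
    ‖heat t φ x‖ ≤ ∫ ξ, ‖(𝓕 φ : Sch d) ξ‖ := by
  rw [heat_apply ht]
  refine (norm_integral_le_integral_norm _).trans ?_
  exact integral_mono_of_nonneg (Eventually.of_forall fun ξ => norm_nonneg _)
    (integrable_norm_fourier φ) (Eventually.of_forall fun ξ => norm_heat_integrand_le ht φ x ξ)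

/-- The heat extension of `φ` to the space-time, constant for negative times. -/
def heatExt (φ : Sch d) (p : ℝ × Sp d) : ℂ := heat (max p.1 0) φ p.2

lemma heatExt_of_nonneg {t : ℝ} (ht : 0 ≤ t) (φ : Sch d) (x : Sp d) :
    heatExt φ (t, x) = heat t φ x := by
  simp [heatExt, max_eq_left ht]

lemma norm_heatExt_le (φ : Sch d) (p : ℝ × Sp d) : ‖heatExt φ p‖ ≤ ∫ ξ, ‖(𝓕 φ : Sch d) ξ‖ :=
  norm_heat_apply_le (le_max_right _ _) φ p.2

lemma continuous_heatExt (φ : Sch d) : Continuous (heatExt φ) := by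
  have h : heatExt φ = fun p : ℝ × Sp d => ∫ ξ, Complex.exp (2 * Real.pi * Complex.I *
      (inner ℝ ξ p.2 : ℝ)) * (heatSymbol (max p.1 0) ξ * (𝓕 φ) ξ) := by
    ext p
    rw [heatExt, heat_apply (le_max_right _ _)]
  rw [h]
  have hc := (𝓕 φ : Sch d).continuous
  refine continuous_of_dominated (bound := fun ξ => ‖(𝓕 φ : Sch d) ξ‖) (fun p => ?_)
    (fun p => Eventually.of_forall fun ξ => norm_heat_integrand_le (le_max_right _ _) φ p.2 ξ)
    (integrable_norm_fourier φ) (Eventually.of_forall fun ξ => ?_)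
  · unfold heatSymbol
    exact Continuous.aestronglyMeasurable (by fun_prop)
  · unfold heatSymbol
    fun_prop

lemma hasDerivAt_heat {t : ℝ} (ht : 0 < t) (φ : Sch d) (x : Sp d) :
    HasDerivAt (fun s => heat s φ x) (heat t (lap φ) x) t := by
  have hc := (𝓕 φ : Sch d).continuous
  have hc2 := (𝓕 (lap φ) : Sch d).continuous
  have key := hasDerivAt_integral_of_dominated_loc_of_deriv_le (μ := (volume : Measure (Sp d)))
    (F := fun s ξ => Complex.exp (2 * Real.pi * Complex.I * (inner ℝ ξ x : ℝ)) *
        (heatSymbol s ξ * (𝓕 φ) ξ))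
    (F' := fun s ξ => Complex.exp (2 * Real.pi * Complex.I * (inner ℝ ξ x : ℝ)) *
        (heatSymbol s ξ * (𝓕 (lap φ)) ξ))
    (bound := fun ξ => ‖(𝓕 (lap φ) : Sch d) ξ‖) (Ioi_mem_nhds ht)
    (Eventually.of_forall fun s => ?_) ?_ ?_
    (Eventually.of_forall fun ξ s (hs : 0 < s) => ?_)
    (integrable_norm_fourier _) (Eventually.of_forall fun ξ s hs => ?_)
  · have h2 := key.2
    rw [← heat_apply ht.le] at h2
    refine h2.congr_of_eventuallyEq ?_
    filter_upwards [Ioi_mem_nhds ht] with s hs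
    exact heat_apply (le_of_lt hs) φ x
  · unfold heatSymbol
    exact Continuous.aestronglyMeasurable (by fun_prop)
  · refine (integrable_norm_fourier φ).mono' ?_
      (Eventually.of_forall fun ξ => norm_heat_integrand_le ht.le φ x ξ)
    unfold heatSymbol
    exact Continuous.aestronglyMeasurable (by fun_prop)
  · unfold heatSymbol
    exact Continuous.aestronglyMeasurable (by fun_prop)
  · exact norm_heat_integrand_le hs.le (lap φ) x ξ
  · have h1 : HasDerivAt (fun s : ℝ => heatSymbol s ξ)
        (heatSymbol s ξ * -((4 * Real.pi ^ 2 * ‖ξ‖ ^ 2 : ℝ) : ℂ)) s := by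
      unfold heatSymbol
      have : HasDerivAt (fun s : ℝ => (-((4 * Real.pi ^ 2 * s * ‖ξ‖ ^ 2 : ℝ) : ℂ)))
          (-((4 * Real.pi ^ 2 * ‖ξ‖ ^ 2 : ℝ) : ℂ)) s := by
        have h0 : HasDerivAt (fun s : ℝ => 4 * Real.pi ^ 2 * s * ‖ξ‖ ^ 2)
            (4 * Real.pi ^ 2 * ‖ξ‖ ^ 2) s := by
          simpa using ((hasDerivAt_id s).const_mul (4 * Real.pi ^ 2)).mul_const (‖ξ‖ ^ 2)
        exact h0.ofReal_comp.neg
      exact this.cexp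
    have h2 := (h1.mul_const ((𝓕 φ : Sch d) ξ)).const_mul
      (Complex.exp (2 * Real.pi * Complex.I * (inner ℝ ξ x : ℝ)))
    refine h2.congr_deriv ?_
    simp only [fourier_lap]
    ring

lemma integral_norm_heat_le {t : ℝ} (ht : 0 < t) (φ : Sch d) :
    ∫ x, ‖heat t φ x‖ ≤ ∫ x, ‖φ x‖ := by
  have h := eLpNorm_heat_le (r := 1) le_rfl (by simp) ht φ
  rw [eLpNorm_one_eq_lintegral_enorm, eLpNorm_one_eq_lintegral_enorm] at h
  rw [integral_norm_eq_lintegral_enorm (heat t φ).integrable.aestronglyMeasurable,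
    integral_norm_eq_lintegral_enorm φ.integrable.aestronglyMeasurable]
  exact ENNReal.toReal_mono φ.integrable.hasFiniteIntegral.ne h

/-- The measure on the space-time slab `(0, T] × ℝ^d`. -/
abbrev slab (d : ℕ) (T : ℝ) : Measure (ℝ × Sp d) :=
  ((volume : Measure ℝ).restrict (Ioc 0 T)).prod volume

lemma integrable_heatExt (φ : Sch d) (T : ℝ) : Integrable (heatExt φ) (slab d T) := by
  rw [integrable_prod_iff (continuous_heatExt φ).aestronglyMeasurable]
  constructor
  · exact Eventually.of_forall fun t => (heat (max t 0) φ).integrable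
  · have hm : AEStronglyMeasurable (fun t => ∫ x, ‖heatExt φ (t, x)‖)
        ((volume : Measure ℝ).restrict (Ioc 0 T)) :=
      ((continuous_heatExt φ).norm.aestronglyMeasurable (μ := slab d T)).integral_prod_right'
    refine Integrable.mono' (g := fun _ => ∫ x, ‖φ x‖) (integrable_const _) hm ?_
    filter_upwards [ae_restrict_mem measurableSet_Ioc] with t ht
    rw [Real.norm_of_nonneg (integral_nonneg fun _ => norm_nonneg _)]
    simp only [heatExt_of_nonneg ht.1.le]
    exact integral_norm_heat_le ht.1 φ

lemma integrable_slab_of_le {E : Type*} [NormedAddCommGroup E] {G : ℝ × Sp d → E} {T M : ℝ}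
    (hG : Continuous G) (φ ψ : Sch d) (h : ∀ p, ‖G p‖ ≤ M * (‖heatExt φ p‖ + ‖heatExt ψ p‖)) :
    Integrable G (slab d T) :=
  (((integrable_heatExt φ T).norm.add (integrable_heatExt ψ T).norm).const_mul M).mono'
    hG.aestronglyMeasurable (Eventually.of_forall h)

end HeatFlow

/-! ### Dissipation of the Bellman energy along the heat flow -/

section Energy

variable {d : ℕ}

lemma exists_norm_le_of_continuous {E F : Type*} [NormedAddCommGroup E] [ProperSpace E]
    [NormedAddCommGroup F] {Φ : E → F} (hΦ : Continuous Φ) (R : ℝ) :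
    ∃ M, 0 ≤ M ∧ ∀ z, ‖z‖ ≤ R → ‖Φ z‖ ≤ M := by
  obtain ⟨M, hM⟩ := (isCompact_closedBall (0 : E) R).exists_bound_of_continuousOn hΦ.continuousOn
  exact ⟨max M 0, le_max_right _ _, fun z hz => (hM z (by simpa using hz)).trans (le_max_left _ _)⟩

/-- The real parts of two complex numbers. -/
def rePair (a b : ℂ) : ℝ × ℝ := (a.re, b.re)

lemma norm_rePair_le (a b : ℂ) : ‖rePair a b‖ ≤ ‖a‖ + ‖b‖ := by
  rw [rePair, Prod.norm_def]
  refine max_le ?_ ?_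
  · exact (Complex.abs_re_le_norm a).trans (le_add_of_nonneg_right (norm_nonneg _))
  · exact (Complex.abs_re_le_norm b).trans (le_add_of_nonneg_left (norm_nonneg _))

lemma continuous_rePair {X : Type*} [TopologicalSpace X] {f g : X → ℂ} (hf : Continuous f)
    (hg : Continuous g) : Continuous fun x => rePair (f x) (g x) :=
  (Complex.continuous_re.comp hf).prodMk (Complex.continuous_re.comp hg)

lemma hasLineDerivAt_rePair (u v : Sch d) (i : Fin d) (x : Sp d) :
    HasLineDerivAt ℝ (fun y => rePair (u y) (v y)) (rePair (dd i u x) (dd i v x)) x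
      (EuclideanSpace.single i 1) := by
  have h : ∀ w : Sch d, HasFDerivAt (fun y => (w y).re)
      (Complex.reCLM.comp (fderiv ℝ w x)) x := fun w =>
    Complex.reCLM.hasFDerivAt.comp x (w.hasFDerivAt x)
  have := ((h u).prodMk (h v)).hasLineDerivAt (EuclideanSpace.single i 1)
  simpa [rePair, dd_apply, pd] using! this

/-- Integration by parts in each coordinate, with the chain rule for `fderiv ℝ W`. The pair takes
values in a ball, where the derivatives of `W` are bounded, so Schwartz decay provides the
integrability. -/
lemma integral_fderiv_lap {W : ℝ × ℝ → ℝ} (hW : ContDiff ℝ 2 W) (u v : Sch d) :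
    Integrable (fun x => ∑ i, fderiv ℝ (fderiv ℝ W) (rePair (u x) (v x))
        (rePair (dd i u x) (dd i v x)) (rePair (dd i u x) (dd i v x))) ∧
    ∫ x, fderiv ℝ W (rePair (u x) (v x)) (rePair (lap u x) (lap v x)) =
      -∫ x, ∑ i, fderiv ℝ (fderiv ℝ W) (rePair (u x) (v x))
        (rePair (dd i u x) (dd i v x)) (rePair (dd i u x) (dd i v x)) := by
  have hW1 : ContDiff ℝ 1 (fderiv ℝ W) := hW.fderiv_right (by norm_num)
  have hc1 : Continuous (fderiv ℝ W) := hW1.continuous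
  have hc2 : Continuous (fderiv ℝ (fderiv ℝ W)) := hW1.continuous_fderiv (by simp)
  have hub : ∀ w : Sch d, ∃ R, ∀ x, ‖w x‖ ≤ R := fun w =>
    ⟨_, fun x => SchwartzMap.norm_le_seminorm ℝ w x⟩
  obtain ⟨Ru, hRu⟩ := hub u
  obtain ⟨Rv, hRv⟩ := hub v
  have hR : ∀ x, ‖rePair (u x) (v x)‖ ≤ Ru + Rv := fun x =>
    (norm_rePair_le _ _).trans (add_le_add (hRu x) (hRv x))
  obtain ⟨M₁, hM₁0, hM₁⟩ := exists_norm_le_of_continuous hc1 (Ru + Rv)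
  obtain ⟨M₂, hM₂0, hM₂⟩ := exists_norm_le_of_continuous
    (F := ℝ × ℝ →L[ℝ] ℝ × ℝ →L[ℝ] ℝ) (Φ := fderiv ℝ (fderiv ℝ W)) hc2 (Ru + Rv)
  have hG : Continuous fun x => rePair (u x) (v x) := continuous_rePair u.continuous v.continuous
  have hgi : ∀ a b : Sch d, Integrable fun x => rePair (a x) (b x) := fun a b =>
    (a.integrable.norm.add b.integrable.norm).mono'
      (continuous_rePair a.continuous b.continuous).aestronglyMeasurable
      (Eventually.of_forall fun x => norm_rePair_le _ _)
  have h1 : ∀ a b : Sch d, Integrable fun x =>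
      fderiv ℝ W (rePair (u x) (v x)) (rePair (a x) (b x)) := fun a b =>
    ((hgi a b).norm.const_mul M₁).mono'
      ((hc1.comp hG).clm_apply (continuous_rePair a.continuous b.continuous)).aestronglyMeasurable
      (Eventually.of_forall fun x => (ContinuousLinearMap.le_opNorm _ _).trans
        (by gcongr; exact hM₁ _ (hR x)))
  have h2 : ∀ i : Fin d, Integrable fun x => fderiv ℝ (fderiv ℝ W) (rePair (u x) (v x))
        (rePair (dd i u x) (dd i v x)) (rePair (dd i u x) (dd i v x)) := fun i => by
    obtain ⟨Su, hSu⟩ := hub (dd i u)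
    obtain ⟨Sv, hSv⟩ := hub (dd i v)
    refine ((hgi (dd i u) (dd i v)).norm.const_mul (M₂ * (Su + Sv))).mono' ?_ ?_
    · have := continuous_rePair (dd i u).continuous (dd i v).continuous
      exact (((hc2.comp hG).clm_apply this).clm_apply this).aestronglyMeasurable
    · refine Eventually.of_forall fun x => (ContinuousLinearMap.le_opNorm₂ _ _ _).trans ?_
      gcongr
      · exact hM₂ _ (hR x)
      · exact (norm_rePair_le _ _).trans (add_le_add (hSu x) (hSv x))
  refine ⟨integrable_finsetSum _ fun i _ => h2 i, ?_⟩
  have e : ∀ x, fderiv ℝ W (rePair (u x) (v x)) (rePair (lap u x) (lap v x)) =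
      ∑ i, fderiv ℝ W (rePair (u x) (v x)) (rePair (dd i (dd i u) x) (dd i (dd i v) x)) := by
    intro x
    rw [← map_sum]
    congr 1
    rw [lap_eq_sum, lap_eq_sum, sum_apply, sum_apply]
    ext <;> simp [rePair, Prod.fst_sum, Prod.snd_sum]
  simp only [e]
  rw [integral_finsetSum _ fun i _ => h1 _ _, integral_finsetSum _ fun i _ => h2 i,
    ← Finset.sum_neg_distrib]
  refine Finset.sum_congr rfl fun i _ => ?_
  refine integral_bilinear_hasLineDerivAt_right_eq_neg_left_of_integrable
    (f := fun x => fderiv ℝ W (rePair (u x) (v x)))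
    (f' := fun x => fderiv ℝ (fderiv ℝ W) (rePair (u x) (v x)) (rePair (dd i u x) (dd i v x)))
    (g := fun x => rePair (dd i u x) (dd i v x)) (v := EuclideanSpace.single i (1 : ℝ))
    (B := ContinuousLinearMap.id ℝ ((ℝ × ℝ) →L[ℝ] ℝ)) (h2 i) (h1 _ _) (h1 _ _) ?_ ?_
  · intro x _
    have := (hW1.differentiable (by simp)).differentiableAt (x := rePair (u x) (v x))
    have h := hasLineDerivAt_rePair u v i x
    rw [HasLineDerivAt] at h ⊢
    refine HasFDerivAt.comp_hasDerivAt (0 : ℝ) ?_ h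
    simpa using! this.hasFDerivAt
  · intro x _
    exact hasLineDerivAt_rePair _ _ _ _

/-- `∫ W(P_t f, P_t h)` decreases at the rate of the Hessian term. By AM-GM with the weights `m` and
`m⁻¹` this rate is at least `2 ∫ |∂_j P_t f| |∂_k P_t h|`, for real parts. Integrate over `(0, T]`
and bound the final energy below by `W 0`. -/
lemma integral_heat_mul_le {W : ℝ × ℝ → ℝ} (hW : ContDiff ℝ 2 W) (hW0 : ∀ z, W 0 ≤ W z)
    (hH : ∀ z, ∃ m : ℝ, 0 < m ∧ ∀ v : ℝ × ℝ, m * v.1 ^ 2 + m⁻¹ * v.2 ^ 2 ≤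
        fderiv ℝ (fderiv ℝ W) z v v)
    {f h : Sch d} (hf : HasCompactSupport f) (hh : HasCompactSupport h) (j k : Fin d)
    {T : ℝ} (hT : 0 ≤ T) :
    ∫ t in (0 : ℝ)..T, ∫ x, |(heat t (dd j f) x).re| * |(heat t (dd k h) x).re| ≤
      (1 / 2) * ∫ x, (W (rePair (f x) (h x)) - W 0) := by
  have hW1 : ContDiff ℝ 1 (fderiv ℝ W) := hW.fderiv_right (by norm_num)
  have hc1 : Continuous (fderiv ℝ W) := hW1.continuous
  set G : ℝ × Sp d → ℝ × ℝ := fun p => rePair (heatExt f p) (heatExt h p) with hGd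
  have hG : Continuous G := continuous_rePair (continuous_heatExt f) (continuous_heatExt h)
  set R := (∫ ξ, ‖(𝓕 f : Sch d) ξ‖) + ∫ ξ, ‖(𝓕 h : Sch d) ξ‖ with hR
  have hGR : ∀ p, ‖G p‖ ≤ R := fun p =>
    (norm_rePair_le _ _).trans (add_le_add (norm_heatExt_le f p) (norm_heatExt_le h p))
  obtain ⟨M, hM0, hM⟩ := exists_norm_le_of_continuous hc1 R
  set F : ℝ × Sp d → ℝ := fun p =>
    fderiv ℝ W (G p) (rePair (heatExt (lap f) p) (heatExt (lap h) p)) with hFd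
  have hFc : Continuous F := (hc1.comp hG).clm_apply
    (continuous_rePair (continuous_heatExt _) (continuous_heatExt _))
  have hFi : Integrable F (slab d T) := by
    refine integrable_slab_of_le hFc (lap f) (lap h) (M := M) fun p => ?_
    refine (ContinuousLinearMap.le_opNorm _ _).trans ?_
    gcongr
    · exact hM _ (hGR p)
    · exact norm_rePair_le _ _
  have hftc : ∀ x, ∫ t in Ioc 0 T, F (t, x) = W (G (T, x)) - W (rePair (f x) (h x)) := by
    intro x
    rw [← intervalIntegral.integral_of_le hT]
    have e0 : rePair (f x) (h x) = G (0, x) := by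
      simp [hGd, heatExt_of_nonneg le_rfl, heat_zero]
    rw [e0]
    refine intervalIntegral.integral_eq_sub_of_hasDerivAt_of_le (f := fun t => W (G (t, x))) hT
      (hW.continuous.comp (hG.comp (by fun_prop))).continuousOn (fun t ht => ?_)
      (Continuous.intervalIntegrable
        (hFc.comp (by fun_prop : Continuous fun t : ℝ => (t, x))) _ _)
    have hu : ∀ φ : Sch d, HasDerivAt (fun s => heatExt φ (s, x)) (heatExt (lap φ) (t, x)) t := by
      intro φ
      rw [heatExt_of_nonneg ht.1.le]
      refine (hasDerivAt_heat ht.1 φ x).congr_of_eventuallyEq ?_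
      filter_upwards [Ioi_mem_nhds ht.1] with s hs
      exact heatExt_of_nonneg (le_of_lt hs) φ x
    have hre : ∀ φ : Sch d, HasDerivAt (fun s => (heatExt φ (s, x)).re)
        (heatExt (lap φ) (t, x)).re t := fun φ => by
      have := (Complex.reCLM.hasFDerivAt (x := heatExt φ (t, x))).comp_hasDerivAt t (hu φ)
      exact this
    exact ((hW.differentiable (by simp)).differentiableAt.hasFDerivAt).comp_hasDerivAt t
      ((hre f).prodMk (hre h))
  have hineq : ∀ t ∈ Ioc 0 T, 2 * ∫ x, |(heat t (dd j f) x).re| * |(heat t (dd k h) x).re| ≤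
      -∫ x, F (t, x) := by
    intro t ht
    obtain ⟨hi, he⟩ := integral_fderiv_lap hW (heat t f) (heat t h)
    have e : ∀ x, F (t, x) = fderiv ℝ W (rePair (heat t f x) (heat t h x))
        (rePair (lap (heat t f) x) (lap (heat t h) x)) := by
      intro x
      simp only [hFd, hGd, heatExt_of_nonneg ht.1.le, heat_lap ht.1.le]
    simp only [e]
    rw [he, neg_neg, ← integral_const_mul]
    refine integral_mono_of_nonneg (Eventually.of_forall fun x => by positivity) hi
      (Eventually.of_forall fun x => ?_)
    simp only [heat_dd ht.1.le]
    obtain ⟨m, hm, hmH⟩ := hH (rePair (heat t f x) (heat t h x))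
    set a := fun i => (dd i (heat t f) x).re with ha
    set b := fun i => (dd i (heat t h) x).re with hb
    calc 2 * (|a j| * |b k|) ≤ m * a j ^ 2 + m⁻¹ * b k ^ 2 := by
          have h := sq_nonneg (m * |a j| - |b k|)
          have e : m * a j ^ 2 + m⁻¹ * b k ^ 2 - 2 * (|a j| * |b k|) =
              (m * |a j| - |b k|) ^ 2 * m⁻¹ := by
            rw [← sq_abs (a j), ← sq_abs (b k)]
            field_simp
            ring
          have : 0 ≤ (m * |a j| - |b k|) ^ 2 * m⁻¹ := by positivity
          linarith
      _ ≤ m * ∑ i, a i ^ 2 + m⁻¹ * ∑ i, b i ^ 2 := by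
          gcongr
          · exact Finset.single_le_sum (f := fun i => a i ^ 2) (fun i _ => sq_nonneg _)
              (Finset.mem_univ j)
          · exact Finset.single_le_sum (f := fun i => b i ^ 2) (fun i _ => sq_nonneg _)
              (Finset.mem_univ k)
      _ = ∑ i, (m * a i ^ 2 + m⁻¹ * b i ^ 2) := by
          rw [Finset.mul_sum, Finset.mul_sum, Finset.sum_add_distrib]
      _ ≤ _ := Finset.sum_le_sum fun i _ => hmH (rePair (dd i (heat t f) x) (dd i (heat t h) x))
  -- `W 0` need not vanish and must be subtracted; the compact supports then make the difference
  -- integrable.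
  have hWi : Integrable fun x => W (rePair (f x) (h x)) - W 0 := by
    refine Continuous.integrable_of_hasCompactSupport
      ((hW.continuous.comp (continuous_rePair f.continuous h.continuous)).sub continuous_const) ?_
    have hs : HasCompactSupport fun x => (f x, h x) := by
      have := hf.union hh
      refine HasCompactSupport.intro this fun x hx => ?_
      have h1 : x ∉ tsupport f := fun h => hx (Or.inl h)
      have h2 : x ∉ tsupport h := fun h => hx (Or.inr h)
      rw [image_eq_zero_of_notMem_tsupport h1, image_eq_zero_of_notMem_tsupport h2]
      rfl
    exact hs.comp_left (g := fun c : ℂ × ℂ => W (rePair c.1 c.2) - W 0)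
      (by simp only [rePair, Prod.fst_zero, Prod.snd_zero, Complex.zero_re]; exact sub_self _)
  have hswap : ∫ t in Ioc 0 T, (∫ x, F (t, x)) =
      ∫ x, (W (G (T, x)) - W (rePair (f x) (h x))) := by
    rw [← integral_prod _ hFi, integral_prod_symm _ hFi]
    exact integral_congr_ae (Eventually.of_forall hftc)
  have hWi2 : Integrable fun x => W (G (T, x)) - W (rePair (f x) (h x)) :=
    hFi.integral_prod_right.congr (Eventually.of_forall hftc)
  rw [intervalIntegral.integral_of_le hT]
  have h1 : 2 * ∫ t in Ioc 0 T, ∫ x, |(heat t (dd j f) x).re| * |(heat t (dd k h) x).re| ≤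
      ∫ t in Ioc 0 T, -∫ x, F (t, x) := by
    rw [← integral_const_mul]
    refine integral_mono_of_nonneg (Eventually.of_forall fun t => ?_)
      hFi.integral_prod_left.neg ?_
    · exact mul_nonneg zero_le_two (integral_nonneg fun x => by positivity)
    · filter_upwards [ae_restrict_mem measurableSet_Ioc] with t ht
      exact hineq t ht
  rw [integral_neg, hswap] at h1
  have h2 : -∫ x, (W (G (T, x)) - W (rePair (f x) (h x))) ≤
      ∫ x, (W (rePair (f x) (h x)) - W 0) := by
    rw [← integral_neg]
    refine integral_mono hWi2.neg hWi fun x => ?_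
    have := hW0 (G (T, x))
    beta_reduce
    linarith
  linarith

end Energy

/-! ### Density of test functions in the Schwartz space -/

section Density

variable {d : ℕ}

/-- A test function, as a Schwartz function. -/
def testSch : Test d →ₗ[ℂ] Sch d where
  toFun φ := φ.hasCompactSupport.toSchwartzMap φ.contDiff
  map_add' _ _ := by ext; rfl
  map_smul' _ _ := by ext; rfl

@[simp] lemma testSch_apply (φ : Test d) (x : Sp d) : testSch φ x = φ x := rfl

lemma coe_testSch (φ : Test d) : (testSch φ : Sp d → ℂ) = φ := rfl

lemma hasCompactSupport_testSch (φ : Test d) : HasCompactSupport (testSch φ) := φ.hasCompactSupport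

lemma exists_testSch_eq {φ : Sch d} (h : HasCompactSupport φ) : ∃ ψ : Test d, testSch ψ = φ :=
  ⟨⟨φ, φ.smooth', h, subset_univ _⟩, by ext; rfl⟩

lemma hasCompactSupport_dd {φ : Sch d} (h : HasCompactSupport φ) (j : Fin d) :
    HasCompactSupport (dd j φ) := by
  obtain ⟨ψ, rfl⟩ := exists_testSch_eq h
  have := pd_hasCompactSupport j ψ
  rwa [← coe_testSch, ← funext (dd_apply j (testSch ψ))] at this

lemma hasCompactSupport_lap {φ : Sch d} (h : HasCompactSupport φ) : HasCompactSupport (lap φ) := by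
  have : (lap φ : Sp d → ℂ) = ∑ j, (dd j (dd j φ) : Sp d → ℂ) := by
    ext x
    rw [lap_eq_sum, sum_apply, Finset.sum_apply]
  rw [this]
  refine Finset.sum_induction _ (fun f : Sp d → ℂ => HasCompactSupport f) (fun _ _ => .add) .zero
    fun j _ => hasCompactSupport_dd (hasCompactSupport_dd h j) j

lemma hasCompactSupport_smul {φ : Sch d} (h : HasCompactSupport φ) (c : ℂ) :
    HasCompactSupport (c • φ : Sch d) :=
  h.comp_left (g := fun w => c * w) (mul_zero c)

/-- One power of `1 + ‖x‖` is traded for a factor `1 / n`: for `i = 0` the function vanishes on `‖x‖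
≤ n`, and for `i > 0` scaling gives `n^{-i} ≤ n^{-1}`. With the Leibniz rule, cutoffs then converge
in every Schwartz seminorm. -/
lemma exists_iteratedFDeriv_one_sub_bump_le (χ : ContDiffBump (0 : Sp d)) (hχ : χ.rIn = 1) (i : ℕ) :
    ∃ c, 0 ≤ c ∧ ∀ n : ℝ, 1 ≤ n → ∀ x,
      ‖iteratedFDeriv ℝ i (fun y => 1 - χ (n⁻¹ • y)) x‖ ≤ c / n * (1 + ‖x‖) := by
  have hsm : ContDiff ℝ i fun y => 1 - χ y := contDiff_const.sub χ.contDiff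
  rcases Nat.eq_zero_or_pos i with rfl | hi
  · refine ⟨1, zero_le_one, fun n hn x => ?_⟩
    have hn0 : 0 < n := by linarith
    rw [norm_iteratedFDeriv_zero, Real.norm_of_nonneg (sub_nonneg.2 χ.le_one)]
    rcases le_total ‖x‖ n with h | h
    · rw [χ.one_of_mem_closedBall]
      · rw [sub_self]
        positivity
      · rw [mem_closedBall_zero_iff, norm_smul, norm_inv, Real.norm_of_nonneg hn0.le, hχ,
          inv_mul_le_iff₀ hn0]
        simpa
    · have := χ.nonneg (x := n⁻¹ • x)
      have h2 : 1 ≤ 1 / n * (1 + ‖x‖) := by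
        rw [one_div, ← div_eq_inv_mul, le_div_iff₀ hn0]
        linarith
      linarith
  · have hcs : HasCompactSupport (iteratedFDeriv ℝ i χ) := χ.hasCompactSupport.iteratedFDeriv i
    obtain ⟨c, hc⟩ := hcs.exists_bound_of_continuous
      ((χ.contDiff (n := i)).continuous_iteratedFDeriv le_rfl)
    refine ⟨max c 0, le_max_right _ _, fun n hn x => ?_⟩
    have hn0 : 0 < n := by linarith
    rw [iteratedFDeriv_comp_const_smul n⁻¹ hsm, norm_smul]
    have e : iteratedFDeriv ℝ i (fun y => 1 - χ y) (n⁻¹ • x) = -iteratedFDeriv ℝ i χ (n⁻¹ • x) := by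
      have := iteratedFDeriv_sub_apply (𝕜 := ℝ) (i := i) (x := n⁻¹ • x) (f := fun _ : Sp d => (1 : ℝ))
        (g := χ) contDiffAt_const χ.contDiff.contDiffAt
      rw [iteratedFDeriv_const_of_ne hi.ne', Pi.zero_apply, zero_sub] at this
      exact this
    rw [e, norm_neg, norm_pow, norm_inv, Real.norm_of_nonneg hn0.le]
    have h1 : n⁻¹ ^ i ≤ n⁻¹ := pow_le_of_le_one (by positivity) (inv_le_one_of_one_le₀ hn) hi.ne'
    calc n⁻¹ ^ i * ‖iteratedFDeriv ℝ i χ (n⁻¹ • x)‖ ≤ n⁻¹ * max c 0 := by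
          gcongr
          exact (hc _).trans (le_max_left _ _)
      _ = max c 0 / n * 1 := by ring
      _ ≤ _ := by
          gcongr
          linarith [norm_nonneg x]

lemma dense_hasCompactSupport : Dense {φ : Sch d | HasCompactSupport φ} := by
  intro φ
  let χ : ContDiffBump (0 : Sp d) := ⟨1, 2, one_pos, one_lt_two⟩
  have hcs : ∀ n : ℕ, HasCompactSupport fun x => χ (((n : ℝ) + 1)⁻¹ • x) • φ x := by
    intro n
    refine HasCompactSupport.smul_right (f := fun x => χ (((n : ℝ) + 1)⁻¹ • x)) ?_
    exact χ.hasCompactSupport.comp_smul (by positivity)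
  have hsm : ∀ n : ℕ, ContDiff ℝ ∞ fun x => χ (((n : ℝ) + 1)⁻¹ • x) • φ x := fun n =>
    (χ.contDiff.comp (contDiff_const_smul _)).smul φ.smooth'
  refine mem_closure_of_tendsto (f := fun n : ℕ => (hcs n).toSchwartzMap (hsm n)) (b := atTop) ?_
    (Eventually.of_forall fun n => hcs n)
  rw [(schwartz_withSeminorms ℝ (Sp d) ℂ).tendsto_nhds]
  rintro ⟨k, m⟩ ε hε
  choose c hc0 hc using exists_iteratedFDeriv_one_sub_bump_le χ rfl
  set B : ℝ := ∑ i ∈ Finset.range (m + 1), (m.choose i : ℝ) * c i *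
    (SchwartzMap.seminorm ℝ k (m - i) φ + SchwartzMap.seminorm ℝ (k + 1) (m - i) φ) with hB
  have hB0 : 0 ≤ B := Finset.sum_nonneg fun i _ => by
    have := hc0 i
    positivity
  have hle : ∀ n : ℕ, schwartzSeminormFamily ℝ (Sp d) ℂ (k, m)
      ((hcs n).toSchwartzMap (hsm n) - φ) ≤ B / ((n : ℝ) + 1) := by
    intro n
    have hn : (1 : ℝ) ≤ (n : ℝ) + 1 := by linarith [n.cast_nonneg (α := ℝ)]
    rw [SchwartzMap.schwartzSeminormFamily_apply, map_sub_rev]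
    refine SchwartzMap.seminorm_le_bound ℝ k m _ (by positivity) fun x => ?_
    have e : ((φ - (hcs n).toSchwartzMap (hsm n) : Sch d) : Sp d → ℂ) =
        fun y => (fun y => 1 - χ (((n : ℝ) + 1)⁻¹ • y)) y • φ y := by
      ext y
      rw [sub_apply]
      simp only [HasCompactSupport.toSchwartzMap_toFun, sub_smul, one_smul]
    rw [e]
    have hs1 : ContDiff ℝ ∞ fun y => 1 - χ (((n : ℝ) + 1)⁻¹ • y) :=
      contDiff_const.sub (χ.contDiff.comp (contDiff_const_smul _))
    have hl := norm_iteratedFDeriv_smul_le hs1 φ.smooth' x (n := m) (by exact_mod_cast le_top)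
    calc ‖x‖ ^ k * ‖iteratedFDeriv ℝ m (fun y => (fun y => 1 - χ (((n : ℝ) + 1)⁻¹ • y)) y • φ y) x‖
        ≤ ‖x‖ ^ k * ∑ i ∈ Finset.range (m + 1), (m.choose i : ℝ) *
          ‖iteratedFDeriv ℝ i (fun y => 1 - χ (((n : ℝ) + 1)⁻¹ • y)) x‖ *
          ‖iteratedFDeriv ℝ (m - i) φ x‖ := by gcongr; exact hl
      _ ≤ ‖x‖ ^ k * ∑ i ∈ Finset.range (m + 1), (m.choose i : ℝ) *
          (c i / ((n : ℝ) + 1) * (1 + ‖x‖)) * ‖iteratedFDeriv ℝ (m - i) φ x‖ := by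
          gcongr with i hi
          exact hc i _ hn x
      _ = ∑ i ∈ Finset.range (m + 1), (m.choose i : ℝ) * c i *
          (‖x‖ ^ k * ‖iteratedFDeriv ℝ (m - i) φ x‖ +
            ‖x‖ ^ (k + 1) * ‖iteratedFDeriv ℝ (m - i) φ x‖) / ((n : ℝ) + 1) := by
          rw [Finset.mul_sum]
          refine Finset.sum_congr rfl fun i _ => ?_
          ring
      _ ≤ _ := by
          rw [hB, Finset.sum_div]
          gcongr with i hi
          · exact mul_nonneg (Nat.cast_nonneg _) (hc0 i)
          · exact SchwartzMap.le_seminorm ℝ k (m - i) φ x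
          · exact SchwartzMap.le_seminorm ℝ (k + 1) (m - i) φ x
  have hlim : Tendsto (fun n : ℕ => B / ((n : ℝ) + 1)) atTop (𝓝 0) := by
    have := tendsto_one_div_add_atTop_nhds_zero_nat (𝕜 := ℝ).const_mul B
    simpa [div_eq_mul_inv] using this
  filter_upwards [hlim.eventually (gt_mem_nhds hε)] with n hn
  exact (hle n).trans_lt hn

lemma denseRange_testSch : DenseRange (testSch : Test d → Sch d) := by
  refine dense_hasCompactSupport.mono fun φ hφ => ?_
  exact exists_testSch_eq hφ

end Density

/-! ### The bilinear embedding and its consequence for mixed derivatives -/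

section BilinearEmbedding

variable {d : ℕ}

lemma integrable_heatExt_mul (φ ψ : Sch d) (T : ℝ) :
    Integrable (fun p => ‖heatExt φ p‖ * ‖heatExt ψ p‖) (slab d T) :=
  (integrable_heatExt φ T).norm.mul_bdd (c := ∫ ξ, ‖(𝓕 ψ : Sch d) ξ‖)
    (continuous_heatExt ψ).norm.aestronglyMeasurable
    (Eventually.of_forall fun p => by rw [norm_norm]; exact norm_heatExt_le ψ p)

lemma integrable_heatExt_re_mul (φ ψ : Sch d) (T : ℝ) :
    Integrable (fun p => |(heatExt φ p).re| * |(heatExt ψ p).re|) (slab d T) := by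
  refine (integrable_heatExt_mul φ ψ T).mono' ?_ (Eventually.of_forall fun p => ?_)
  · have h1 := continuous_heatExt φ
    have h2 := continuous_heatExt ψ
    exact Continuous.aestronglyMeasurable (by fun_prop)
  · rw [Real.norm_of_nonneg (by positivity)]
    exact mul_le_mul (Complex.abs_re_le_norm _) (Complex.abs_re_le_norm _) (abs_nonneg _)
      (norm_nonneg _)

lemma integrable_rpow_norm {p : ℝ} (hp : 1 < p) (φ : Sch d) : Integrable fun x => ‖φ x‖ ^ p := by
  have h := (φ.memLp (ENNReal.ofReal p)).integrable_norm_rpow (by simp; linarith) (by simp)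
  rwa [ENNReal.toReal_ofReal (by linarith)] at h

lemma tendsto_bellman {p q K : ℝ} (hp : 2 ≤ p) (hpq : p.HolderConjugate q) (z : ℝ × ℝ) :
    Tendsto (fun n : ℕ => bellman p q K (1 / ((n : ℝ) + 1)) z) atTop (𝓝 (bellman p q K 0 z)) := by
  have hc : Continuous fun ε : ℝ => bellman p q K ε z :=
    (continuous_bellman hp hpq).comp (by fun_prop : Continuous fun ε : ℝ => (ε, z))
  exact (hc.tendsto 0).comp tendsto_one_div_add_atTop_nhds_zero_nat

/-- The energy estimate for `ε = 1 / (n + 1)`, then `ε → 0` on the right: the integrands are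
uniformly bounded and supported in a fixed compact set. The limit is needed because the bound by
pure powers is available at `ε = 0`. -/
lemma integral_slab_le_of_two_le {p q : ℝ} (hp : 2 ≤ p) (hpq : p.HolderConjugate q) :
    ∃ C, 0 ≤ C ∧ ∀ f h : Sch d, HasCompactSupport f → HasCompactSupport h → ∀ (j k : Fin d) (T : ℝ),
      0 ≤ T → ∫ w, |(heatExt (dd j f) w).re| * |(heatExt (dd k h) w).re| ∂(slab d T) ≤
        C * ((∫ x, ‖f x‖ ^ p) + ∫ x, ‖h x‖ ^ q) := by
  have hq1 := hpq.symm.lt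
  have hq0 := hpq.symm.pos
  have hp1 := hpq.lt
  have hq2 : q ≤ 2 := by
    have := hpq.mul_eq_add
    nlinarith
  set K : ℝ := 11 / (q * (q - 1)) with hKd
  have hqq : 0 < q * (q - 1) := mul_pos hq0 (by linarith)
  have hK0 : 0 ≤ K := by positivity
  have hK : 11 ≤ K * (q * (q - 1)) := by
    rw [hKd, div_mul_cancel₀ _ hqq.ne']
  refine ⟨2 ^ (2 - q) + K, by positivity, fun f h hf hh j k T hT => ?_⟩
  set W := fun ε : ℝ => bellman p q K ε with hW
  set W₀ : ℝ × ℝ → ℝ := bellman p q K 0 with hW₀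
  have hcont := continuous_bellman (K := K) hp hpq
  have hlhs : ∫ w, |(heatExt (dd j f) w).re| * |(heatExt (dd k h) w).re| ∂(slab d T) =
      ∫ t in (0 : ℝ)..T, ∫ x, |(heat t (dd j f) x).re| * |(heat t (dd k h) x).re| := by
    rw [integral_prod _ (integrable_heatExt_re_mul _ _ T), intervalIntegral.integral_of_le hT]
    refine setIntegral_congr_fun measurableSet_Ioc fun t ht => ?_
    simp only [heatExt_of_nonneg ht.1.le]
  have h1 : ∀ n : ℕ, ∫ w, |(heatExt (dd j f) w).re| * |(heatExt (dd k h) w).re| ∂(slab d T) ≤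
      (1 / 2) * ∫ x, (W (1 / ((n : ℝ) + 1)) (rePair (f x) (h x)) - W (1 / ((n : ℝ) + 1)) 0) := by
    intro n
    have hε : (0 : ℝ) < 1 / ((n : ℝ) + 1) := by positivity
    rw [hlhs]
    exact integral_heat_mul_le (contDiff_bellman hε) (bellman_zero_le hp hpq hq2 hK0 _)
      (bellman_hessian hp hpq hK hε) hf hh j k hT
  obtain ⟨M, hM0, hM⟩ := exists_norm_le_of_continuous hcont
    (max 1 (SchwartzMap.seminorm ℝ 0 0 f + SchwartzMap.seminorm ℝ 0 0 h))
  have hMb : ∀ (n : ℕ) x, ‖W (1 / ((n : ℝ) + 1)) (rePair (f x) (h x))‖ ≤ M := by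
    intro n x
    refine hM (1 / ((n : ℝ) + 1), rePair (f x) (h x)) ?_
    rw [Prod.norm_def]
    refine max_le_max ?_ ?_
    · rw [Real.norm_of_nonneg (by positivity)]
      exact Nat.one_div_le_one_div (Nat.zero_le n) |>.trans (by simp)
    · exact (norm_rePair_le _ _).trans
        (add_le_add (SchwartzMap.norm_le_seminorm ℝ f x) (SchwartzMap.norm_le_seminorm ℝ h x))
  have hMb0 : ∀ n : ℕ, ‖W (1 / ((n : ℝ) + 1)) 0‖ ≤ M := by
    intro n
    refine hM (1 / ((n : ℝ) + 1), 0) ?_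
    rw [Prod.norm_def]
    refine max_le ?_ (by simp)
    rw [Real.norm_of_nonneg (by positivity)]
    exact (Nat.one_div_le_one_div (Nat.zero_le n) |>.trans (by simp)).trans (le_max_left _ _)
  have hlim : Tendsto (fun n : ℕ => (1 / 2) * ∫ x, (W (1 / ((n : ℝ) + 1)) (rePair (f x) (h x)) -
      W (1 / ((n : ℝ) + 1)) 0)) atTop
      (𝓝 ((1 / 2) * ∫ x, (W₀ (rePair (f x) (h x)) - W₀ 0))) := by
    refine Tendsto.const_mul _ ?_
    set S := tsupport f ∪ tsupport h with hS
    have hScompact : IsCompact S := hf.isCompact.union hh.isCompact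
    refine tendsto_integral_of_dominated_convergence (S.indicator fun _ => 2 * M)
      (fun n => ?_) ?_ (fun n => Eventually.of_forall fun x => ?_)
      (Eventually.of_forall fun x => ?_)
    · have hr := continuous_rePair f.continuous h.continuous
      refine Continuous.aestronglyMeasurable (Continuous.sub ?_ continuous_const)
      exact hcont.comp (continuous_const.prodMk hr)
    · exact (integrable_indicator_iff hScompact.measurableSet).2
        (integrableOn_const hScompact.measure_lt_top.ne)
    · by_cases hx : x ∈ S
      · rw [indicator_of_mem hx]
        refine (norm_sub_le _ _).trans ?_
        linarith [hMb n x, hMb0 n]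
      · have h1 : x ∉ tsupport f := fun h => hx (Or.inl h)
        have h2 : x ∉ tsupport h := fun h => hx (Or.inr h)
        rw [indicator_of_notMem hx, image_eq_zero_of_notMem_tsupport h1,
          image_eq_zero_of_notMem_tsupport h2]
        have : rePair 0 0 = 0 := rfl
        rw [this, sub_self, norm_zero]
    · exact (tendsto_bellman hp hpq _).sub (tendsto_bellman hp hpq _)
  refine (ge_of_tendsto' hlim h1).trans ?_
  have hpt : ∀ x, W₀ (rePair (f x) (h x)) - W₀ 0 ≤
      (2 ^ (2 - q) + K) * (‖f x‖ ^ p + ‖h x‖ ^ q) := by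
    intro x
    have h0 : 0 ≤ W₀ 0 := by
      simp only [hW₀, bellman]
      positivity
    have h1 := bellman_eps_zero_le (K := K) hp hpq (rePair (f x) (h x))
    have h2 : |(rePair (f x) (h x)).1| ^ p ≤ ‖f x‖ ^ p :=
      Real.rpow_le_rpow (abs_nonneg _) (Complex.abs_re_le_norm _) (by linarith)
    have h3 : |(rePair (f x) (h x)).2| ^ q ≤ ‖h x‖ ^ q :=
      Real.rpow_le_rpow (abs_nonneg _) (Complex.abs_re_le_norm _) (by linarith)
    have h4 : (0 : ℝ) ≤ 2 ^ (2 - q) := by positivity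
    have h5 : 0 ≤ ‖f x‖ ^ p := by positivity
    calc W₀ (rePair (f x) (h x)) - W₀ 0 ≤ W₀ (rePair (f x) (h x)) := by linarith
      _ ≤ _ := h1
      _ ≤ 2 ^ (2 - q) * ‖f x‖ ^ p + (2 ^ (2 - q) + K) * ‖h x‖ ^ q := by gcongr
      _ ≤ _ := by nlinarith
  have hif := integrable_rpow_norm hp1 f
  have hih := integrable_rpow_norm hq1 h
  have hint : ∫ x, (W₀ (rePair (f x) (h x)) - W₀ 0) ≤
      (2 ^ (2 - q) + K) * ((∫ x, ‖f x‖ ^ p) + ∫ x, ‖h x‖ ^ q) := by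
    rw [← integral_add hif hih, ← integral_const_mul]
    refine integral_mono_of_nonneg (Eventually.of_forall fun x => ?_)
      ((hif.add hih).const_mul _) (Eventually.of_forall hpt)
    exact sub_nonneg.2 (bellman_zero_le hp hpq hq2 hK0 _ _)
  have hnn : 0 ≤ (2 ^ (2 - q) + K) * ((∫ x, ‖f x‖ ^ p) + ∫ x, ‖h x‖ ^ q) := by
    have h1 : 0 ≤ ∫ x, ‖f x‖ ^ p := integral_nonneg fun x => by positivity
    have h2 : 0 ≤ ∫ x, ‖h x‖ ^ q := integral_nonneg fun x => by positivity
    positivity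
  linarith

/-- The bilinear embedding for the heat semigroup. -/
lemma integral_slab_le {p q : ℝ} (hpq : p.HolderConjugate q) :
    ∃ C, 0 ≤ C ∧ ∀ f h : Sch d, HasCompactSupport f → HasCompactSupport h → ∀ (j k : Fin d) (T : ℝ),
      0 ≤ T → ∫ w, |(heatExt (dd j f) w).re| * |(heatExt (dd k h) w).re| ∂(slab d T) ≤
        C * ((∫ x, ‖f x‖ ^ p) + ∫ x, ‖h x‖ ^ q) := by
  rcases le_total 2 p with hp | hp
  · exact integral_slab_le_of_two_le hp hpq
  · have hq : 2 ≤ q := by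
      have h1 := hpq.mul_eq_add
      have h2 := hpq.lt
      nlinarith
    obtain ⟨C, hC, h⟩ := integral_slab_le_of_two_le (d := d) hq hpq.symm
    refine ⟨C, hC, fun f g hf hg j k T hT => ?_⟩
    have := h g f hg hf k j T hT
    rw [add_comm (∫ x, ‖f x‖ ^ p)]
    simpa only [mul_comm] using this

lemma heatExt_smul (c : ℂ) (φ : Sch d) (w : ℝ × Sp d) : heatExt (c • φ) w = c * heatExt φ w := by
  simp only [heatExt, map_smul, smul_apply, smul_eq_mul]

/-- Multiplication by `-i` turns imaginary parts into real parts, so four real estimates give the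
complex one; hence the factor `4`. -/
lemma integral_slab_norm_le {p q : ℝ} (hpq : p.HolderConjugate q) :
    ∃ C, 0 ≤ C ∧ ∀ f h : Sch d, HasCompactSupport f → HasCompactSupport h → ∀ (j k : Fin d) (T : ℝ),
      0 ≤ T → ∫ w, ‖heatExt (dd j f) w‖ * ‖heatExt (dd k h) w‖ ∂(slab d T) ≤
        C * ((∫ x, ‖f x‖ ^ p) + ∫ x, ‖h x‖ ^ q) := by
  obtain ⟨C, hC, H⟩ := integral_slab_le (d := d) hpq
  refine ⟨4 * C, by positivity, fun f h hf hh j k T hT => ?_⟩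
  set f' : Sch d := (-Complex.I) • f with hf'
  set h' : Sch d := (-Complex.I) • h with hh'
  have cf : HasCompactSupport f' := hasCompactSupport_smul hf _
  have ch : HasCompactSupport h' := hasCompactSupport_smul hh _
  have nf : ∀ x, ‖f' x‖ = ‖f x‖ := fun x => by simp [hf']
  have nh : ∀ x, ‖h' x‖ = ‖h x‖ := fun x => by simp [hh']
  have him : ∀ (φ : Sch d) (i : Fin d) w,
      (heatExt (dd i ((-Complex.I) • φ)) w).re = (heatExt (dd i φ) w).im := by
    intro φ i w
    rw [map_smul, heatExt_smul]
    simp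
  have h1 := H f h hf hh j k T hT
  have h2 := H f h' hf ch j k T hT
  have h3 := H f' h cf hh j k T hT
  have h4 := H f' h' cf ch j k T hT
  simp only [nf, nh] at h2 h3 h4
  have i1 := integrable_heatExt_re_mul (dd j f) (dd k h) T
  have i2 := integrable_heatExt_re_mul (dd j f) (dd k h') T
  have i3 := integrable_heatExt_re_mul (dd j f') (dd k h) T
  have i4 := integrable_heatExt_re_mul (dd j f') (dd k h') T
  have hsum : ∫ w, ‖heatExt (dd j f) w‖ * ‖heatExt (dd k h) w‖ ∂(slab d T) ≤
      ∫ w, ((|(heatExt (dd j f) w).re| * |(heatExt (dd k h) w).re| +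
        |(heatExt (dd j f) w).re| * |(heatExt (dd k h') w).re|) +
        (|(heatExt (dd j f') w).re| * |(heatExt (dd k h) w).re| +
        |(heatExt (dd j f') w).re| * |(heatExt (dd k h') w).re|)) ∂(slab d T) := by
    refine integral_mono (integrable_heatExt_mul _ _ T) ((i1.add i2).add (i3.add i4)) fun w => ?_
    rw [hf', hh', him, him, ← mul_add, ← mul_add, ← add_mul]
    exact mul_le_mul (Complex.norm_le_abs_re_add_abs_im _) (Complex.norm_le_abs_re_add_abs_im _)
      (norm_nonneg _) (by positivity)
  have e := integral_add (i1.add i2) (i3.add i4)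
  simp only [Pi.add_apply] at e
  rw [e, integral_add i1 i2, integral_add i3 i4] at hsum
  linarith

/-- This integral bounds the sup norm of the heat flow of `∂_j φ`. The flow damps every frequency
except `0`, where the Fourier transform of a derivative vanishes. -/
lemma tendsto_integral_norm_heatSymbol_mul (φ : Sch d) (j : Fin d) :
    Tendsto (fun n : ℕ => ∫ ξ, ‖heatSymbol (n : ℝ) ξ * (𝓕 (dd j φ) : Sch d) ξ‖) atTop (𝓝 0) := by
  have : (0 : ℝ) = ∫ _ : Sp d, (0 : ℝ) := by simp
  rw [this]
  refine tendsto_integral_of_dominated_convergence (fun ξ => ‖(𝓕 (dd j φ) : Sch d) ξ‖)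
    (fun n => ?_) (integrable_norm_fourier _) (fun n => Eventually.of_forall fun ξ => ?_)
    (Eventually.of_forall fun ξ => ?_)
  · have := (𝓕 (dd j φ) : Sch d).continuous
    unfold heatSymbol
    exact Continuous.aestronglyMeasurable (by fun_prop)
  · rw [norm_norm, norm_mul]
    exact mul_le_of_le_one_left (norm_nonneg _) (norm_heatSymbol_le n.cast_nonneg ξ)
  · rcases eq_or_ne ξ 0 with rfl | hξ
    · simp [fourier_dd]
    · simp only [norm_mul, norm_heatSymbol]
      rw [← zero_mul ‖(𝓕 (dd j φ) : Sch d) ξ‖]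
      refine Tendsto.mul_const _ (Real.tendsto_exp_neg_atTop_nhds_zero.comp ?_)
      have hc : 0 < 4 * Real.pi ^ 2 * ‖ξ‖ ^ 2 := by positivity
      have := (tendsto_natCast_atTop_atTop (R := ℝ)).const_mul_atTop hc
      refine this.congr fun n => ?_
      ring

/-- For `a = ∂_j φ` and `b = ∂_k h`, the `t`-derivative of `∫ P_t a P_t b` is `2 ∫ P_t Δa P_t b`.
Since `Δa = ∂_j Δφ`, its time integral is controlled by the bilinear embedding for `Δφ` and `h`. The
value at time `n` tends to `0`, which leaves `∫ a b`. -/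
lemma norm_integral_dd_mul_dd_le_add {p q : ℝ} (hpq : p.HolderConjugate q) :
    ∃ C, 0 ≤ C ∧ ∀ φ h : Sch d, HasCompactSupport φ → HasCompactSupport h → ∀ (j k : Fin d),
      ‖∫ x, dd j φ x * dd k h x‖ ≤ C * ((∫ x, ‖lap φ x‖ ^ p) + ∫ x, ‖h x‖ ^ q) := by
  obtain ⟨C, hC, H⟩ := integral_slab_norm_le (d := d) hpq
  refine ⟨2 * C, by positivity, fun φ h hφ hh j k => ?_⟩
  set a := dd j φ with ha
  set b := dd k h with hb
  set F : ℝ × Sp d → ℂ := fun w =>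
    heatExt (lap a) w * heatExt b w + heatExt a w * heatExt (lap b) w with hF
  have hFc : Continuous F := ((continuous_heatExt _).mul (continuous_heatExt _)).add
    ((continuous_heatExt _).mul (continuous_heatExt _))
  have hmulI : ∀ (u v : Sch d) (T : ℝ), Integrable (fun w => heatExt u w * heatExt v w) (slab d T) :=
    fun u v T => (integrable_heatExt u T).mul_bdd (c := ∫ ξ, ‖(𝓕 v : Sch d) ξ‖)
      (continuous_heatExt v).aestronglyMeasurable (Eventually.of_forall (norm_heatExt_le v))
  have hFi : ∀ T, Integrable F (slab d T) := fun T => (hmulI _ _ T).add (hmulI _ _ T)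
  have hstep : ∀ n : ℕ, ‖∫ x, a x * b x‖ ≤ (∫ ξ, ‖heatSymbol (n : ℝ) ξ * (𝓕 a : Sch d) ξ‖) *
      (∫ x, ‖b x‖) + 2 * C * ((∫ x, ‖lap φ x‖ ^ p) + ∫ x, ‖h x‖ ^ q) := by
    intro n
    have hT : (0 : ℝ) ≤ n := n.cast_nonneg
    have hftc : ∀ x, ∫ t in Ioc 0 (n : ℝ), F (t, x) =
        heat (n : ℝ) a x * heat (n : ℝ) b x - a x * b x := by
      intro x
      rw [← intervalIntegral.integral_of_le hT]
      have hu : ∀ (t : ℝ), 0 < t → ∀ ψ : Sch d,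
          HasDerivAt (fun s => heatExt ψ (s, x)) (heatExt (lap ψ) (t, x)) t := by
        intro t ht ψ
        rw [heatExt_of_nonneg ht.le]
        refine (hasDerivAt_heat ht ψ x).congr_of_eventuallyEq ?_
        filter_upwards [Ioi_mem_nhds ht] with s hs
        exact heatExt_of_nonneg (le_of_lt hs) ψ x
      have hpair : Continuous fun t : ℝ => (t, x) := by fun_prop
      have := intervalIntegral.integral_eq_sub_of_hasDerivAt_of_le
        (f := fun t => heatExt a (t, x) * heatExt b (t, x)) (f' := fun t => F (t, x)) hT
        (((continuous_heatExt a).comp hpair).mul ((continuous_heatExt b).comp hpair)).continuousOn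
        (fun t ht => (hu t ht.1 a).mul (hu t ht.1 b))
        (Continuous.intervalIntegrable (hFc.comp hpair) _ _)
      rw [this]
      simp only [heatExt_of_nonneg hT, heatExt_of_nonneg le_rfl, heat_zero]
    have hx : ∀ t ∈ Ioc 0 (n : ℝ), ∫ x, F (t, x) =
        2 * ∫ x, heatExt (lap a) (t, x) * heatExt b (t, x) := by
      intro t ht
      have hi : ∀ u v : Sch d, Integrable fun x => u x * v x := fun u v =>
        u.integrable.mul_bdd (c := SchwartzMap.seminorm ℝ 0 0 v) v.continuous.aestronglyMeasurable
          (Eventually.of_forall fun x => SchwartzMap.norm_le_seminorm ℝ v x)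
      simp only [hF, heatExt_of_nonneg ht.1.le]
      rw [integral_add (hi _ _) (hi _ _), heat_lap ht.1.le b, integral_mul_lap,
        ← heat_lap ht.1.le a]
      ring
    have hswap : ∫ x, (heat (n : ℝ) a x * heat (n : ℝ) b x - a x * b x) =
        2 * ∫ w, heatExt (lap a) w * heatExt b w ∂(slab d n) := by
      calc ∫ x, (heat (n : ℝ) a x * heat (n : ℝ) b x - a x * b x)
          = ∫ x, ∫ t in Ioc 0 (n : ℝ), F (t, x) :=
            integral_congr_ae (Eventually.of_forall fun x => (hftc x).symm)
        _ = ∫ t in Ioc 0 (n : ℝ), ∫ x, F (t, x) := by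
            rw [← integral_prod_symm _ (hFi n), integral_prod _ (hFi n)]
        _ = ∫ t in Ioc 0 (n : ℝ), 2 * ∫ x, heatExt (lap a) (t, x) * heatExt b (t, x) :=
            setIntegral_congr_fun measurableSet_Ioc hx
        _ = _ := by rw [integral_const_mul, ← integral_prod _ (hmulI _ _ _)]
    have hi : ∀ u v : Sch d, Integrable fun x => u x * v x := fun u v =>
      u.integrable.mul_bdd (c := SchwartzMap.seminorm ℝ 0 0 v) v.continuous.aestronglyMeasurable
        (Eventually.of_forall fun x => SchwartzMap.norm_le_seminorm ℝ v x)
    rw [integral_sub (hi _ _) (hi _ _)] at hswap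
    have e : ∫ x, a x * b x = (∫ x, heat (n : ℝ) a x * heat (n : ℝ) b x) -
        2 * ∫ w, heatExt (lap a) w * heatExt b w ∂(slab d n) := by
      rw [← hswap]
      ring
    rw [e]
    refine (norm_sub_le _ _).trans (add_le_add ?_ ?_)
    · have hsup : ∀ x, ‖heat (n : ℝ) a x‖ ≤ ∫ ξ, ‖heatSymbol (n : ℝ) ξ * (𝓕 a : Sch d) ξ‖ := by
        intro x
        rw [heat_apply hT]
        refine (norm_integral_le_integral_norm _).trans (le_of_eq ?_)
        refine integral_congr_ae (Eventually.of_forall fun ξ => ?_)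
        simp only
        rw [norm_mul, norm_exp_two_pi_I_mul, one_mul]
      have hb1 : ∫ x, ‖heat (n : ℝ) b x‖ ≤ ∫ x, ‖b x‖ := by
        rcases hT.eq_or_lt with h0 | h0
        · rw [← h0, heat_zero]
        · exact integral_norm_heat_le h0 b
      calc ‖∫ x, heat (n : ℝ) a x * heat (n : ℝ) b x‖
          ≤ ∫ x, (∫ ξ, ‖heatSymbol (n : ℝ) ξ * (𝓕 a : Sch d) ξ‖) * ‖heat (n : ℝ) b x‖ := by
            refine norm_integral_le_of_norm_le ((heat (n : ℝ) b).integrable.norm.const_mul _)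
              (Eventually.of_forall fun x => ?_)
            rw [norm_mul]
            gcongr
            exact hsup x
        _ = (∫ ξ, ‖heatSymbol (n : ℝ) ξ * (𝓕 a : Sch d) ξ‖) * ∫ x, ‖heat (n : ℝ) b x‖ :=
            integral_const_mul _ _
        _ ≤ _ := by gcongr
    · rw [norm_mul, Complex.norm_ofNat, mul_assoc]
      gcongr
      refine (norm_integral_le_integral_norm _).trans ?_
      simp only [norm_mul]
      rw [ha, lap_dd, hb]
      exact H (lap φ) h (hasCompactSupport_lap hφ) hh j k n hT
  have hlim := ((tendsto_integral_norm_heatSymbol_mul φ j).mul_const (∫ x, ‖b x‖)).add_const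
    (2 * C * ((∫ x, ‖lap φ x‖ ^ p) + ∫ x, ‖h x‖ ^ q))
  rw [zero_mul, zero_add] at hlim
  exact ge_of_tendsto' hlim hstep

end BilinearEmbedding

/-! ### The pairing of `L^q` with Schwartz functions -/

section Pairing

variable {d : ℕ}

/-- A Schwartz function, as an element of `L^r`. -/
def toLr (r : ℝ≥0∞) [Fact (1 ≤ r)] : Sch d →L[ℂ] LSp d ℂ r := SchwartzMap.toLpCLM ℂ ℂ r volume

variable {q r : ℝ≥0∞} [Fact (1 ≤ q)] [Fact (1 ≤ r)]

lemma coeFn_toLr (φ : Sch d) : toLr r φ =ᵐ[volume] φ := φ.coeFn_toLp r volume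

lemma norm_toLr (φ : Sch d) : ‖toLr r φ‖ = (eLpNorm φ r volume).toReal := SchwartzMap.norm_toLp

lemma norm_toLr_le_of_eLpNorm_le {φ ψ : Sch d} {c : ℝ} (hc : 0 ≤ c)
    (h : eLpNorm φ r volume ≤ ENNReal.ofReal c * eLpNorm ψ r volume) :
    ‖toLr r φ‖ ≤ c * ‖toLr r ψ‖ := by
  rw [norm_toLr, norm_toLr]
  have := ENNReal.toReal_mono (ENNReal.mul_ne_top ENNReal.ofReal_ne_top (ψ.memLp r volume).2.ne) h
  rwa [ENNReal.toReal_mul, ENNReal.toReal_ofReal hc] at this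

lemma ofReal_norm_toLr (φ : Sch d) : ENNReal.ofReal ‖toLr r φ‖ = eLpNorm φ r volume := by
  rw [norm_toLr, ENNReal.ofReal_toReal (φ.memLp r volume).2.ne]

/-- Integration against an element of `L^q`, as a functional on Schwartz functions. -/
def pairS (r : ℝ≥0∞) [Fact (1 ≤ r)] [ENNReal.HolderConjugate q r] (u : LSp d ℂ q) :
    Sch d →L[ℂ] ℂ :=
  ((ContinuousLinearMap.mul ℂ ℂ).lpPairing volume q r u).comp (toLr r)

variable [ENNReal.HolderConjugate q r]

lemma lpPairing_apply (u : LSp d ℂ q) (v : LSp d ℂ r) :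
    (ContinuousLinearMap.mul ℂ ℂ).lpPairing volume q r u v = ∫ x, u x * v x := by
  rw [ContinuousLinearMap.lpPairing_eq_integral]
  rfl

lemma integral_mul_toLr (u : Sp d → ℂ) (φ : Sch d) :
    ∫ x, u x * toLr r φ x = ∫ x, u x * φ x := by
  refine integral_congr_ae ?_
  filter_upwards [coeFn_toLr (r := r) φ] with x hx
  rw [hx]

lemma pairS_apply (u : LSp d ℂ q) (φ : Sch d) : pairS r u φ = ∫ x, u x * φ x := by
  rw [pairS, ContinuousLinearMap.comp_apply, lpPairing_apply, integral_mul_toLr]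

lemma pairS_toLr (ψ φ : Sch d) : pairS r (toLr q ψ) φ = ∫ x, ψ x * φ x := by
  rw [pairS_apply]
  refine integral_congr_ae ?_
  filter_upwards [coeFn_toLr (r := q) ψ] with x hx
  rw [hx]

lemma norm_lpPairing_le (u : LSp d ℂ q) (v : LSp d ℂ r) :
    ‖(ContinuousLinearMap.mul ℂ ℂ).lpPairing volume q r u v‖ ≤ ‖u‖ * ‖v‖ := by
  rw [lpPairing_apply]
  have hint : Integrable fun x => u x * v x := (Lp.memLp u).integrable_mul (Lp.memLp v)
  have h1 : eLpNorm (fun x => u x * v x) 1 volume ≤ eLpNorm u q volume * eLpNorm v r volume := by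
    have := eLpNorm_smul_le_mul_eLpNorm (p := q) (q := r) (r := 1) (Lp.aestronglyMeasurable v)
      (Lp.aestronglyMeasurable u)
    exact this
  rw [eLpNorm_one_eq_lintegral_enorm] at h1
  rw [Lp.norm_def, Lp.norm_def, ← ENNReal.toReal_mul]
  refine (norm_integral_le_integral_norm _).trans ?_
  rw [integral_norm_eq_lintegral_enorm hint.aestronglyMeasurable]
  exact ENNReal.toReal_mono (ENNReal.mul_ne_top (Lp.memLp u).2.ne (Lp.memLp v).2.ne) h1

lemma norm_pairS_le (u : LSp d ℂ q) (φ : Sch d) : ‖pairS r u φ‖ ≤ ‖u‖ * ‖toLr r φ‖ :=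
  norm_lpPairing_le u _

lemma ae_eq_of_integral_test_eq {u v : Sp d → ℂ} (hu : LocallyIntegrable u)
    (hv : LocallyIntegrable v) (h : ∀ φ : Test d, ∫ x, u x * φ x = ∫ x, v x * φ x) :
    u =ᵐ[volume] v := by
  refine ae_eq_of_integral_contDiff_smul_eq hu hv fun g hg hgc => ?_
  have := h ⟨fun x => (g x : ℂ), Complex.ofRealCLM.contDiff.comp hg,
    hgc.comp_left (g := fun s : ℝ => (s : ℂ)) Complex.ofReal_zero, subset_univ _⟩
  simp only [Complex.real_smul, mul_comm (g _ : ℂ)]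
  exact this

lemma locallyIntegrable_Lp (u : LSp d ℂ q) : LocallyIntegrable (u : Sp d → ℂ) :=
  (Lp.memLp u).locallyIntegrable (Fact.out : 1 ≤ q)

lemma Lp_ext_of_test {u v : LSp d ℂ q} (h : ∀ φ : Test d, ∫ x, u x * φ x = ∫ x, v x * φ x) :
    u = v :=
  Lp.ext (ae_eq_of_integral_test_eq (locallyIntegrable_Lp u) (locallyIntegrable_Lp v) h)

/-- The bound represents pairing with `ψ` by an element of `L^q` of norm at most `M`. This element
acts as `ψ` on test functions, hence equals `ψ` almost everywhere. -/
lemma norm_toLr_le_of_forall_test (hr : r ≠ ⊤) (hq : q ≠ ⊤) {ψ : Sch d} {M : ℝ} (hM : 0 ≤ M)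
    (h : ∀ φ : Test d, ‖∫ x, ψ x * φ x‖ ≤ M * ‖toLr r (testSch φ)‖) : ‖toLr q ψ‖ ≤ M := by
  obtain ⟨u, hu, hu'⟩ := exists_Lp_of_bound (q := q) hr hq
    ((toLr r).toLinearMap.comp (testSch (d := d)))
    ((pairS r (toLr q ψ)).toLinearMap.comp testSch) hM (fun φ => by
      have := h φ
      simpa [pairS_toLr] using this)
  have : toLr q ψ = u := by
    refine Lp_ext_of_test fun φ => ?_
    have := hu' φ
    simp only [LinearMap.comp_apply, ContinuousLinearMap.coe_coe, pairS_apply,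
      integral_mul_toLr] at this
    exact this
  rwa [this]

end Pairing

/-! ### The Calderón–Zygmund inequality for second derivatives -/

section SecondDerivatives

variable {d : ℕ} {q r : ℝ≥0∞} [Fact (1 ≤ q)] [Fact (1 ≤ r)]

lemma integral_rpow_norm_eq (hr : r ≠ ⊤) (φ : Sch d) :
    ∫ x, ‖φ x‖ ^ r.toReal = ‖toLr r φ‖ ^ r.toReal := by
  have h1 : 1 ≤ r := Fact.out
  have hr0 : r ≠ 0 := (zero_lt_one.trans_le h1).ne'
  have hI : 0 ≤ ∫ x, ‖φ x‖ ^ r.toReal := integral_nonneg fun x => by positivity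
  rw [norm_toLr, (φ.memLp r volume).eLpNorm_eq_integral_rpow_norm hr0 hr,
    ENNReal.toReal_ofReal (by positivity), ← Real.rpow_mul hI,
    inv_mul_cancel₀ (ENNReal.toReal_pos hr0 hr).ne', Real.rpow_one]

/-- Turns an additive bound into a multiplicative one by normalising both factors. The choice `s = 1
/ (α + η)`, `t = 1 / (β + η)` with `η → 0` allows `α` or `β` to be zero. -/
lemma le_mul_of_forall_scaling {p q B C α β : ℝ} (hC : 0 ≤ C) (hα : 0 ≤ α) (hβ : 0 ≤ β)
    (hp : 0 < p) (hq : 0 < q)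
    (h : ∀ s t : ℝ, 0 < s → 0 < t → s * t * B ≤ C * ((s * α) ^ p + (t * β) ^ q)) :
    B ≤ 2 * C * α * β := by
  have key : ∀ η : ℝ, 0 < η → B ≤ 2 * C * (α + η) * (β + η) := by
    intro η hη
    have ha : 0 < α + η := by linarith
    have hb : 0 < β + η := by linarith
    have h1 := h (α + η)⁻¹ (β + η)⁻¹ (by positivity) (by positivity)
    have h2 : ((α + η)⁻¹ * α) ^ p ≤ 1 := by
      refine Real.rpow_le_one (by positivity) ?_ hp.le
      rw [inv_mul_le_iff₀ ha]
      linarith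
    have h3 : ((β + η)⁻¹ * β) ^ q ≤ 1 := by
      refine Real.rpow_le_one (by positivity) ?_ hq.le
      rw [inv_mul_le_iff₀ hb]
      linarith
    have h4 : (α + η)⁻¹ * (β + η)⁻¹ * B ≤ C * 2 :=
      h1.trans (mul_le_mul_of_nonneg_left (by linarith) hC)
    rw [← mul_inv, inv_mul_le_iff₀ (by positivity)] at h4
    linarith
  have hlim : Tendsto (fun η : ℝ => 2 * C * (α + η) * (β + η)) (𝓝[>] 0)
      (𝓝 (2 * C * (α + 0) * (β + 0))) := by
    have : Continuous fun η : ℝ => 2 * C * (α + η) * (β + η) := by fun_prop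
    exact (this.tendsto 0).mono_left nhdsWithin_le_nhds
  simp only [add_zero] at hlim
  exact ge_of_tendsto hlim (by filter_upwards [self_mem_nhdsWithin] with η hη using key η hη)

variable [ENNReal.HolderConjugate q r]

lemma exists_norm_integral_dd_mul_dd_le (hq : q ≠ ⊤) (hr : r ≠ ⊤) :
    ∃ C, 0 ≤ C ∧ ∀ φ h : Sch d, HasCompactSupport φ → HasCompactSupport h → ∀ j k : Fin d,
      ‖∫ x, dd j φ x * dd k h x‖ ≤ C * ‖toLr r (lap φ)‖ * ‖toLr q h‖ := by
  have hpq : r.toReal.HolderConjugate q.toReal := ENNReal.HolderConjugate.toReal_of_ne_top hr hq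
  obtain ⟨C, hC, H⟩ := norm_integral_dd_mul_dd_le_add (d := d) hpq
  refine ⟨2 * C, by positivity, fun φ h hφ hh j k => ?_⟩
  refine le_mul_of_forall_scaling hC (norm_nonneg _) (norm_nonneg _) hpq.pos hpq.symm.pos
    fun s t hs ht => ?_
  have h1 := H ((s : ℂ) • φ) ((t : ℂ) • h) (hasCompactSupport_smul hφ _)
    (hasCompactSupport_smul hh _) j k
  rw [integral_rpow_norm_eq hr, integral_rpow_norm_eq hq] at h1
  simp only [map_smul, smul_apply, smul_eq_mul, norm_smul, Complex.norm_real,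
    Real.norm_of_nonneg hs.le, Real.norm_of_nonneg ht.le] at h1
  have e : ∀ x, (s : ℂ) * dd j φ x * ((t : ℂ) * dd k h x) =
      ((s * t : ℝ) : ℂ) * (dd j φ x * dd k h x) := by
    intro x
    push_cast
    ring
  simp only [e] at h1
  rwa [integral_const_mul, norm_mul, Complex.norm_real, Real.norm_of_nonneg (by positivity)] at h1

/-- The second derivatives are controlled by the Laplacian in `L^r`. -/
lemma exists_norm_dd_dd_le (q : ℝ≥0∞) [Fact (1 ≤ q)] [ENNReal.HolderConjugate q r]
    (hq : q ≠ ⊤) (hr : r ≠ ⊤) :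
    ∃ C, 0 ≤ C ∧ ∀ (φ : Sch d) (j k : Fin d),
      ‖toLr r (dd j (dd k φ))‖ ≤ C * ‖toLr r (lap φ)‖ := by
  obtain ⟨C, hC, H⟩ := exists_norm_integral_dd_mul_dd_le (d := d) hq hr
  refine ⟨C, hC, fun φ j k => ?_⟩
  refine denseRange_testSch.induction_on (p := fun φ : Sch d =>
    ‖toLr r (dd j (dd k φ))‖ ≤ C * ‖toLr r (lap φ)‖) φ ?_ fun φ => ?_
  · refine isClosed_le ?_ ?_ <;> fun_prop
  · refine norm_toLr_le_of_forall_test hq hr (by positivity) fun h => ?_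
    have e : ∫ x, dd j (dd k (testSch φ)) x * h x =
        -∫ x, dd k (testSch φ) x * dd j (testSch h) x := by
      rw [integral_mul_dd, neg_neg]
      rfl
    rw [e, norm_neg]
    exact H _ _ (hasCompactSupport_testSch φ) (hasCompactSupport_testSch h) k j

end SecondDerivatives

/-! ### Resolvent estimates uniform on the sector -/

section Resolvent

variable {d : ℕ} {r : ℝ≥0∞} [Fact (1 ≤ r)]

lemma sin_half_le_cos {θ β : ℝ} (hβ : |β| < Real.pi - θ) (hθ : 0 < θ) :
    Real.sin (θ / 2) ≤ Real.cos (β / 2) := by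
  rw [← Real.cos_abs, abs_div, abs_two, ← Real.cos_pi_div_two_sub]
  refine Real.cos_le_cos_of_nonneg_of_le_pi (by positivity) ?_ ?_
  · linarith [Real.pi_pos]
  · linarith

lemma exists_norm_le_sub_lap (hr : r ≠ ⊤) {θ : ℝ} (hθ0 : 0 < θ) (hθ : θ < Real.pi / 2) :
    ∃ C, 0 ≤ C ∧ ∀ z ∈ Sector θ, ∀ w : Sch d,
      ‖z‖ * ‖toLr r w‖ ≤ C * ‖toLr r (z • w - lap w)‖ := by
  have hc : 0 < Real.sin (θ / 2) := Real.sin_pos_of_pos_of_lt_pi (by linarith) (by linarith)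
  refine ⟨(1 / Real.sin (θ / 2)) ^ (d / 2 : ℝ) * (1 / Real.sin (θ / 2)), by positivity, ?_⟩
  rintro z ⟨hz0, hz⟩ w
  have hzn : 0 < ‖z‖ := norm_pos_iff.2 hz0
  have h := norm_toLr_le_of_eLpNorm_le (by positivity)
    (eLpNorm_le_of_sub_lap Fact.out hr hz0 hc (sin_half_le_cos hz hθ0) w)
  refine (mul_le_mul_of_nonneg_left h hzn.le).trans (le_of_eq ?_)
  field_simp

/-- `L^r` norms in Taylor's formula `h ∂_j φ(x) = φ(x + h e) - φ(x) - ∫₀^h (h - s) ∂_j² φ(x + s e)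
ds`, with `h - s ≤ h` in the remainder. -/
lemma mul_norm_dd_le (hr : r ≠ ⊤) (φ : Sch d) (j : Fin d) {h : ℝ} (hh : 0 < h) :
    h * ‖toLr r (dd j φ)‖ ≤ 2 * ‖toLr r φ‖ + h ^ 2 * ‖toLr r (dd j (dd j φ))‖ := by
  set e : Sp d := EuclideanSpace.single j 1 with he
  set ν : Measure ℝ := volume.restrict (Ioc 0 h) with hν
  have hline : ∀ (ψ : Sch d) (x : Sp d) (s : ℝ),
      HasDerivAt (fun s : ℝ => ψ (x + s • e)) (dd j ψ (x + s • e)) s := by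
    intro ψ x s
    have h1 : HasDerivAt (fun s : ℝ => x + s • e) e s := by
      simpa using ((hasDerivAt_id s).smul_const e).const_add x
    rw [dd_apply]
    exact (ψ.hasFDerivAt _).comp_hasDerivAt s h1
  have htaylor : ∀ x, (h : ℂ) * dd j φ x = φ (x + h • e) - φ x -
      ∫ s, ((h - s : ℝ) : ℂ) * dd j (dd j φ) (x - (-s) • e) ∂ν := by
    intro x
    have hd : ∀ s ∈ uIcc 0 h, HasDerivAt
        (fun s : ℝ => ((h - s : ℝ) : ℂ) * dd j φ (x + s • e) + φ (x + s • e))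
        (((h - s : ℝ) : ℂ) * dd j (dd j φ) (x - (-s) • e)) s := by
      intro s _
      have h0 : HasDerivAt (fun s : ℝ => ((h - s : ℝ) : ℂ)) (-1) s := by
        have := ((hasDerivAt_id s).const_sub h).ofReal_comp
        simpa using this
      refine ((h0.mul (hline (dd j φ) x s)).add (hline φ x s)).congr_deriv ?_
      rw [neg_smul, sub_neg_eq_add]
      ring
    have := intervalIntegral.integral_eq_sub_of_hasDerivAt hd (Continuous.intervalIntegrable (by
      have := (dd j (dd j φ)).continuous
      fun_prop) _ _)
    rw [intervalIntegral.integral_of_le hh.le] at this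
    rw [hν, this]
    simp
  set I : Sp d → ℂ := fun x => ∫ s, ((h - s : ℝ) : ℂ) * dd j (dd j φ) (x - (-s) • e) ∂ν with hI
  have hIm : eLpNorm I r volume ≤ ENNReal.ofReal (h ^ 2 * ‖toLr r (dd j (dd j φ))‖) := by
    refine (eLpNorm_integral_mul_translate_le (k := fun s : ℝ => ((h - s : ℝ) : ℂ))
      (τ := fun s : ℝ => (-s) • e) (by fun_prop) (by fun_prop)
      (dd j (dd j φ)).continuous.measurable Fact.out hr).trans ?_
    rw [ENNReal.ofReal_mul (by positivity), ofReal_norm_toLr]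
    gcongr
    calc ∫⁻ s, ‖((h - s : ℝ) : ℂ)‖ₑ ∂ν ≤ ∫⁻ s, ENNReal.ofReal h ∂ν := by
          refine lintegral_mono_ae ?_
          filter_upwards [ae_restrict_mem measurableSet_Ioc] with s hs
          rw [← ofReal_norm, Complex.norm_real, Real.norm_of_nonneg (by linarith [hs.2])]
          exact ENNReal.ofReal_le_ofReal (by linarith [hs.1])
      _ = ENNReal.ofReal (h ^ 2) := by
          rw [lintegral_const, hν, Measure.restrict_apply_univ, Real.volume_Ioc, sub_zero,
            ← ENNReal.ofReal_mul hh.le, sq]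
  have hshift : MemLp (fun x => φ (x + h • e)) r volume ∧
      eLpNorm (fun x => φ (x + h • e)) r volume = eLpNorm φ r volume := by
    have hmp := measurePreserving_add_right (volume : Measure (Sp d)) (h • e)
    exact ⟨(φ.memLp r volume).comp_measurePreserving hmp,
      eLpNorm_comp_measurePreserving φ.continuous.aestronglyMeasurable hmp⟩
  have hIaes : AEStronglyMeasurable I volume := by
    have : I = fun x => φ (x + h • e) - φ x - (h : ℂ) * dd j φ x := by
      ext x
      rw [htaylor x]
      ring
    rw [this]
    have h1 := φ.continuous
    have h2 := (dd j φ).continuous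
    exact Continuous.aestronglyMeasurable (by fun_prop)
  have hfun : (fun x => (h : ℂ) * dd j φ x) = (fun x => φ (x + h • e)) - φ - I := by
    ext x
    exact htaylor x
  have hmain : eLpNorm (((h : ℂ) • dd j φ : Sch d)) r volume ≤
      ENNReal.ofReal (2 * ‖toLr r φ‖ + h ^ 2 * ‖toLr r (dd j (dd j φ))‖) := by
    have e1 : (((h : ℂ) • dd j φ : Sch d) : Sp d → ℂ) = fun x => (h : ℂ) * dd j φ x := by
      ext x
      simp
    rw [e1, hfun]
    refine (eLpNorm_sub_le (hshift.1.aestronglyMeasurable.sub φ.continuous.aestronglyMeasurable)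
      hIaes Fact.out).trans ?_
    rw [ENNReal.ofReal_add (by positivity) (by positivity)]
    refine add_le_add ((eLpNorm_sub_le hshift.1.aestronglyMeasurable
      φ.continuous.aestronglyMeasurable Fact.out).trans (le_of_eq ?_)) hIm
    rw [hshift.2, two_mul, ENNReal.ofReal_add (by positivity) (by positivity), ofReal_norm_toLr]
  have := ENNReal.toReal_mono ENNReal.ofReal_ne_top hmain
  rw [← norm_toLr, ENNReal.toReal_ofReal (by positivity), map_smul, norm_smul, Complex.norm_real,
    Real.norm_of_nonneg hh.le] at this
  exact this

/-- The resolvent estimates for the Laplacian in `L^r`. -/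
theorem exists_resolvent_bounds (q : ℝ≥0∞) [Fact (1 ≤ q)] [ENNReal.HolderConjugate q r]
    (hq : q ≠ ⊤) (hr : r ≠ ⊤) {θ : ℝ} (hθ0 : 0 < θ) (hθ : θ < Real.pi / 2) :
    ∃ C, 0 < C ∧ (∀ (φ : Sch d) (j k : Fin d),
        ‖toLr r (dd j (dd k φ))‖ ≤ C * ‖toLr r (lap φ)‖) ∧
      ∀ z ∈ Sector θ, ∀ w : Sch d,
        ‖z‖ * ‖toLr r w‖ ≤ C * ‖toLr r (z • w - lap w)‖ ∧
        ‖toLr r (lap w)‖ ≤ C * ‖toLr r (z • w - lap w)‖ ∧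
        ∀ j, Real.sqrt ‖z‖ * ‖toLr r (dd j w)‖ ≤ C * ‖toLr r (z • w - lap w)‖ := by
  obtain ⟨A, hA, hAdd⟩ := exists_norm_dd_dd_le (d := d) q hq hr
  obtain ⟨B, hB, hBw⟩ := exists_norm_le_sub_lap (d := d) hr hθ0 hθ
  refine ⟨A + 2 * B + A * (1 + B) + B + 1, by positivity, fun φ j k => ?_, fun z hz w => ?_⟩
  · refine (hAdd φ j k).trans ?_
    gcongr
    nlinarith [mul_nonneg hA hB]
  · set N := ‖toLr r (z • w - lap w)‖ with hN
    have hN0 : 0 ≤ N := norm_nonneg _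
    have h1 := hBw z hz w
    have hlap : ‖toLr r (lap w)‖ ≤ (1 + B) * N := by
      have e : toLr r (lap w) = z • toLr r w - toLr r (z • w - lap w) := by
        rw [map_sub, map_smul]
        abel
      rw [e]
      refine (norm_sub_le _ _).trans ?_
      rw [norm_smul]
      linarith
    have hAB := mul_nonneg hA hB
    refine ⟨h1.trans ?_, hlap.trans ?_, fun j => ?_⟩
    · gcongr
      nlinarith
    · refine mul_le_mul_of_nonneg_right ?_ hN0
      nlinarith
    · have hz0 : 0 < ‖z‖ := norm_pos_iff.2 hz.1
      set s := Real.sqrt ‖z‖ with hs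
      have hs0 : 0 < s := Real.sqrt_pos.2 hz0
      have hss : s ^ 2 = ‖z‖ := Real.sq_sqrt hz0.le
      -- The step `|z|^{-1/2}` balances the bound on `|z| w` against the one on the second
      -- derivative.
      have h2 := mul_norm_dd_le hr w j (inv_pos.2 hs0)
      have h3 := mul_le_mul_of_nonneg_left h2 (sq_nonneg s)
      have e1 : s ^ 2 * (s⁻¹ * ‖toLr r (dd j w)‖) = s * ‖toLr r (dd j w)‖ := by
        field_simp
      have e2 : s ^ 2 * (2 * ‖toLr r w‖ + s⁻¹ ^ 2 * ‖toLr r (dd j (dd j w))‖) =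
          2 * (‖z‖ * ‖toLr r w‖) + ‖toLr r (dd j (dd j w))‖ := by
        rw [← hss]
        field_simp
      rw [e1, e2] at h3
      have h4 : ‖toLr r (dd j (dd j w))‖ ≤ A * ((1 + B) * N) :=
        (hAdd w j j).trans (mul_le_mul_of_nonneg_left hlap hA)
      calc s * ‖toLr r (dd j w)‖ ≤ 2 * (B * N) + A * ((1 + B) * N) := by linarith
        _ = (2 * B + A * (1 + B)) * N := by ring
        _ ≤ _ := by
          refine mul_le_mul_of_nonneg_right ?_ hN0
          linarith

end Resolvent

/-! ### Approximation by functions in the range of `Δ` or of `(z - Δ)Δ` -/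

section Approximation

variable {d : ℕ}

lemma res_lap {z : ℂ} (hz : z ∈ Complex.slitPlane) (φ : Sch d) :
    res z (lap φ) = lap (res z φ) := by
  rw [lap_eq_sum, lap_eq_sum, map_sum]
  simp only [res_dd hz]

/-- The approximation `φ - s (s - Δ)⁻¹ φ = -Δ (s - Δ)⁻¹ φ` of `φ`, with `s = 1 / (n + 1)`. -/
def lowCut (n : ℕ) : Sch d →L[ℂ] Sch d := -(lap.comp (res (((1 / ((n : ℝ) + 1) : ℝ)) : ℂ)))

lemma ofReal_mem_slitPlane_of_nat (n : ℕ) : ((1 / ((n : ℝ) + 1) : ℝ) : ℂ) ∈ Complex.slitPlane :=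
  Complex.ofReal_mem_slitPlane.2 (by positivity)

lemma lowCut_apply (n : ℕ) (φ : Sch d) :
    lowCut n φ = -lap (res ((1 / ((n : ℝ) + 1) : ℝ) : ℂ) φ) := rfl

lemma lowCut_eq_sub (n : ℕ) (φ : Sch d) : lowCut n φ =
    φ - ((1 / ((n : ℝ) + 1) : ℝ) : ℂ) • res ((1 / ((n : ℝ) + 1) : ℝ) : ℂ) φ := by
  have h := res_sub_lap (ofReal_mem_slitPlane_of_nat n) φ
  rw [lowCut_apply]
  nth_rw 2 [← h]
  abel

lemma lowCut_dd (n : ℕ) (j : Fin d) (φ : Sch d) : lowCut n (dd j φ) = dd j (lowCut n φ) := by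
  rw [lowCut_apply, lowCut_apply, res_dd (ofReal_mem_slitPlane_of_nat n), lap_dd, map_neg]

lemma lowCut_lap (n : ℕ) (φ : Sch d) : lowCut n (lap φ) = lap (lowCut n φ) := by
  rw [lowCut_apply, lowCut_apply, res_lap (ofReal_mem_slitPlane_of_nat n), map_neg]

lemma exists_lap_eq_lowCut (n : ℕ) (φ : Sch d) : ∃ χ : Sch d, lap χ = lowCut n φ :=
  ⟨-res ((1 / ((n : ℝ) + 1) : ℝ) : ℂ) φ, by rw [lowCut_apply, map_neg]⟩

/-- `lowCut` already contains the factor `Δ`, and `z - Δ` is invertible on Schwartz functions. `Δ`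
is not, since its symbol vanishes at the origin; this is why `lowCut` is needed. -/
lemma exists_sub_lap_lap_eq_lowCut {z : ℂ} (hz : z ∈ Complex.slitPlane) (n : ℕ) (φ : Sch d) :
    ∃ χ : Sch d, z • lap χ - lap (lap χ) = lowCut n φ := by
  refine ⟨-res z (res ((1 / ((n : ℝ) + 1) : ℝ) : ℂ) φ), ?_⟩
  rw [← map_smul, ← map_sub, lowCut_apply, map_neg, smul_neg, ← neg_sub', map_neg, res_sub_lap hz]

lemma norm_res_apply_le {s : ℝ} (hs : 0 < s) (φ : Sch d) (x : Sp d) :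
    ‖((s : ℂ) • res (s : ℂ) φ) x‖ ≤ ∫ ξ, ‖(s : ℂ) * resSymbol (s : ℂ) ξ * (𝓕 φ : Sch d) ξ‖ := by
  have hsl : (s : ℂ) ∈ Complex.slitPlane := Complex.ofReal_mem_slitPlane.2 hs
  rw [smul_apply, sch_eq_integral (res (s : ℂ) φ), smul_eq_mul, ← integral_const_mul]
  refine (norm_integral_le_integral_norm _).trans (le_of_eq ?_)
  refine integral_congr_ae (Eventually.of_forall fun ξ => ?_)
  simp only [fourier_res hsl, norm_mul, norm_exp_two_pi_I_mul]
  ring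

lemma resSymbol_ofReal {s : ℝ} (ξ : Sp d) :
    (s : ℂ) * resSymbol (s : ℂ) ξ = ((s / (s + 4 * Real.pi ^ 2 * ‖ξ‖ ^ 2) : ℝ) : ℂ) := by
  rw [resSymbol]
  push_cast
  rfl

/-- With `s = 1 / (n + 1)`, the factor `s / (s + 4π²‖ξ‖²)` is at most `1` and tends to `0` off the
origin, a null set since `0 < d`. -/
lemma tendsto_integral_resSymbol (hd : 0 < d) (φ : Sch d) :
    Tendsto (fun n : ℕ => ∫ ξ, ‖((1 / ((n : ℝ) + 1) : ℝ) : ℂ) *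
      resSymbol ((1 / ((n : ℝ) + 1) : ℝ) : ℂ) ξ * (𝓕 φ : Sch d) ξ‖) atTop (𝓝 0) := by
  have h0 : (0 : ℝ) = ∫ _ : Sp d, (0 : ℝ) := by simp
  rw [h0]
  have : Nonempty (Fin d) := ⟨⟨0, hd⟩⟩
  have : Nontrivial (Sp d) := inferInstance
  have hb : ∀ (n : ℕ) (ξ : Sp d), ‖(1 / ((n : ℝ) + 1)) /
      (1 / ((n : ℝ) + 1) + 4 * Real.pi ^ 2 * ‖ξ‖ ^ 2)‖ ≤ 1 := by
    intro n ξ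
    have hs : (0 : ℝ) < 1 / ((n : ℝ) + 1) := by positivity
    have h4 : 0 ≤ 4 * Real.pi ^ 2 * ‖ξ‖ ^ 2 := by positivity
    rw [Real.norm_of_nonneg (by positivity), div_le_one (by positivity)]
    linarith
  refine tendsto_integral_of_dominated_convergence (fun ξ => ‖(𝓕 φ : Sch d) ξ‖)
    (fun n => ?_) (integrable_norm_fourier _) (fun n => Eventually.of_forall fun ξ => ?_) ?_
  · have hc := (𝓕 φ : Sch d).continuous.measurable
    simp only [resSymbol_ofReal]
    refine Measurable.aestronglyMeasurable ?_
    fun_prop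
  · rw [norm_norm, norm_mul, resSymbol_ofReal, Complex.norm_real]
    exact mul_le_of_le_one_left (norm_nonneg _) (hb n ξ)
  · have hne : ∀ᵐ ξ : Sp d, ξ ≠ 0 := by
      rw [ae_iff]
      simp
    filter_upwards [hne] with ξ hξ
    simp only [norm_mul _ ((𝓕 φ : Sch d) ξ), resSymbol_ofReal, Complex.norm_real]
    rw [← zero_mul ‖(𝓕 φ : Sch d) ξ‖]
    refine Tendsto.mul_const _ ?_
    have hc : 4 * Real.pi ^ 2 * ‖ξ‖ ^ 2 ≠ 0 := by
      have := norm_pos_iff.2 hξ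
      positivity
    have h1 := tendsto_one_div_add_atTop_nhds_zero_nat (𝕜 := ℝ)
    have h2 := h1.div (h1.add_const (4 * Real.pi ^ 2 * ‖ξ‖ ^ 2)) (by simpa using hc)
    have h3 := h2.norm
    simpa using h3

variable {q r : ℝ≥0∞} [Fact (1 ≤ q)] [Fact (1 ≤ r)]

/-- For real `s > 0` the angle is zero, so `c = 1` is allowed and the constant in
`eLpNorm_le_of_sub_lap` is exactly `1 / s`. -/
lemma integral_norm_le_of_pos {s : ℝ} (hs : 0 < s) (φ : Sch d) :
    ∫ x, ‖((s : ℂ) • res (s : ℂ) φ : Sch d) x‖ ≤ ∫ x, ‖φ x‖ := by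
  have hsl : (s : ℂ) ∈ Complex.slitPlane := Complex.ofReal_mem_slitPlane.2 hs
  have h := eLpNorm_le_of_sub_lap (r := 1) le_rfl (by simp) (z := (s : ℂ)) (by simp [hs.ne'])
    one_pos (by simp [Complex.arg_ofReal_of_nonneg hs.le]) (res (s : ℂ) φ)
  have : Fact ((1 : ℝ≥0∞) ≤ 1) := ⟨le_rfl⟩
  have h2 := norm_toLr_le_of_eLpNorm_le (by positivity) h
  rw [res_sub_lap hsl] at h2
  have e : ∀ ψ : Sch d, ∫ x, ‖ψ x‖ = ‖toLr 1 ψ‖ := fun ψ => by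
    have := integral_rpow_norm_eq (r := 1) (by simp) ψ
    simpa using this
  rw [e, e, map_smul, norm_smul, Complex.norm_real, Real.norm_of_nonneg hs.le]
  have h3 := mul_le_mul_of_nonneg_left h2 hs.le
  rw [Complex.norm_real, Real.norm_of_nonneg hs.le] at h3
  refine h3.trans (le_of_eq ?_)
  simp
  field_simp

/-- The error `ψ = s (s - Δ)⁻¹ φ` tends to `0` uniformly and stays bounded in `L^1`. Hence `‖ψ‖_r^r
≤ ‖ψ‖_∞^{r-1} ‖ψ‖_1` tends to `0`; here `r > 1` is essential. -/
lemma tendsto_toLr_lowCut (hd : 0 < d) (hr1 : 1 < r) (hr : r ≠ ⊤) (φ : Sch d) :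
    Tendsto (fun n => toLr r (lowCut n φ)) atTop (𝓝 (toLr r φ)) := by
  rw [tendsto_iff_norm_sub_tendsto_zero]
  have hr' : 1 < r.toReal := by
    rw [← ENNReal.toReal_one]
    exact (ENNReal.toReal_lt_toReal (by simp) hr).2 hr1
  set s : ℕ → ℝ := fun n => 1 / ((n : ℝ) + 1) with hs
  have hs0 : ∀ n, 0 < s n := fun n => by simp only [hs]; positivity
  set S : ℕ → ℝ := fun n => ∫ ξ, ‖(s n : ℂ) * resSymbol (s n : ℂ) ξ * (𝓕 φ : Sch d) ξ‖ with hS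
  have hS0 : ∀ n, 0 ≤ S n := fun n => integral_nonneg fun _ => norm_nonneg _
  have hlim : Tendsto S atTop (𝓝 0) := tendsto_integral_resSymbol hd φ
  have hle : ∀ n, ‖toLr r (lowCut n φ) - toLr r φ‖ ≤
      (S n ^ (r.toReal - 1) * ∫ x, ‖φ x‖) ^ r.toReal⁻¹ := by
    intro n
    set ψ : Sch d := (s n : ℂ) • res (s n : ℂ) φ with hψ
    have e : toLr r (lowCut n φ) - toLr r φ = -toLr r ψ := by
      rw [lowCut_eq_sub, map_sub]
      abel
    rw [e, norm_neg, ← Real.rpow_rpow_inv (norm_nonneg (toLr r ψ)) (by linarith : r.toReal ≠ 0),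
      ← integral_rpow_norm_eq hr]
    refine Real.rpow_le_rpow (integral_nonneg fun x => by positivity) ?_ (by positivity)
    calc ∫ x, ‖ψ x‖ ^ r.toReal ≤ ∫ x, S n ^ (r.toReal - 1) * ‖ψ x‖ := by
          refine integral_mono (integrable_rpow_norm hr' ψ) (ψ.integrable.norm.const_mul _) fun x => ?_
          have h1 : ‖ψ x‖ ≤ S n := norm_res_apply_le (hs0 n) φ x
          calc ‖ψ x‖ ^ r.toReal = ‖ψ x‖ ^ (r.toReal - 1) * ‖ψ x‖ := by
                rcases (norm_nonneg (ψ x)).eq_or_lt with h | h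
                · rw [← h, Real.zero_rpow (by linarith), mul_zero]
                · rw [← Real.rpow_add_one h.ne', sub_add_cancel]
            _ ≤ _ := by
                gcongr
      _ = S n ^ (r.toReal - 1) * ∫ x, ‖ψ x‖ := integral_const_mul _ _
      _ ≤ _ := by
          exact mul_le_mul_of_nonneg_left (integral_norm_le_of_pos (hs0 n) φ)
            (Real.rpow_nonneg (hS0 n) _)
  refine squeeze_zero (fun n => norm_nonneg _) hle ?_
  have h1 : Tendsto (fun n => S n ^ (r.toReal - 1)) atTop (𝓝 0) := by
    have := hlim.rpow_const (p := r.toReal - 1) (Or.inr (by linarith))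
    rwa [Real.zero_rpow (by linarith)] at this
  have h2 := (h1.mul_const (∫ x, ‖φ x‖)).rpow_const (p := r.toReal⁻¹) (Or.inr (by positivity))
  rwa [zero_mul, Real.zero_rpow (by positivity)] at h2

/-- `T` is approximately surjective: its range contains all the functions `lowCut n φ`. -/
def CoversLowCut (T : Sch d →L[ℂ] Sch d) : Prop := ∀ n φ, ∃ χ, T χ = lowCut n φ

/-- A functional that is continuous along the approximations `lowCut n φ`. -/
def LowCutContinuous (a : Sch d →ₗ[ℂ] ℂ) : Prop :=
  ∀ φ, Tendsto (fun n => a (lowCut n φ)) atTop (𝓝 (a φ))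

/-- The substitute for density of the range of `T`. It yields uniqueness, and reduces every equation
for the constructed solution to test functions of the form `T χ`. -/
lemma LowCutContinuous.eq_zero {a : Sch d →ₗ[ℂ] ℂ} (ha : LowCutContinuous a)
    {T : Sch d →L[ℂ] Sch d} (hT : CoversLowCut T) (h : ∀ χ, a (T χ) = 0) (φ : Sch d) :
    a φ = 0 := by
  refine tendsto_nhds_unique (ha φ) ?_
  refine tendsto_const_nhds.congr fun n => ?_
  obtain ⟨χ, hχ⟩ := hT n φ
  rw [← hχ, h]

lemma coversLowCut_lap : CoversLowCut (lap : Sch d →L[ℂ] Sch d) := exists_lap_eq_lowCut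

/-- The operator `(z - Δ) Δ`. -/
def resLap (z : ℂ) : Sch d →L[ℂ] Sch d := z • lap - lap.comp lap

lemma resLap_apply (z : ℂ) (φ : Sch d) : resLap z φ = z • lap φ - lap (lap φ) := rfl

lemma coversLowCut_resLap {z : ℂ} (hz : z ∈ Complex.slitPlane) :
    CoversLowCut (resLap z : Sch d →L[ℂ] Sch d) := exists_sub_lap_lap_eq_lowCut hz

variable [ENNReal.HolderConjugate q r]

lemma tendsto_pairS_lowCut (hd : 0 < d) (hr1 : 1 < r) (hr : r ≠ ⊤) (u : LSp d ℂ q) (φ : Sch d) :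
    Tendsto (fun n => pairS r u (lowCut n φ)) atTop (𝓝 (pairS r u φ)) := by
  exact (((ContinuousLinearMap.mul ℂ ℂ).lpPairing volume q r u).continuous.tendsto _).comp
    (tendsto_toLr_lowCut hd hr1 hr φ)

lemma Lp_ext_of_pairS {u v : LSp d ℂ q} (h : ∀ φ : Sch d, pairS r u φ = pairS r v φ) : u = v :=
  Lp_ext_of_test fun φ => by
    have := h (testSch φ)
    rwa [pairS_apply, pairS_apply] at this

lemma Lp_ext_of_covers (hd : 0 < d) (hr1 : 1 < r) (hr : r ≠ ⊤) {T : Sch d →L[ℂ] Sch d}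
    (hT : CoversLowCut T) {u v : LSp d ℂ q} (h : ∀ χ, pairS r u (T χ) = pairS r v (T χ)) :
    u = v := by
  refine Lp_ext_of_pairS (r := r) fun φ => sub_eq_zero.1 ?_
  exact LowCutContinuous.eq_zero (a := (pairS r u - pairS r v).toLinearMap)
    (fun φ => (tendsto_pairS_lowCut hd hr1 hr u φ).sub (tendsto_pairS_lowCut hd hr1 hr v φ)) hT
    (fun χ => sub_eq_zero.2 (h χ)) φ

/-- Solves the transposed equation `Tᵗ u = ℓ` in `L^q`: an a priori bound by `‖T χ‖` is all that
existence requires. -/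
lemma exists_pairS_eq (hr : r ≠ ⊤) (hq : q ≠ ⊤) {T : Sch d →L[ℂ] Sch d} (ℓ : Sch d →ₗ[ℂ] ℂ) {M : ℝ}
    (hM : 0 ≤ M) (h : ∀ χ, ‖ℓ χ‖ ≤ M * ‖toLr r (T χ)‖) :
    ∃ u : LSp d ℂ q, ‖u‖ ≤ M ∧ ∀ χ, pairS r u (T χ) = ℓ χ := by
  obtain ⟨u, hu, hu'⟩ := exists_Lp_of_bound (q := q) hr hq
    ((toLr r).comp T).toLinearMap ℓ hM h
  refine ⟨u, hu, fun χ => ?_⟩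
  rw [hu' χ, pairS_apply]
  exact (integral_mul_toLr _ _).symm

end Approximation

/-! ### Components of vector-valued functions -/

section Components

variable {d : ℕ} {q : ℝ≥0∞} {ι : Type} [Fintype ι]

/-- The `i`-th component of a vector-valued `L^q` function. -/
def comp (i : ι) (G : LSp d (EuclideanSpace ℂ ι) q) : LSp d ℂ q :=
  (EuclideanSpace.proj i : EuclideanSpace ℂ ι →L[ℂ] ℂ).compLp G

lemma coeFn_comp (i : ι) (G : LSp d (EuclideanSpace ℂ ι) q) :
    comp i G =ᵐ[volume] fun x => G x i :=
  ContinuousLinearMap.coeFn_compLp _ G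

lemma norm_comp_le [Fact (1 ≤ q)] (i : ι) (G : LSp d (EuclideanSpace ℂ ι) q) :
    ‖comp i G‖ ≤ ‖G‖ := by
  refine Lp.norm_le_norm_of_ae_le ?_
  filter_upwards [coeFn_comp i G] with x hx
  rw [hx]
  exact PiLp.norm_apply_le _ _

lemma integral_comp_mul (i : ι) (G : LSp d (EuclideanSpace ℂ ι) q) (φ : Sp d → ℂ) :
    ∫ x, comp i G x * φ x = ∫ x, G x i * φ x := by
  refine integral_congr_ae ?_
  filter_upwards [coeFn_comp i G] with x hx
  rw [hx]

variable [DecidableEq ι]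

/-- The vector-valued `L^q` function with given components. -/
def ofComp (E : ι → LSp d ℂ q) : LSp d (EuclideanSpace ℂ ι) q :=
  ∑ i, ((ContinuousLinearMap.id ℂ ℂ).smulRight
    (EuclideanSpace.single i (1 : ℂ) : EuclideanSpace ℂ ι)).compLp (E i)

lemma comp_ofComp (E : ι → LSp d ℂ q) (i : ι) : comp i (ofComp E) = E i := by
  refine Lp.ext ?_
  have h1 : ∀ᵐ x, ∀ j, ((ContinuousLinearMap.id ℂ ℂ).smulRight
      (EuclideanSpace.single j (1 : ℂ) : EuclideanSpace ℂ ι)).compLp (E j) x =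
      E j x • (EuclideanSpace.single j (1 : ℂ) : EuclideanSpace ℂ ι) :=
    ae_all_iff.2 fun j => ContinuousLinearMap.coeFn_compLp _ (E j)
  have h2 := Lp.coeFn_finsetSum Finset.univ fun j => ((ContinuousLinearMap.id ℂ ℂ).smulRight
      (EuclideanSpace.single j (1 : ℂ) : EuclideanSpace ℂ ι)).compLp (E j)
  filter_upwards [coeFn_comp i (ofComp E), h1, h2] with x hx hx1 hx2
  rw [hx, ofComp, hx2, Finset.sum_apply]
  simp only [hx1]
  rw [WithLp.ofLp_sum, Finset.sum_apply]
  simp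

lemma norm_ofComp_le [Fact (1 ≤ q)] (E : ι → LSp d ℂ q) : ‖ofComp E‖ ≤ ∑ i, ‖E i‖ := by
  refine (norm_sum_le _ _).trans (Finset.sum_le_sum fun i _ => ?_)
  refine (ContinuousLinearMap.norm_compLp_le _ _).trans ?_
  refine mul_le_of_le_one_left (norm_nonneg _) ?_
  refine ContinuousLinearMap.opNorm_le_bound _ zero_le_one fun c => ?_
  simp [norm_smul]

lemma ofComp_comp (G : LSp d (EuclideanSpace ℂ ι) q) : ofComp (fun i => comp i G) = G := by
  refine Lp.ext ?_
  have h : ∀ᵐ x, ∀ i, comp i (ofComp fun i => comp i G) x = comp i G x :=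
    ae_all_iff.2 fun i => by
      rw [comp_ofComp]
      exact Eventually.of_forall fun _ => rfl
  have h1 : ∀ᵐ x, ∀ i, comp i (ofComp fun i => comp i G) x = (ofComp fun i => comp i G) x i :=
    ae_all_iff.2 fun i => coeFn_comp i _
  have h2 : ∀ᵐ x, ∀ i, comp i G x = G x i := ae_all_iff.2 fun i => coeFn_comp i _
  filter_upwards [h, h1, h2] with x hx hx1 hx2
  ext i
  rw [← hx1, hx, hx2]

end Components

/-! ### Functions with zero weak gradient -/

section ZeroGradient

variable {d : ℕ}

/-- The derivative of a mollification of `v` is `v` tested against a derivative of a reflected and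
translated bump, hence zero. So every mollification is constant, and mollifications converge to `v`
almost everywhere. -/
lemma exists_ae_eq_const {v : Sp d → ℂ} (hv : LocallyIntegrable v)
    (h : ∀ (j : Fin d) (φ : Test d), ∫ x, v x * pd j φ x = 0) :
    ∃ c : ℂ, v =ᵐ[volume] fun _ => c := by
  set b : ℕ → ContDiffBump (0 : Sp d) := fun n =>
    ⟨1 / ((n : ℝ) + 1), 2 * (1 / ((n : ℝ) + 1)), by positivity, by
      have : (0 : ℝ) < 1 / ((n : ℝ) + 1) := by positivity
      linarith⟩ with hb
  set V : ℕ → Sp d → ℂ := fun n =>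
    convolution ((b n).normed volume) v (ContinuousLinearMap.lsmul ℝ ℝ) volume with hV
  have hconst : ∀ n x, V n x = V n 0 := by
    intro n x
    have hcs : HasCompactSupport ((b n).normed volume) := (b n).hasCompactSupport_normed
    have hsm : ContDiff ℝ ∞ ((b n).normed volume) := (b n).contDiff_normed
    have hd : ∀ y, HasFDerivAt (V n) (convolution (fderiv ℝ ((b n).normed volume)) v
        ((ContinuousLinearMap.lsmul ℝ ℝ).precompL (Sp d)) volume y) y := fun y =>
      hcs.hasFDerivAt_convolution_left _ (hsm.of_le (by simp)) hv y
    have hz : ∀ y, fderiv ℝ (V n) y = 0 := by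
      intro y
      rw [(hd y).fderiv]
      refine ContinuousLinearMap.coe_injective
        ((EuclideanSpace.basisFun (Fin d) ℝ).toBasis.ext fun j => ?_)
      have hex := (hcs.fderiv (𝕜 := ℝ)).convolutionExists_left
        ((ContinuousLinearMap.lsmul ℝ ℝ : ℝ →L[ℝ] ℂ →L[ℝ] ℂ).precompL (Sp d))
        (hsm.continuous_fderiv (by simp)) hv y
      simp only [OrthonormalBasis.coe_toBasis, EuclideanSpace.basisFun_apply,
        ContinuousLinearMap.coe_coe, zero_apply]
      rw [convolution_def, ContinuousLinearMap.integral_apply hex]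
      rw [← integral_sub_left_eq_self _ volume y]
      simp only [sub_sub_cancel]
      set ψ : Test d := ⟨fun w => (((b n).normed volume (y - w) : ℝ) : ℂ),
        Complex.ofRealCLM.contDiff.comp (hsm.comp (contDiff_const.sub contDiff_id)),
        by
          have h1 : HasCompactSupport fun w => (b n).normed volume (y - w) :=
            hcs.comp_homeomorph (Homeomorph.subLeft y)
          exact h1.comp_left (g := fun s : ℝ => (s : ℂ)) Complex.ofReal_zero,
        subset_univ _⟩ with hψ
      have hpd : ∀ w, pd j ψ w = -((fderiv ℝ ((b n).normed volume) (y - w)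
          (EuclideanSpace.single j 1) : ℝ) : ℂ) := by
        intro w
        have h1 : HasFDerivAt (fun w => (b n).normed volume (y - w))
            ((fderiv ℝ ((b n).normed volume) (y - w)).comp (-(ContinuousLinearMap.id ℝ (Sp d)))) w :=
          ((hsm.differentiable (by simp)).differentiableAt.hasFDerivAt).comp w
            ((hasFDerivAt_id w).const_sub y)
        have h2 : HasFDerivAt ψ (Complex.ofRealCLM.comp _) w :=
          Complex.ofRealCLM.hasFDerivAt.comp w h1
        rw [pd, h2.fderiv]
        simp
      have h3 := h j ψ
      simp only [hpd, mul_neg, integral_neg, neg_eq_zero] at h3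
      rw [← h3]
      refine integral_congr_ae (Eventually.of_forall fun w => ?_)
      simp [ContinuousLinearMap.precompL_apply, mul_comm]
    exact is_const_of_fderiv_eq_zero (fun y => (hd y).differentiableAt) hz x 0
  -- The outer radius is exactly twice the inner one, a bounded ratio, which gives convergence at
  -- almost every point.
  have hconv := ContDiffBump.ae_convolution_tendsto_right_of_locallyIntegrable (φ := b) (l := atTop)
    (K := 2) (μ := (volume : Measure (Sp d))) (g := v) (by
      have := (tendsto_one_div_add_atTop_nhds_zero_nat (𝕜 := ℝ)).const_mul 2
      simpa [hb] using this) (Eventually.of_forall fun n => le_rfl) hv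
  obtain ⟨x₀, hx₀⟩ := hconv.exists
  refine ⟨v x₀, ?_⟩
  filter_upwards [hconv] with x hx
  refine tendsto_nhds_unique hx (hx₀.congr fun n => ?_)
  exact (hconst n x₀).trans (hconst n x).symm

end ZeroGradient

/-! ### Recovering a potential from a limit of gradients -/

section Potential

variable {d : ℕ}

/-- Smoothing of `φ` by convolution with `ρ`. -/
def smoothing (ρ : Sch d) : Sch d →L[ℂ] Sch d :=
  SchwartzMap.convolution (ContinuousLinearMap.mul ℂ ℂ) ρ

lemma smoothing_apply (ρ φ : Sch d) (x : Sp d) : smoothing ρ φ x = ∫ h, ρ h * φ (x - h) := by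
  rw [smoothing, SchwartzMap.convolution_apply]
  rfl

lemma fourier_smoothing (ρ φ : Sch d) (ξ : Sp d) :
    (𝓕 (smoothing ρ φ) : Sch d) ξ = (𝓕 ρ : Sch d) ξ * (𝓕 φ : Sch d) ξ := by
  rw [smoothing, SchwartzMap.fourier_convolution, SchwartzMap.pairing_apply_apply]
  rfl

lemma smoothing_dd (ρ φ : Sch d) (j : Fin d) : smoothing ρ (dd j φ) = dd j (smoothing ρ φ) := by
  refine fourier_apply_ext fun ξ => ?_
  rw [fourier_smoothing, fourier_dd, fourier_dd, fourier_smoothing]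
  ring

lemma integral_dd (j : Fin d) (φ : Sch d) : ∫ x, dd j φ x = 0 := by
  have h := fourier_dd j φ 0
  rw [SchwartzMap.fourier_coe, Real.fourier_eq'] at h
  simpa using h

lemma fderiv_apply_eq_sum (φ : Sch d) (x h : Sp d) :
    fderiv ℝ φ x h = ∑ j, (h j : ℂ) * dd j φ x := by
  have e : h = ∑ j, h j • (EuclideanSpace.single j (1 : ℝ) : Sp d) := by
    have := (EuclideanSpace.basisFun (Fin d) ℝ).sum_repr h
    simpa using this.symm
  conv_lhs => rw [e]
  rw [map_sum]
  refine Finset.sum_congr rfl fun j _ => ?_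
  rw [map_smul, Complex.real_smul, dd_apply]
  rfl

lemma norm_fderiv_le_sum (φ : Sch d) (x : Sp d) : ‖fderiv ℝ φ x‖ ≤ ∑ j, ‖dd j φ x‖ := by
  refine ContinuousLinearMap.opNorm_le_bound _ (Finset.sum_nonneg fun _ _ => norm_nonneg _)
    fun h => ?_
  rw [fderiv_apply_eq_sum, Finset.sum_mul]
  refine (norm_sum_le _ _).trans (Finset.sum_le_sum fun j _ => ?_)
  rw [norm_mul, Complex.norm_real, mul_comm]
  gcongr
  exact PiLp.norm_apply_le h j

variable {q r : ℝ≥0∞} [Fact (1 ≤ q)] [Fact (1 ≤ r)]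

lemma norm_smoothing_apply_le [ENNReal.HolderConjugate q r] (ρ φ : Sch d) (x : Sp d) :
    ‖smoothing ρ φ x‖ ≤ ‖toLr r ρ‖ * ‖toLr q φ‖ := by
  have hmp := Measure.measurePreserving_sub_left (volume : Measure (Sp d)) x
  have hm : MemLp (fun h => φ (x - h)) q volume :=
    (φ.memLp q volume).comp_measurePreserving hmp
  have hn : eLpNorm (fun h => φ (x - h)) q volume = eLpNorm φ q volume :=
    eLpNorm_comp_measurePreserving φ.continuous.aestronglyMeasurable hmp
  have h := norm_lpPairing_le (q := r) (r := q) (toLr r ρ) (hm.toLp _)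
  rw [lpPairing_apply, Lp.norm_toLp, hn, ← norm_toLr] at h
  refine le_trans (le_of_eq ?_) h
  rw [smoothing_apply]
  congr 1
  refine integral_congr_ae ?_
  filter_upwards [coeFn_toLr (r := r) ρ, hm.coeFn_toLp] with h h1 h2
  rw [h1, h2]

lemma norm_smoothing_sub_le [ENNReal.HolderConjugate q r] (ρ φ : Sch d) (x y : Sp d) :
    ‖smoothing ρ φ x - smoothing ρ φ y‖ ≤
      ‖toLr r ρ‖ * (∑ j, ‖toLr q (dd j φ)‖) * ‖x - y‖ := by
  refine Convex.norm_image_sub_le_of_norm_fderiv_le (𝕜 := ℝ) (s := univ)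
    (fun z _ => (smoothing ρ φ).differentiableAt) (fun z _ => ?_) convex_univ (mem_univ y)
    (mem_univ x)
  refine (norm_fderiv_le_sum _ _).trans ?_
  rw [Finset.mul_sum]
  refine Finset.sum_le_sum fun j _ => ?_
  rw [← smoothing_dd]
  exact norm_smoothing_apply_le _ _ _

/-- A Poincaré inequality: since `∫ ρ = 1`, `φ - ρ * φ` is the integral of `ρ(h) h · ∇φ(x - s h)`
over all `h` and `s ∈ (0, 1]`, a superposition of translates of `∇φ`. -/
lemma exists_norm_sub_smoothing_le (hq : q ≠ ⊤) (ρ : Sch d) (hρ : ∫ x, ρ x = 1) :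
    ∃ K, 0 ≤ K ∧ ∀ φ : Sch d,
      ‖toLr q (φ - smoothing ρ φ)‖ ≤ K * ∑ j, ‖toLr q (dd j φ)‖ := by
  set ν : Measure (Sp d × ℝ) := volume.prod (volume.restrict (Ioc (0 : ℝ) 1)) with hν
  set k : Fin d → Sp d × ℝ → ℂ := fun j p => ρ p.1 * (p.1 j : ℂ) with hk
  have hρc := ρ.continuous
  have hkc : ∀ j, Continuous (k j) := fun j => by
    simp only [hk]
    fun_prop
  have hki : ∀ j, Integrable (fun h : Sp d => ρ h * (h j : ℂ)) := by
    intro j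
    refine (SchwartzMap.integrable_pow_mul volume ρ 1).mono' (by fun_prop)
      (Eventually.of_forall fun h => ?_)
    rw [norm_mul, Complex.norm_real, mul_comm, pow_one]
    gcongr
    exact PiLp.norm_apply_le h j
  have hkν : ∀ j, Integrable (k j) ν := fun j => (hki j).comp_fst _
  set K : ℝ≥0∞ := ∑ j, ∫⁻ p, ‖k j p‖ₑ ∂ν with hK
  have hKtop : K ≠ ⊤ := (ENNReal.sum_lt_top.2 fun j _ => (hkν j).hasFiniteIntegral).ne
  have hKj : ∀ j, ∫⁻ p, ‖k j p‖ₑ ∂ν ≤ K := fun j =>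
    Finset.single_le_sum (f := fun j => ∫⁻ p, ‖k j p‖ₑ ∂ν) (fun _ _ => zero_le)
      (Finset.mem_univ j)
  refine ⟨K.toReal, ENNReal.toReal_nonneg, fun φ => ?_⟩
  set I : Fin d → Sp d → ℂ := fun j x => ∫ p, k j p * dd j φ (x - p.2 • p.1) ∂ν with hI
  have hIint : ∀ j x, Integrable (fun p => k j p * dd j φ (x - p.2 • p.1)) ν := by
    intro j x
    refine (hkν j).mul_bdd (c := SchwartzMap.seminorm ℝ 0 0 (dd j φ)) ?_ ?_
    · have := (dd j φ).continuous
      exact Continuous.aestronglyMeasurable (by fun_prop)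
    · exact Eventually.of_forall fun p => SchwartzMap.norm_le_seminorm ℝ (dd j φ) _
  have hftc : ∀ x h : Sp d, φ x - φ (x - h) =
      ∫ s in Ioc (0 : ℝ) 1, ∑ j, (h j : ℂ) * dd j φ (x - s • h) := by
    intro x h
    rw [← intervalIntegral.integral_of_le zero_le_one]
    have hd : ∀ s ∈ uIcc (0 : ℝ) 1, HasDerivAt (fun s : ℝ => -φ (x - s • h))
        (∑ j, (h j : ℂ) * dd j φ (x - s • h)) s := by
      intro s _
      have h1 : HasDerivAt (fun s : ℝ => x - s • h) (-h) s := by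
        simpa using ((hasDerivAt_id s).smul_const h).const_sub x
      have h2 := ((φ.hasFDerivAt (x - s • h)).comp_hasDerivAt s h1).neg
      rw [map_neg, neg_neg, fderiv_apply_eq_sum] at h2
      exact h2
    have := intervalIntegral.integral_eq_sub_of_hasDerivAt hd (Continuous.intervalIntegrable (by
      have := fun j => (dd j φ).continuous
      fun_prop) _ _)
    rw [this]
    simp
    ring
  have hrepr : ((φ - smoothing ρ φ : Sch d) : Sp d → ℂ) = ∑ j, I j := by
    ext x
    have hiρ : Integrable fun h => ρ h * φ (x - h) := by
      refine ρ.integrable.mul_bdd (c := SchwartzMap.seminorm ℝ 0 0 φ) ?_ ?_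
      · have := φ.continuous
        exact Continuous.aestronglyMeasurable (by fun_prop)
      · exact Eventually.of_forall fun p => SchwartzMap.norm_le_seminorm ℝ φ _
    calc (φ - smoothing ρ φ : Sch d) x = (∫ h, ρ h * φ x) - ∫ h, ρ h * φ (x - h) := by
          rw [sub_apply, smoothing_apply, integral_mul_const, hρ, one_mul]
      _ = ∫ h, ρ h * (φ x - φ (x - h)) := by
          rw [← integral_sub (ρ.integrable.mul_const _) hiρ]
          simp only [mul_sub]
      _ = ∫ h, ∫ s in Ioc (0 : ℝ) 1, ∑ j, k j (h, s) * dd j φ (x - s • h) := by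
          refine integral_congr_ae (Eventually.of_forall fun h => ?_)
          simp only [hftc, hk]
          rw [← integral_const_mul]
          simp only [Finset.mul_sum, mul_assoc]
      _ = ∫ p, ∑ j, k j p * dd j φ (x - p.2 • p.1) ∂ν := by
          rw [hν, integral_prod _ (integrable_finsetSum _ fun j _ => hIint j x)]
      _ = (∑ j, I j) x := by
          rw [integral_finsetSum _ fun j _ => hIint j x, Finset.sum_apply]
  have hIc : ∀ j, AEStronglyMeasurable (I j) volume := by
    intro j
    have h1 : Continuous fun p : Sp d × (Sp d × ℝ) => k j p.2 * dd j φ (p.1 - p.2.2 • p.2.1) := by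
      have := (dd j φ).continuous
      have := hkc j
      fun_prop
    exact (h1.aestronglyMeasurable (μ := volume.prod ν)).integral_prod_right'
  have hmain : eLpNorm (φ - smoothing ρ φ : Sch d) q volume ≤
      K * ∑ j, eLpNorm (dd j φ) q volume := by
    rw [hrepr, Finset.mul_sum]
    refine (eLpNorm_sum_le (fun j _ => hIc j) Fact.out).trans (Finset.sum_le_sum fun j _ => ?_)
    refine (eLpNorm_integral_mul_translate_le (hkc j).measurable.aemeasurable (by fun_prop)
      (dd j φ).continuous.measurable Fact.out hq).trans ?_
    gcongr
    exact hKj j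
  rw [norm_toLr]
  have htop : ∀ j ∈ (Finset.univ : Finset (Fin d)), eLpNorm (dd j φ) q volume ≠ ⊤ :=
    fun j _ => ((dd j φ).memLp q volume).2.ne
  have := ENNReal.toReal_mono (ENNReal.mul_ne_top hKtop (ENNReal.sum_ne_top.2 htop)) hmain
  rw [ENNReal.toReal_mul, ENNReal.toReal_sum htop] at this
  simpa only [norm_toLr] using this

lemma exists_sch_integral_eq_one : ∃ ρ : Sch d, ∫ x, ρ x = 1 := by
  let χ : ContDiffBump (0 : Sp d) := ⟨1, 2, one_pos, one_lt_two⟩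
  have hcs : HasCompactSupport fun x => ((χ.normed volume x : ℝ) : ℂ) :=
    χ.hasCompactSupport_normed.comp_left (g := fun s : ℝ => (s : ℂ)) Complex.ofReal_zero
  have hsm : ContDiff ℝ ∞ fun x => ((χ.normed volume x : ℝ) : ℂ) :=
    Complex.ofRealCLM.contDiff.comp χ.contDiff_normed
  refine ⟨hcs.toSchwartzMap hsm, ?_⟩
  have := χ.integral_normed (μ := (volume : Measure (Sp d)))
  simp only [HasCompactSupport.toSchwartzMap_toFun, integral_complex_ofReal, this,
    Complex.ofReal_one]

lemma integral_norm_mul_sch (φ : Sch d) : Integrable fun x => ‖x‖ * ‖φ x‖ := by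
  simpa using SchwartzMap.integrable_pow_mul volume φ 1

/-- An `L^q` limit of gradients of Schwartz functions is the gradient of a function in
`Ẇ^{1,q}`. -/
theorem exists_potential (r : ℝ≥0∞) [Fact (1 ≤ r)] [ENNReal.HolderConjugate q r] (hq : q ≠ ⊤)
    {φ : ℕ → Sch d} {E : Fin d → LSp d ℂ q}
    (hE : ∀ j, Tendsto (fun n => toLr q (dd j (φ n))) atTop (𝓝 (E j))) :
    ∃ v : Sp d → ℂ, MemLqLoc q v ∧
      ∀ (j : Fin d) (ψ : Test d), ∫ x, v x * pd j ψ x = -∫ x, E j x * ψ x := by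
  obtain ⟨ρ, hρ⟩ := exists_sch_integral_eq_one (d := d)
  obtain ⟨K, hK, hKφ⟩ := exists_norm_sub_smoothing_le hq ρ hρ
  have hcauchy : ∀ (c : ℝ), 0 ≤ c → ∀ {X : Type} [NormedAddCommGroup X] [CompleteSpace X]
      (A : Sch d →+ X), (∀ f, ‖A f‖ ≤ c * ∑ j, ‖toLr q (dd j f)‖) →
      ∃ a, Tendsto (fun n => A (φ n)) atTop (𝓝 a) := by
    intro c hc X _ _ A hA
    refine cauchySeq_tendsto_of_complete ?_
    rw [cauchySeq_iff_tendsto_dist_atTop_0]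
    have h0 : Tendsto (fun p : ℕ × ℕ => c * ∑ j, ‖toLr q (dd j (φ p.1)) - toLr q (dd j (φ p.2))‖)
        atTop (𝓝 (c * ∑ _j : Fin d, 0)) := by
      refine Tendsto.const_mul _ (tendsto_finsetSum _ fun j _ => ?_)
      have := cauchySeq_iff_tendsto_dist_atTop_0.1 (hE j).cauchySeq
      simpa only [dist_eq_norm] using this
    simp only [Finset.sum_const_zero, mul_zero] at h0
    refine squeeze_zero (fun _ => dist_nonneg) (fun p => ?_) h0
    rw [dist_eq_norm, ← map_sub]
    refine (hA _).trans (le_of_eq ?_)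
    simp only [map_sub]
  -- Up to constants, `φ n` is the sum of `φ n - ρ * φ n`, which converges in `L^q`, and of `ρ * φ
  -- n` minus its value at `0`, which converges pointwise with a uniform Lipschitz bound. The
  -- constants themselves need not converge.
  obtain ⟨a, ha⟩ := hcauchy K hK
    ((toLr q).comp (ContinuousLinearMap.id ℂ (Sch d) - smoothing ρ)).toLinearMap.toAddMonoidHom hKφ
  have hv : ∀ x : Sp d, ∃ w : ℂ,
      Tendsto (fun n => smoothing ρ (φ n) x - smoothing ρ (φ n) 0) atTop (𝓝 w) := by
    intro x
    refine hcauchy (‖toLr r ρ‖ * ‖x‖) (by positivity)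
      (AddMonoidHom.mk' (fun f => smoothing ρ f x - smoothing ρ f 0) fun f g => by
        simp only [map_add, add_apply]
        ring) fun f => ?_
    have := norm_smoothing_sub_le (q := q) (r := r) ρ f x 0
    rw [sub_zero] at this
    refine this.trans (le_of_eq ?_)
    ring
  choose v hv using hv
  obtain ⟨B, hB⟩ : ∃ B, ∀ n, ‖toLr r ρ‖ * (∑ j, ‖toLr q (dd j (φ n))‖) ≤ B := by
    have h := (tendsto_finsetSum Finset.univ fun j _ => (hE j).norm).const_mul ‖toLr r ρ‖
    obtain ⟨B, hB⟩ := h.bddAbove_range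
    exact ⟨B, fun n => hB ⟨n, rfl⟩⟩
  have hB0 : 0 ≤ B := le_trans (mul_nonneg (norm_nonneg _)
    (Finset.sum_nonneg fun _ _ => norm_nonneg _)) (hB 0)
  have hlip : ∀ n (x y : Sp d), ‖smoothing ρ (φ n) x - smoothing ρ (φ n) y‖ ≤ B * ‖x - y‖ :=
    fun n x y => (norm_smoothing_sub_le (q := q) (r := r) ρ (φ n) x y).trans
      (mul_le_mul_of_nonneg_right (hB n) (norm_nonneg _))
  have hvlip : ∀ x y, ‖v x - v y‖ ≤ B * ‖x - y‖ := by
    intro x y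
    refine le_of_tendsto ((hv x).sub (hv y)).norm (Eventually.of_forall fun n => ?_)
    rw [sub_sub_sub_cancel_right]
    exact hlip n x y
  have hvc : Continuous v := by
    have : LipschitzWith ⟨B, hB0⟩ v := LipschitzWith.of_dist_le_mul fun x y => by
      rw [dist_eq_norm, dist_eq_norm]
      exact hvlip x y
    exact this.continuous
  refine ⟨fun x => a x + v x, fun x R => ?_, fun j ψ => ?_⟩
  · refine ((Lp.memLp a).restrict _).add ?_
    obtain ⟨M, hM⟩ := (isCompact_closedBall x R).exists_bound_of_continuousOn hvc.continuousOn
    have : IsFiniteMeasure ((volume : Measure (Sp d)).restrict (Metric.ball x R)) :=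
      ⟨by rw [Measure.restrict_apply_univ]; exact measure_ball_lt_top⟩
    refine MemLp.of_bound hvc.aestronglyMeasurable M ?_
    filter_upwards [ae_restrict_mem measurableSet_ball] with y hy
    exact hM y (Metric.ball_subset_closedBall hy)
  · set η : Sch d := dd j (testSch ψ) with hη
    have hηpd : ∀ x, pd j ψ x = η x := fun x => (dd_apply j (testSch ψ) x).symm
    simp only [hηpd]
    have h1 : Tendsto (fun n => pairS r (toLr q (φ n - smoothing ρ (φ n))) η) atTop
        (𝓝 (pairS r a η)) := by
      simp only [pairS, ContinuousLinearMap.comp_apply]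
      exact (((ContinuousLinearMap.mul ℂ ℂ).lpPairing volume q r).flip
        (toLr r η)).continuous.tendsto a |>.comp ha
    have h2 : Tendsto (fun n => ∫ x, (smoothing ρ (φ n) x - smoothing ρ (φ n) 0) * η x) atTop
        (𝓝 (∫ x, v x * η x)) := by
      refine tendsto_integral_of_dominated_convergence (fun x => B * (‖x‖ * ‖η x‖)) (fun n => ?_)
        ((integral_norm_mul_sch η).const_mul B) (fun n => Eventually.of_forall fun x => ?_)
        (Eventually.of_forall fun x => (hv x).mul_const _)
      · have := (smoothing ρ (φ n)).continuous
        have := η.continuous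
        exact Continuous.aestronglyMeasurable (by fun_prop)
      · rw [norm_mul, ← mul_assoc]
        have := hlip n x 0
        rw [sub_zero] at this
        gcongr
    have h3 : Tendsto (fun n => -pairS r (toLr q (dd j (φ n))) (testSch ψ)) atTop
        (𝓝 (-pairS r (E j) (testSch ψ))) := by
      simp only [pairS, ContinuousLinearMap.comp_apply]
      exact ((((ContinuousLinearMap.mul ℂ ℂ).lpPairing volume q r).flip
        (toLr r (testSch ψ))).continuous.tendsto (E j) |>.comp (hE j)).neg
    have hi : ∀ f g : Sch d, Integrable fun x => f x * g x := fun f g =>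
      f.integrable.mul_bdd (c := SchwartzMap.seminorm ℝ 0 0 g) g.continuous.aestronglyMeasurable
        (Eventually.of_forall fun x => SchwartzMap.norm_le_seminorm ℝ g x)
    have h4 : ∀ n, pairS r (toLr q (φ n - smoothing ρ (φ n))) η +
        ∫ x, (smoothing ρ (φ n) x - smoothing ρ (φ n) 0) * η x =
        -pairS r (toLr q (dd j (φ n))) (testSch ψ) := by
      intro n
      rw [pairS_toLr, pairS_toLr]
      -- The subtracted constant is invisible because `∂_j ψ` has integral zero.
      have e1 : ∫ x, (smoothing ρ (φ n) x - smoothing ρ (φ n) 0) * η x =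
          ∫ x, smoothing ρ (φ n) x * η x := by
        simp only [sub_mul]
        rw [integral_sub (hi _ _) (η.integrable.const_mul _), integral_const_mul, hη, integral_dd,
          mul_zero, sub_zero]
      rw [e1]
      simp only [sub_apply, sub_mul]
      rw [integral_sub (hi _ _) (hi _ _), sub_add_cancel, hη, integral_mul_dd]
    have h5 := tendsto_nhds_unique ((h1.add h2).congr h4) h3
    rw [pairS_apply, pairS_apply] at h5
    simp only [add_mul]
    rw [integral_add, h5]
    · rfl
    · exact (Lp.memLp a).integrable_mul (η.memLp r volume)
    · refine ((hvc.mul η.continuous).integrable_of_hasCompactSupport ?_)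
      exact (hasCompactSupport_dd (hasCompactSupport_testSch ψ) j).mul_left

end Potential

/-! ### The negative Sobolev norm tested on Schwartz functions -/

section NegativeSobolev

variable {d : ℕ} {q : ℝ≥0∞} [Fact (1 ≤ q)]

lemma memLqLoc_sch (r : ℝ≥0∞) (φ : Sch d) : MemLqLoc r φ := fun x R =>
  (φ.memLp r volume).restrict (Metric.ball x R)

lemma isWeakGradient_testSch {r : ℝ≥0∞} [Fact (1 ≤ r)] (φ : Test d) :
    IsWeakGradient φ (ofComp fun j => toLr r (dd j (testSch φ))) := by
  intro j ψ
  have h1 : ∫ x, φ x * pd j ψ x = ∫ x, testSch φ x * dd j (testSch ψ) x := by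
    simp only [dd_apply, coe_testSch]
  rw [h1, integral_mul_dd, ← integral_comp_mul, comp_ofComp]
  congr 1
  refine integral_congr_ae ?_
  filter_upwards [coeFn_toLr (r := r) (dd j (testSch φ))] with x hx
  rw [hx, testSch_apply]

/-- A Schwartz function that is a test function, as an element of the homogeneous space. -/
def testHomSobolev (r : ℝ≥0∞) [Fact (1 ≤ r)] (φ : Test d) : HomSobolev d r :=
  (⟨(φ, ofComp fun j => toLr r (dd j (testSch φ))),
    memLqLoc_sch r (testSch φ), isWeakGradient_testSch φ⟩ : homSobolevSubmodule d r)

lemma norm_testHomSobolev_le {r : ℝ≥0∞} [Fact (1 ≤ r)] (φ : Test d) :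
    ‖testHomSobolev r φ‖ ≤ ∑ j, ‖toLr r (dd j (testSch φ))‖ :=
  norm_ofComp_le fun j => toLr r (dd j (testSch φ))

/-- The only property of `Λ` that the proof uses. Density carries it from test functions to Schwartz
functions. -/
lemma Represents.norm_pairS_le {g : LSp d ℂ q} {Λ : NegHomSobolev d q} (h : Represents Λ g)
    (φ : Sch d) :
    ‖pairS q.conjExponent g φ‖ ≤ ‖Λ‖ * ∑ j, ‖toLr q.conjExponent (dd j φ)‖ := by
  refine denseRange_testSch.induction_on (p := fun φ : Sch d =>
    ‖pairS q.conjExponent g φ‖ ≤ ‖Λ‖ * ∑ j, ‖toLr q.conjExponent (dd j φ)‖) φ ?_ fun φ => ?_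
  · refine isClosed_le ?_ ?_ <;> fun_prop
  · have h1 := h (testHomSobolev q.conjExponent φ) φ rfl
    rw [pairS_apply]
    simp only [testSch_apply]
    rw [← h1]
    exact (Λ.le_opNorm _).trans
      (mul_le_mul_of_nonneg_left (norm_testHomSobolev_le φ) (norm_nonneg _))

/-- This says `g = -div G`. The bound lets `φ ↦ ⟨g, φ⟩` factor through `φ ↦ ∇φ`, and Riesz is
applied to each component of the extended functional. -/
lemma exists_eq_sum_pairS_dd {r : ℝ≥0∞} [Fact (1 ≤ r)] [ENNReal.HolderConjugate q r]
    (hr : r ≠ ⊤) (hq : q ≠ ⊤) {g : LSp d ℂ q} {M : ℝ} (hM : 0 ≤ M)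
    (h : ∀ φ, ‖pairS r g φ‖ ≤ M * ∑ j, ‖toLr r (dd j φ)‖) :
    ∃ G : Fin d → LSp d ℂ q, ∀ φ, pairS r g φ = ∑ j, pairS r (G j) (dd j φ) := by
  obtain ⟨Φ, -, hΦ⟩ := exists_dual_of_bound (Y := Fin d → LSp d ℂ r)
    (LinearMap.pi fun j => ((toLr r).comp (dd j)).toLinearMap) (pairS r g).toLinearMap
    (M := M * d) (by positivity) fun φ => by
      refine (h φ).trans ?_
      rw [mul_assoc]
      refine mul_le_mul_of_nonneg_left ?_ hM
      refine (Finset.sum_le_card_nsmul Finset.univ _ _ fun j _ =>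
        norm_le_pi_norm (fun j => toLr r (dd j φ)) j).trans (le_of_eq ?_)
      rw [Finset.card_univ, Fintype.card_fin, nsmul_eq_mul]
      rfl
  choose G hG hG' using fun j : Fin d => exists_Lp_eq_dual (q := q) hr hq
    (Φ.comp (ContinuousLinearMap.single ℂ (fun _ : Fin d => LSp d ℂ r) j))
  refine ⟨G, fun φ => ?_⟩
  have h1 := hΦ φ
  rw [ContinuousLinearMap.coe_coe] at h1
  rw [← h1]
  have h2 : (LinearMap.pi fun j => ((toLr r).comp (dd j)).toLinearMap :
      Sch d →ₗ[ℂ] Fin d → LSp d ℂ r) φ = ∑ j, Pi.single j (toLr r (dd j φ)) :=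
    (Finset.univ_sum_single (fun j => toLr r (dd j φ))).symm
  rw [h2, map_sum]
  refine Finset.sum_congr rfl fun j _ => ?_
  rw [pairS_apply, ← integral_mul_toLr (r := r), ← hG' j]
  rfl

end NegativeSobolev

/-! ### The gradient part of a vector field in `L^q` -/

section DenseLaplacians

variable {d : ℕ} {q r : ℝ≥0∞} [Fact (1 ≤ q)] [Fact (1 ≤ r)]

lemma denseRange_toLr_lap (hd : 0 < d) (hq1 : 1 < q) (hq : q ≠ ⊤) :
    DenseRange fun χ : Sch d => toLr q (lap χ) := by
  have h1 : DenseRange (toLr q : Sch d → LSp d ℂ q) :=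
    SchwartzMap.denseRange_toLpCLM (E := Sp d) (F := ℂ) hq
  refine dense_closure.1 (h1.mono ?_)
  rintro _ ⟨φ, rfl⟩
  refine mem_closure_of_tendsto (tendsto_toLr_lowCut hd hq1 hq φ) (Eventually.of_forall fun n => ?_)
  obtain ⟨χ, hχ⟩ := exists_lap_eq_lowCut n φ
  exact ⟨χ, by simp only [hχ]⟩

variable [ENNReal.HolderConjugate q r]

lemma tendsto_pairS {u : ℕ → LSp d ℂ q} {v : LSp d ℂ q} (h : Tendsto u atTop (𝓝 v)) (φ : Sch d) :
    Tendsto (fun n => pairS r (u n) φ) atTop (𝓝 (pairS r v φ)) :=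
  (((ContinuousLinearMap.mul ℂ ℂ).lpPairing volume q r).flip (toLr r φ)).continuous.tendsto v
    |>.comp h

/-- The gradient part of the Helmholtz decomposition of `V`. -/
lemma exists_gradient_part (hd : 0 < d) (hq1 : 1 < q) (hq : q ≠ ⊤) (hr : r ≠ ⊤)
    (V : Fin d → LSp d ℂ q) :
    ∃ (E : Fin d → LSp d ℂ q) (φ : ℕ → Sch d),
      (∀ k, Tendsto (fun n => toLr q (dd k (φ n))) atTop (𝓝 (E k))) ∧
      ∀ k χ, pairS r (E k) (lap χ) = ∑ l, pairS r (V l) (dd k (dd l χ)) := by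
  -- Calderón–Zygmund is needed here in `L^q`, with the roles of `q` and `r` exchanged.
  obtain ⟨C, hC, hCdd⟩ := exists_norm_dd_dd_le (d := d) (r := q) r hr hq
  have hseq : ∀ l, ∃ Φ : ℕ → Sch d, Tendsto (fun n => toLr q (lap (Φ n))) atTop (𝓝 (V l)) := by
    intro l
    obtain ⟨x, hx, hxl⟩ := mem_closure_iff_seq_limit.1 (denseRange_toLr_lap hd hq1 hq (V l))
    choose Φ hΦ using hx
    exact ⟨Φ, by simpa only [hΦ] using hxl⟩
  choose Φ hΦ using hseq
  have hcau : ∀ k l, ∃ e, Tendsto (fun n => toLr q (dd k (dd l (Φ l n)))) atTop (𝓝 e) := by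
    intro k l
    refine cauchySeq_tendsto_of_complete ?_
    rw [cauchySeq_iff_tendsto_dist_atTop_0]
    have h0 := (cauchySeq_iff_tendsto_dist_atTop_0.1 (hΦ l).cauchySeq).const_mul C
    rw [mul_zero] at h0
    refine squeeze_zero (fun _ => dist_nonneg) (fun p => ?_) h0
    rw [dist_eq_norm, dist_eq_norm]
    simp only [← map_sub]
    exact hCdd _ _ _
  choose e he using hcau
  -- Formally `E = ∇ Δ⁻¹ div V`. Since `Δ Φ_l → V_l`, it is the limit of the gradients of `∑ ∂_l
  -- Φ_l`, the form that `exists_potential` requires.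
  refine ⟨fun k => ∑ l, e k l, fun n => ∑ l, dd l (Φ l n), fun k => ?_, fun k χ => ?_⟩
  · simp only [map_sum]
    exact tendsto_finsetSum _ fun l _ => he k l
  · have h1 : pairS r (∑ l, e k l) (lap χ) = ∑ l, pairS r (e k l) (lap χ) := by
      simp [pairS, map_sum]
    rw [h1]
    refine Finset.sum_congr rfl fun l _ => ?_
    refine tendsto_nhds_unique (tendsto_pairS (he k l) (lap χ))
      ((tendsto_pairS (hΦ l) (dd k (dd l χ))).congr fun n => ?_)
    rw [pairS_toLr, pairS_toLr, integral_mul_lap, integral_mul_dd, integral_mul_dd, neg_neg, lap_dd,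
      lap_dd, dd_comm k l]

end DenseLaplacians

/-! ### Derivatives of `χ` controlled by `(z - Δ)Δχ` -/

section ResolventBounds

variable {d : ℕ} {q r : ℝ≥0∞} [Fact (1 ≤ q)] [Fact (1 ≤ r)]

/-- The Calderón–Zygmund inequality for second derivatives and the resolvent estimates for `z - Δ`
on Schwartz functions, with constant `C`. -/
structure ResolventBounds (d : ℕ) (r : ℝ≥0∞) [Fact (1 ≤ r)] (C : ℝ) (z : ℂ) : Prop where
  one_le : 1 ≤ C
  hessian : ∀ (φ : Sch d) (j k : Fin d), ‖toLr r (dd j (dd k φ))‖ ≤ C * ‖toLr r (lap φ)‖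
  value : ∀ w : Sch d, ‖z‖ * ‖toLr r w‖ ≤ C * ‖toLr r (z • w - lap w)‖
  laplacian : ∀ w : Sch d, ‖toLr r (lap w)‖ ≤ C * ‖toLr r (z • w - lap w)‖
  gradient : ∀ (w : Sch d) (j : Fin d),
    √‖z‖ * ‖toLr r (dd j w)‖ ≤ C * ‖toLr r (z • w - lap w)‖

lemma exists_resolventBounds (d : ℕ) (q : ℝ≥0∞) [Fact (1 ≤ q)] [ENNReal.HolderConjugate q r]
    (hq : q ≠ ⊤) (hr : r ≠ ⊤) {θ : ℝ} (hθ0 : 0 < θ) (hθ : θ < Real.pi / 2) :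
    ∃ C, ∀ z ∈ Sector θ, ResolventBounds d r C z := by
  obtain ⟨C, -, hCZ, hC⟩ := exists_resolvent_bounds (d := d) (r := r) q hq hr hθ0 hθ
  have hle : ∀ φ : Sch d, C * ‖toLr r φ‖ ≤ max C 1 * ‖toLr r φ‖ := fun φ =>
    mul_le_mul_of_nonneg_right (le_max_left _ _) (norm_nonneg _)
  exact ⟨max C 1, fun z hz => ⟨le_max_right _ _, fun φ j k => (hCZ φ j k).trans (hle _),
    fun w => (hC z hz w).1.trans (hle _), fun w => (hC z hz w).2.1.trans (hle _),
    fun w j => ((hC z hz w).2.2 j).trans (hle _)⟩⟩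

namespace ResolventBounds

variable {C : ℝ} {z : ℂ}

lemma nonneg (h : ResolventBounds d r C z) : 0 ≤ C := zero_le_one.trans h.one_le

/-- No estimate below applies the basic bounds more than three times, so with `1 ≤ C` the single
constant `C ^ 3` serves for all of them. -/
lemma le_cube_mul (h : ResolventBounds d r C z) {x N : ℝ} (hN : 0 ≤ N) {n : ℕ} (hn : n ≤ 3) (hx : x ≤ C ^ n * N) :
    x ≤ C ^ 3 * N :=
  hx.trans (mul_le_mul_of_nonneg_right (pow_le_pow_right₀ h.one_le hn) hN)

lemma norm_mul_lap_le (h : ResolventBounds d r C z) (χ : Sch d) : ‖z‖ * ‖toLr r (lap χ)‖ ≤ C ^ 3 * ‖toLr r (resLap z χ)‖ :=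
  h.le_cube_mul (norm_nonneg _) (n := 1) (by norm_num) (by rw [pow_one]; exact h.value (lap χ))

lemma norm_mul_dd_dd_le (h : ResolventBounds d r C z) (χ : Sch d) (j k : Fin d) :
    ‖z‖ * ‖toLr r (dd j (dd k χ))‖ ≤ C ^ 3 * ‖toLr r (resLap z χ)‖ := by
  refine h.le_cube_mul (norm_nonneg _) (n := 2) (by norm_num) ?_
  calc ‖z‖ * ‖toLr r (dd j (dd k χ))‖ ≤ ‖z‖ * (C * ‖toLr r (lap χ)‖) :=
        mul_le_mul_of_nonneg_left (h.hessian χ j k) (norm_nonneg _)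
    _ = C * (‖z‖ * ‖toLr r (lap χ)‖) := by ring
    _ ≤ C * (C * ‖toLr r (resLap z χ)‖) := mul_le_mul_of_nonneg_left (h.value (lap χ)) h.nonneg
    _ = C ^ 2 * ‖toLr r (resLap z χ)‖ := by ring

lemma sqrt_mul_dd_lap_le (h : ResolventBounds d r C z) (χ : Sch d) (j : Fin d) :
    √‖z‖ * ‖toLr r (dd j (lap χ))‖ ≤ C ^ 3 * ‖toLr r (resLap z χ)‖ :=
  h.le_cube_mul (norm_nonneg _) (n := 1) (by norm_num) (by rw [pow_one]; exact h.gradient (lap χ) j)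

lemma sqrt_mul_dd_dd_dd_le (h : ResolventBounds d r C z) (χ : Sch d) (i j k : Fin d) :
    √‖z‖ * ‖toLr r (dd i (dd j (dd k χ)))‖ ≤ C ^ 3 * ‖toLr r (resLap z χ)‖ := by
  refine h.le_cube_mul (norm_nonneg _) (n := 2) (by norm_num) ?_
  calc √‖z‖ * ‖toLr r (dd i (dd j (dd k χ)))‖ ≤ √‖z‖ * (C * ‖toLr r (dd k (lap χ))‖) := by
        rw [← lap_dd]
        exact mul_le_mul_of_nonneg_left (h.hessian (dd k χ) i j) (Real.sqrt_nonneg _)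
    _ = C * (√‖z‖ * ‖toLr r (dd k (lap χ))‖) := by ring
    _ ≤ C * (C * ‖toLr r (resLap z χ)‖) := mul_le_mul_of_nonneg_left (h.gradient (lap χ) k) h.nonneg
    _ = C ^ 2 * ‖toLr r (resLap z χ)‖ := by ring

lemma norm_dd_dd_lap_le_sq (h : ResolventBounds d r C z) (χ : Sch d) (j k : Fin d) :
    ‖toLr r (dd j (dd k (lap χ)))‖ ≤ C ^ 2 * ‖toLr r (resLap z χ)‖ :=
  calc ‖toLr r (dd j (dd k (lap χ)))‖ ≤ C * ‖toLr r (lap (lap χ))‖ := h.hessian (lap χ) j k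
    _ ≤ C * (C * ‖toLr r (resLap z χ)‖) := mul_le_mul_of_nonneg_left (h.laplacian (lap χ)) h.nonneg
    _ = C ^ 2 * ‖toLr r (resLap z χ)‖ := by ring

lemma norm_dd_dd_lap_le (h : ResolventBounds d r C z) (χ : Sch d) (j k : Fin d) :
    ‖toLr r (dd j (dd k (lap χ)))‖ ≤ C ^ 3 * ‖toLr r (resLap z χ)‖ :=
  h.le_cube_mul (norm_nonneg _) (n := 2) (by norm_num) (h.norm_dd_dd_lap_le_sq χ j k)

lemma norm_dd_dd_dd_dd_le (h : ResolventBounds d r C z) (χ : Sch d) (i j k l : Fin d) :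
    ‖toLr r (dd i (dd j (dd k (dd l χ))))‖ ≤ C ^ 3 * ‖toLr r (resLap z χ)‖ :=
  calc ‖toLr r (dd i (dd j (dd k (dd l χ))))‖ ≤ C * ‖toLr r (dd k (dd l (lap χ)))‖ := by
        rw [← lap_dd, ← lap_dd]
        exact h.hessian _ i j
    _ ≤ C * (C ^ 2 * ‖toLr r (resLap z χ)‖) :=
        mul_le_mul_of_nonneg_left (h.norm_dd_dd_lap_le_sq χ k l) h.nonneg
    _ = C ^ 3 * ‖toLr r (resLap z χ)‖ := by ring

lemma norm_dd_dd_sub_le (h : ResolventBounds d r C z) (χ : Sch d) (j k : Fin d) :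
    ‖toLr r (dd j (dd k (z • χ - lap χ)))‖ ≤ C ^ 3 * ‖toLr r (resLap z χ)‖ := by
  refine h.le_cube_mul (norm_nonneg _) (n := 1) (by norm_num) ?_
  rw [pow_one, resLap_apply, ← map_smul, ← map_sub]
  exact h.hessian _ j k

end ResolventBounds

end ResolventBounds

/-! ### Elimination of the pressure and bounds for the resulting functional -/

section StokesFunctional

variable {d : ℕ} {q r : ℝ≥0∞} [Fact (1 ≤ q)] [Fact (1 ≤ r)] [ENNReal.HolderConjugate q r]

/-- The functional `χ ↦ ⟨u_k, (z - Δ) Δ χ⟩` of a solution `u`, expressed through the data. -/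
def stokesFun (r : ℝ≥0∞) [Fact (1 ≤ r)] [ENNReal.HolderConjugate q r] (z : ℂ)
    (F : LSp d (CVec d) q) (f : LSp d (CMat d) q) (g : LSp d ℂ q) (k : Fin d) : Sch d →L[ℂ] ℂ :=
  (pairS r (comp k F)).comp lap - ∑ l, (pairS r (comp l F)).comp ((dd k).comp (dd l))
    - ∑ j, (pairS r (comp (j, k) f)).comp ((dd j).comp lap)
    + ∑ j, ∑ l, (pairS r (comp (j, l) f)).comp ((dd j).comp ((dd k).comp (dd l)))
    - (pairS r g).comp ((dd k).comp (z • ContinuousLinearMap.id ℂ (Sch d) - lap))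

variable {z : ℂ} {F : LSp d (CVec d) q} {f : LSp d (CMat d) q} {g : LSp d ℂ q}

lemma stokesFun_apply (k : Fin d) (χ : Sch d) : stokesFun r z F f g k χ =
    pairS r (comp k F) (lap χ) - ∑ l, pairS r (comp l F) (dd k (dd l χ))
      - ∑ j, pairS r (comp (j, k) f) (dd j (lap χ))
      + ∑ j, ∑ l, pairS r (comp (j, l) f) (dd j (dd k (dd l χ)))
      - pairS r g (dd k (z • χ - lap χ)) := by
  simp [stokesFun]

/-- The weight `s` will be `|z|` for the velocity and `√|z|` for its gradient. The factors count
terms: `1 + d` with `F` and `d + d²` with `f`. -/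
lemma mul_norm_stokesFun_le {s M₁ M₂ M₃ : ℝ} (hs : 0 ≤ s) (k : Fin d) (χ : Sch d)
    (h₁ : s * ‖toLr r (lap χ)‖ ≤ M₁) (h₁' : ∀ k l, s * ‖toLr r (dd k (dd l χ))‖ ≤ M₁)
    (h₂ : ∀ j, s * ‖toLr r (dd j (lap χ))‖ ≤ M₂)
    (h₂' : ∀ j k l, s * ‖toLr r (dd j (dd k (dd l χ)))‖ ≤ M₂)
    (h₃ : s * ‖pairS r g (dd k (z • χ - lap χ))‖ ≤ M₃) :
    s * ‖stokesFun r z F f g k χ‖ ≤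
      (1 + d) * (‖F‖ * M₁) + (d + d ^ 2) * (‖f‖ * M₂) + M₃ := by
  have hFb : ∀ l (φ : Sch d), s * ‖toLr r φ‖ ≤ M₁ → s * ‖pairS r (comp l F) φ‖ ≤ ‖F‖ * M₁ :=
    fun l φ h => by
      calc s * ‖pairS r (comp l F) φ‖ ≤ s * (‖F‖ * ‖toLr r φ‖) :=
            mul_le_mul_of_nonneg_left ((norm_pairS_le _ _).trans
              (mul_le_mul_of_nonneg_right (norm_comp_le _ _) (norm_nonneg _))) hs
        _ = ‖F‖ * (s * ‖toLr r φ‖) := by ring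
        _ ≤ ‖F‖ * M₁ := mul_le_mul_of_nonneg_left h (norm_nonneg _)
  have hfb : ∀ p (φ : Sch d), s * ‖toLr r φ‖ ≤ M₂ → s * ‖pairS r (comp p f) φ‖ ≤ ‖f‖ * M₂ :=
    fun p φ h => by
      calc s * ‖pairS r (comp p f) φ‖ ≤ s * (‖f‖ * ‖toLr r φ‖) :=
            mul_le_mul_of_nonneg_left ((norm_pairS_le _ _).trans
              (mul_le_mul_of_nonneg_right (norm_comp_le _ _) (norm_nonneg _))) hs
        _ = ‖f‖ * (s * ‖toLr r φ‖) := by ring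
        _ ≤ ‖f‖ * M₂ := mul_le_mul_of_nonneg_left h (norm_nonneg _)
  have hsum : ∀ {a : Fin d → ℂ} {M : ℝ}, (∀ j, s * ‖a j‖ ≤ M) → s * ‖∑ j, a j‖ ≤ d * M := by
    intro a M h
    calc s * ‖∑ j, a j‖ ≤ s * ∑ j, ‖a j‖ := mul_le_mul_of_nonneg_left (norm_sum_le _ _) hs
      _ = ∑ j, s * ‖a j‖ := Finset.mul_sum _ _ _
      _ ≤ ∑ _j : Fin d, M := Finset.sum_le_sum fun j _ => h j
      _ = d * M := by simp
  have e1 := hFb k _ h₁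
  have e2 := hsum fun l => hFb l _ (h₁' k l)
  have e3 := hsum fun j => hfb (j, k) _ (h₂ j)
  have e4 := hsum fun j => hsum fun l => hfb (j, l) _ (h₂' j k l)
  rw [stokesFun_apply]
  have hn : ∀ a b c e g : ℂ, s * ‖a - b - c + e - g‖ ≤
      s * ‖a‖ + s * ‖b‖ + s * ‖c‖ + s * ‖e‖ + s * ‖g‖ := by
    intro a b c e g
    rw [← mul_add, ← mul_add, ← mul_add, ← mul_add]
    refine mul_le_mul_of_nonneg_left ?_ hs
    refine (norm_sub_le _ _).trans (add_le_add_left ?_ _)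
    refine (norm_add_le _ _).trans (add_le_add_left ?_ _)
    exact (norm_sub_le _ _).trans (add_le_add_left (norm_sub_le _ _) _)
  refine (hn _ _ _ _ _).trans ?_
  linarith

/-- Terms with `F` carry two derivatives of `χ` and absorb `|z|` entirely. Terms with `f` carry
three and absorb only one `√|z|`. For `g`, the dual bound adds a derivative, so that
Calderón–Zygmund applies to `(z - Δ)χ`. -/
lemma norm_mul_stokesFun_le {C M : ℝ} (h : ResolventBounds d r C z) (hM : 0 ≤ M)
    (hg : ∀ φ, ‖pairS r g φ‖ ≤ M * ∑ j, ‖toLr r (dd j φ)‖) (k : Fin d) (χ : Sch d) :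
    ‖z‖ * ‖stokesFun r z F f g k χ‖ ≤
      (1 + d + d ^ 2) * C ^ 3 * (‖F‖ + √‖z‖ * ‖f‖ + ‖z‖ * M) * ‖toLr r (resLap z χ)‖ := by
  set N := C ^ 3 * ‖toLr r (resLap z χ)‖ with hN
  have hN0 : 0 ≤ N := mul_nonneg (pow_nonneg h.nonneg 3) (norm_nonneg _)
  have hs : √‖z‖ * √‖z‖ = ‖z‖ := Real.mul_self_sqrt (norm_nonneg z)
  have hgN : ‖pairS r g (dd k (z • χ - lap χ))‖ ≤ M * (d * N) := by
    refine (hg _).trans (mul_le_mul_of_nonneg_left ?_ hM)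
    refine (Finset.sum_le_sum fun j _ => h.norm_dd_dd_sub_le χ j k).trans (le_of_eq ?_)
    simp [hN]
  have hroot : ∀ {x : ℝ}, √‖z‖ * x ≤ N → ‖z‖ * x ≤ √‖z‖ * N := fun {x} hx => by
    calc ‖z‖ * x = √‖z‖ * (√‖z‖ * x) := by rw [← mul_assoc, hs]
      _ ≤ √‖z‖ * N := mul_le_mul_of_nonneg_left hx (Real.sqrt_nonneg _)
  have key := mul_norm_stokesFun_le (F := F) (f := f) (g := g) (norm_nonneg z) k χ
    (h.norm_mul_lap_le χ) (h.norm_mul_dd_dd_le χ) (fun j => hroot (h.sqrt_mul_dd_lap_le χ j))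
    (fun i j l => hroot (h.sqrt_mul_dd_dd_dd_le χ i j l))
    (mul_le_mul_of_nonneg_left hgN (norm_nonneg z))
  refine key.trans ?_
  have h1 : 0 ≤ ‖F‖ * N := by positivity
  have h2 : 0 ≤ ‖f‖ * (√‖z‖ * N) := by positivity
  have h3 : 0 ≤ ‖z‖ * M * N := by positivity
  have hd : (0 : ℝ) ≤ d := Nat.cast_nonneg d
  have h4 : 0 ≤ (d : ℝ) ^ 2 * (‖F‖ * N) := by positivity
  have h5 : 0 ≤ (1 + (d : ℝ) ^ 2) * (‖z‖ * M * N) := by positivity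
  rw [show (1 + (d : ℝ) + d ^ 2) * C ^ 3 * (‖F‖ + √‖z‖ * ‖f‖ + ‖z‖ * M) * ‖toLr r (resLap z χ)‖ =
    (1 + (d : ℝ) + d ^ 2) * (‖F‖ + √‖z‖ * ‖f‖ + ‖z‖ * M) * N by rw [hN]; ring]
  linarith

/-- With one more derivative, the `F` terms absorb `√|z|` and the `f` terms absorb nothing. The `g`
term now has two derivatives of `(z - Δ)χ`, so the plain `L^q` norm of `g` suffices. -/
lemma sqrt_mul_stokesFun_dd_le {C : ℝ} (h : ResolventBounds d r C z) (j k : Fin d) (χ : Sch d) :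
    √‖z‖ * ‖stokesFun r z F f g k (dd j χ)‖ ≤
      (1 + d + d ^ 2) * C ^ 3 * (‖F‖ + √‖z‖ * ‖f‖ + √‖z‖ * ‖g‖) * ‖toLr r (resLap z χ)‖ := by
  set N := C ^ 3 * ‖toLr r (resLap z χ)‖ with hN
  have hN0 : 0 ≤ N := mul_nonneg (pow_nonneg h.nonneg 3) (norm_nonneg _)
  have hgN : ‖pairS r g (dd k (z • dd j χ - lap (dd j χ)))‖ ≤ ‖g‖ * N := by
    rw [lap_dd, ← map_smul, ← map_sub]
    exact (norm_pairS_le _ _).trans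
      (mul_le_mul_of_nonneg_left (h.norm_dd_dd_sub_le χ k j) (norm_nonneg _))
  have hs0 := Real.sqrt_nonneg ‖z‖
  have key := mul_norm_stokesFun_le (F := F) (f := f) (g := g) hs0 k (dd j χ)
    (by rw [lap_dd]; exact h.sqrt_mul_dd_lap_le χ j) (fun k l => h.sqrt_mul_dd_dd_dd_le χ k l j)
    (fun i => mul_le_mul_of_nonneg_left
      (by rw [lap_dd]; exact h.norm_dd_dd_lap_le χ i j) hs0)
    (fun i k l => mul_le_mul_of_nonneg_left (h.norm_dd_dd_dd_dd_le χ i k l j) hs0)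
    (mul_le_mul_of_nonneg_left hgN hs0)
  refine key.trans ?_
  have h1 : 0 ≤ ‖F‖ * N := by positivity
  have h2 : 0 ≤ ‖f‖ * (√‖z‖ * N) := by positivity
  have h3 : 0 ≤ √‖z‖ * ‖g‖ * N := by positivity
  have hd : (0 : ℝ) ≤ d := Nat.cast_nonneg d
  have h4 : 0 ≤ (d : ℝ) ^ 2 * (‖F‖ * N) := by positivity
  have h5 : 0 ≤ ((d : ℝ) + (d : ℝ) ^ 2) * (√‖z‖ * ‖g‖ * N) := by positivity
  rw [show (1 + (d : ℝ) + d ^ 2) * C ^ 3 * (‖F‖ + √‖z‖ * ‖f‖ + √‖z‖ * ‖g‖) *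
    ‖toLr r (resLap z χ)‖ =
    (1 + (d : ℝ) + d ^ 2) * (‖F‖ + √‖z‖ * ‖f‖ + √‖z‖ * ‖g‖) * N by rw [hN]; ring]
  linarith

/-- The functional `T χ ↦ ⟨u, T χ⟩` is represented by some `v` of norm at most `M`, and `v = u`
because the range of `T` determines an element of `L^q`. -/
lemma norm_le_of_pairS_le (hd : 0 < d) (hr1 : 1 < r) (hr : r ≠ ⊤) (hq : q ≠ ⊤)
    {T : Sch d →L[ℂ] Sch d} (hT : CoversLowCut T) {u : LSp d ℂ q} {M : ℝ} (hM : 0 ≤ M)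
    (h : ∀ χ, ‖pairS r u (T χ)‖ ≤ M * ‖toLr r (T χ)‖) : ‖u‖ ≤ M := by
  obtain ⟨v, hv, hv'⟩ := exists_pairS_eq (q := q) hr hq ((pairS r u).comp T).toLinearMap hM h
  rwa [Lp_ext_of_covers hd hr1 hr hT (u := u) (v := v) fun χ => (hv' χ).symm]

lemma IsStokesSolution.pairS_momentum {u : LSp d (CVec d) q} {π : Sp d → ℂ}
    (h : IsStokesSolution z F f g u π) (k : Fin d) {φ : Sch d} (hφ : HasCompactSupport φ) :
    -pairS r (comp k u) (lap φ) - (∫ x, π x * dd k φ x) + z * pairS r (comp k u) φ =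
      pairS r (comp k F) φ - ∑ j, pairS r (comp (j, k) f) (dd j φ) := by
  obtain ⟨ψ, rfl⟩ := exists_testSch_eq hφ
  have h1 := h.momentum k ψ
  simpa only [pairS_apply, integral_comp_mul, lap_apply, dd_apply, coe_testSch, testSch_apply]
    using h1

lemma IsStokesSolution.pairS_divergence {u : LSp d (CVec d) q} {π : Sp d → ℂ}
    (h : IsStokesSolution z F f g u π) {φ : Sch d} (hφ : HasCompactSupport φ) :
    -∑ j, pairS r (comp j u) (dd j φ) = pairS r g φ := by
  obtain ⟨ψ, rfl⟩ := exists_testSch_eq hφ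
  have h1 := h.divergence ψ
  simpa only [pairS_apply, integral_comp_mul, dd_apply, coe_testSch, testSch_apply] using h1

/-- The pressure cancels because `∂_k Δ = ∑ ∂_l ∂_k ∂_l`, and the divergence equation replaces the
remaining velocity terms by `g`. A locally integrable pressure only allows compactly supported `χ`;
once it is gone, both sides extend by density. -/
lemma IsStokesSolution.pairS_resLap {u : LSp d (CVec d) q} {π : Sp d → ℂ}
    (h : IsStokesSolution z F f g u π) (hπ : LocallyIntegrable π) (k : Fin d) (χ : Sch d) :
    pairS r (comp k u) (resLap z χ) = stokesFun r z F f g k χ := by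
  refine denseRange_testSch.induction_on (p := fun χ : Sch d =>
    pairS r (comp k u) (resLap z χ) = stokesFun r z F f g k χ) χ ?_ fun ψ => ?_
  · exact isClosed_eq (by fun_prop) (by fun_prop)
  set χ := testSch ψ
  have hχ : HasCompactSupport χ := hasCompactSupport_testSch ψ
  have m1 := h.pairS_momentum (r := r) k (hasCompactSupport_lap hχ)
  have m2 := fun l => h.pairS_momentum (r := r) l
    (hasCompactSupport_dd (hasCompactSupport_dd hχ l) k)
  have d1 := h.pairS_divergence (r := r) (hasCompactSupport_dd hχ k)
  have d2 := h.pairS_divergence (r := r) (hasCompactSupport_dd (hasCompactSupport_lap hχ) k)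
  have hp : ∫ x, π x * dd k (lap χ) x = ∑ l, ∫ x, π x * dd l (dd k (dd l χ)) x := by
    rw [← integral_finsetSum]
    · refine integral_congr_ae (Eventually.of_forall fun x => ?_)
      have : dd k (lap χ) = ∑ l, dd l (dd k (dd l χ)) := by
        rw [lap_eq_sum, map_sum]
        exact Finset.sum_congr rfl fun l _ => dd_comm k l _
      simp only [this, sum_apply, Finset.mul_sum]
    · intro l _
      exact integrable_mul_test hπ (dd l (dd k (dd l χ))).continuous
        (hasCompactSupport_dd (hasCompactSupport_dd (hasCompactSupport_dd hχ l) k) l)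
  have m3 := Finset.sum_congr (rfl : (Finset.univ : Finset (Fin d)) = _) fun l _ => m2 l
  simp only [Finset.sum_add_distrib, Finset.sum_sub_distrib, Finset.sum_neg_distrib,
    ← Finset.mul_sum, lap_dd] at m3
  rw [Finset.sum_comm (f := fun l j => pairS r (comp (j, l) f) (dd j (dd k (dd l χ))))] at m3
  have c1 : ∀ φ : Sch d, ∑ l, pairS r (comp l u) (dd k (dd l φ)) =
      ∑ l, pairS r (comp l u) (dd l (dd k φ)) := fun φ =>
    Finset.sum_congr rfl fun l _ => by rw [dd_comm]
  rw [c1, c1] at m3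
  rw [stokesFun_apply, resLap_apply]
  simp only [map_sub, map_smul, smul_eq_mul]
  linear_combination m1 - m3 + hp - z * d1 + d2

end StokesFunctional

/-! ### Existence, uniqueness and estimates for the Stokes system -/

section Solution

variable {d : ℕ} {q r : ℝ≥0∞} [Fact (1 ≤ q)] [Fact (1 ≤ r)] [ENNReal.HolderConjugate q r]
  {z : ℂ} {F : LSp d (CVec d) q} {f : LSp d (CMat d) q} {g : LSp d ℂ q} {C M : ℝ}

lemma norm_pos_of_mem_slitPlane {z : ℂ} (hz : z ∈ Complex.slitPlane) : 0 < ‖z‖ :=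
  norm_pos_iff.2 (Complex.slitPlane_ne_zero hz)

lemma tendsto_pairS_dd_lowCut (hd : 0 < d) (hr1 : 1 < r) (hr : r ≠ ⊤) (u : LSp d ℂ q) (j : Fin d)
    (φ : Sch d) :
    Tendsto (fun n => pairS r u (dd j (lowCut n φ))) atTop (𝓝 (pairS r u (dd j φ))) := by
  simpa only [lowCut_dd] using tendsto_pairS_lowCut hd hr1 hr u (dd j φ)

lemma tendsto_pairS_lap_lowCut (hd : 0 < d) (hr1 : 1 < r) (hr : r ≠ ⊤) (u : LSp d ℂ q)
    (φ : Sch d) :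
    Tendsto (fun n => pairS r u (lap (lowCut n φ))) atTop (𝓝 (pairS r u (lap φ))) := by
  simpa only [lowCut_lap] using tendsto_pairS_lowCut hd hr1 hr u (lap φ)

lemma resLap_dd (z : ℂ) (j : Fin d) (χ : Sch d) : resLap z (dd j χ) = dd j (resLap z χ) := by
  simp only [resLap_apply, lap_dd, map_sub, map_smul]

lemma exists_velocity (hr : r ≠ ⊤) (hq : q ≠ ⊤) (hz : z ∈ Complex.slitPlane)
    (h : ResolventBounds d r C z) (hM : 0 ≤ M)
    (hg : ∀ φ, ‖pairS r g φ‖ ≤ M * ∑ j, ‖toLr r (dd j φ)‖) (k : Fin d) :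
    ∃ u : LSp d ℂ q, ∀ χ, pairS r u (resLap z χ) = stokesFun r z F f g k χ := by
  have hz0 := norm_pos_of_mem_slitPlane hz
  have hC := h.nonneg
  obtain ⟨u, -, hu⟩ := exists_pairS_eq (q := q) hr hq (T := resLap z)
    (stokesFun r z F f g k).toLinearMap
    (M := (1 + d + d ^ 2) * C ^ 3 * (‖F‖ + √‖z‖ * ‖f‖ + ‖z‖ * M) / ‖z‖) (by positivity)
    fun χ => by
      rw [div_mul_eq_mul_div, le_div_iff₀ hz0, mul_comm]
      exact norm_mul_stokesFun_le h hM hg k χ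
  exact ⟨u, hu⟩

/-- The functional is the one that `∂_j u_k` has to satisfy. Solving for it separately avoids having
to differentiate `u_k`. -/
lemma exists_velocity_derivative (hr : r ≠ ⊤) (hq : q ≠ ⊤) (hz : z ∈ Complex.slitPlane)
    (h : ResolventBounds d r C z) (j k : Fin d) :
    ∃ A : LSp d ℂ q, ∀ χ, pairS r A (resLap z χ) = -stokesFun r z F f g k (dd j χ) := by
  have hz0 := Real.sqrt_pos.2 (norm_pos_of_mem_slitPlane hz)
  have hC := h.nonneg
  have hb : ∀ χ, ‖(-(stokesFun r z F f g k).comp (dd j)) χ‖ ≤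
      (1 + d + d ^ 2) * C ^ 3 * (‖F‖ + √‖z‖ * ‖f‖ + √‖z‖ * ‖g‖) / √‖z‖ *
        ‖toLr r (resLap z χ)‖ := fun χ => by
    rw [neg_apply, norm_neg, ContinuousLinearMap.comp_apply, div_mul_eq_mul_div, le_div_iff₀ hz0,
      mul_comm]
    exact sqrt_mul_stokesFun_dd_le h j k χ
  obtain ⟨A, -, hA⟩ := exists_pairS_eq (q := q) hr hq (T := resLap z)
    (-(stokesFun r z F f g k).comp (dd j)).toLinearMap (by positivity) hb
  exact ⟨A, hA⟩

/-- A weak solution of `ΔP = div div f + Δg`, the part of the pressure equation whose right side has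
two derivatives; Calderón–Zygmund gives the a priori bound. -/
lemma exists_singular_pressure (hr : r ≠ ⊤) (hq : q ≠ ⊤) (h : ResolventBounds d r C z) :
    ∃ P : LSp d ℂ q, ∀ χ, pairS r P (lap χ) =
      ∑ j, ∑ l, pairS r (comp (j, l) f) (dd j (dd l χ)) + pairS r g (lap χ) := by
  have hC := h.nonneg
  obtain ⟨P, -, hP⟩ := exists_pairS_eq (q := q) hr hq (T := lap)
    (∑ j, ∑ l, (pairS r (comp (j, l) f)).comp ((dd j).comp (dd l)) +
      (pairS r g).comp lap).toLinearMap (M := d * (d * (‖f‖ * C)) + ‖g‖) (by positivity)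
    fun χ => by
      have h1 : ∀ j l, ‖pairS r (comp (j, l) f) (dd j (dd l χ))‖ ≤ ‖f‖ * C * ‖toLr r (lap χ)‖ := by
        intro j l
        rw [mul_assoc]
        exact (norm_pairS_le _ _).trans (mul_le_mul (norm_comp_le _ _) (h.hessian χ j l)
          (norm_nonneg _) (norm_nonneg _))
      have h2 : ‖∑ j, ∑ l, pairS r (comp (j, l) f) (dd j (dd l χ))‖ ≤
          ∑ _j : Fin d, ∑ _l : Fin d, ‖f‖ * C * ‖toLr r (lap χ)‖ :=
        (norm_sum_le _ _).trans (Finset.sum_le_sum fun j _ =>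
          (norm_sum_le _ _).trans (Finset.sum_le_sum fun l _ => h1 j l))
      simp only [Finset.sum_const, Finset.card_univ, Fintype.card_fin, nsmul_eq_mul] at h2
      have h3 := norm_pairS_le g (lap χ) (r := r)
      simp only [ContinuousLinearMap.coe_coe, add_apply, sum_apply, ContinuousLinearMap.comp_apply]
      refine (norm_add_le _ _).trans ?_
      linarith
  refine ⟨P, fun χ => ?_⟩
  rw [hP χ]
  simp

/-- The part `Δπ = div F - z g`. Writing `g = -div G`, its gradient `E` is the gradient part of `F +
z G`. -/
lemma exists_regular_pressure (hd : 0 < d) (hq1 : 1 < q) (hr : r ≠ ⊤) (hq : q ≠ ⊤) (hM : 0 ≤ M)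
    (hg : ∀ φ, ‖pairS r g φ‖ ≤ M * ∑ j, ‖toLr r (dd j φ)‖) :
    ∃ (E : Fin d → LSp d ℂ q) (π : Sp d → ℂ), MemLqLoc q π ∧
      (∀ (k : Fin d) (ψ : Test d), ∫ x, π x * pd k ψ x = -∫ x, E k x * ψ x) ∧
      ∀ k χ, pairS r (E k) (lap χ) =
        ∑ l, pairS r (comp l F) (dd k (dd l χ)) + z * pairS r g (dd k χ) := by
  obtain ⟨G, hG⟩ := exists_eq_sum_pairS_dd hr hq hM hg
  obtain ⟨E, φ, hφ, hE⟩ := exists_gradient_part (r := r) hd hq1 hq hr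
    fun l => comp l F + z • G l
  obtain ⟨π, hπ, hπ'⟩ := exists_potential r hq hφ
  refine ⟨E, π, hπ, hπ', fun k χ => ?_⟩
  rw [hE k χ, hG, Finset.mul_sum, ← Finset.sum_add_distrib]
  refine Finset.sum_congr rfl fun l _ => ?_
  rw [dd_comm k l]
  simp [pairS]

lemma sum_dd_dd_dd (l : Fin d) (χ : Sch d) : ∑ k, dd k (dd l (dd k χ)) = dd l (lap χ) := by
  rw [lap_eq_sum, map_sum]
  exact Finset.sum_congr rfl fun k _ => dd_comm k l _

/-- The compatibility behind `div u = g`: in the sum, the terms with `F` and `f` cancel in pairs and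
only `g` survives. -/
lemma sum_stokesFun_dd (χ : Sch d) :
    ∑ k, stokesFun r z F f g k (dd k χ) = -pairS r g (resLap z χ) := by
  have h1 : ∀ u : LSp d ℂ q, ∀ l, ∑ k, pairS r u (dd k (dd l (dd k χ))) =
      pairS r u (dd l (lap χ)) := fun u l => by
    rw [← map_sum, sum_dd_dd_dd]
  have h2 : ∀ j, ∑ k, ∑ l, pairS r (comp (j, l) f) (dd j (dd k (dd l (dd k χ)))) =
      ∑ l, pairS r (comp (j, l) f) (dd j (dd l (lap χ))) := fun j => by
    rw [Finset.sum_comm]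
    refine Finset.sum_congr rfl fun l _ => ?_
    rw [← map_sum, ← map_sum, sum_dd_dd_dd]
  have h3 : ∑ k, pairS r g (dd k (z • dd k χ - lap (dd k χ))) = pairS r g (resLap z χ) := by
    rw [← map_sum, resLap_apply]
    congr 1
    simp only [map_sub, map_smul, lap_dd, Finset.sum_sub_distrib, ← Finset.smul_sum]
    rw [← lap_eq_sum, ← lap_eq_sum]
  simp only [stokesFun_apply, Finset.sum_add_distrib, Finset.sum_sub_distrib, h3]
  rw [Finset.sum_comm (f := fun k l => pairS r (comp l F) (dd k (dd l (dd k χ)))),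
    Finset.sum_comm (f := fun k j => ∑ l, pairS r (comp (j, l) f) (dd j (dd k (dd l (dd k χ))))),
    Finset.sum_comm (f := fun k j => pairS r (comp (j, k) f) (dd j (lap (dd k χ))))]
  simp only [h1, h2, lap_dd]
  ring

/-- Velocity, derivatives and pressures are built independently. The Jacobian and divergence
identities are verified on the range of `(z - Δ)Δ` and the momentum equation on the range of `Δ`;
`LowCutContinuous.eq_zero` extends them to all test functions. -/
theorem exists_isStokesSolution (hd : 0 < d) (hq1 : 1 < q) (hq : q ≠ ⊤) (hr1 : 1 < r)
    (hr : r ≠ ⊤) (hz : z ∈ Complex.slitPlane) (h : ResolventBounds d r C z) (hM : 0 ≤ M)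
    (hg : ∀ φ, ‖pairS r g φ‖ ≤ M * ∑ j, ‖toLr r (dd j φ)‖) :
    ∃ (u : LSp d (CVec d) q) (π₁ : LSp d ℂ q) (π₂ : Sp d → ℂ), MemW1 u ∧ MemHomW1 q π₂ ∧
      IsStokesSolution z F f g u fun x => π₁ x + π₂ x := by
  have hT := coversLowCut_resLap (d := d) hz
  choose U hU using exists_velocity (F := F) (f := f) hr hq hz h hM hg
  choose A hA using exists_velocity_derivative (F := F) (f := f) (g := g) hr hq hz h
  obtain ⟨P, hP⟩ := exists_singular_pressure (f := f) (g := g) hr hq h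
  obtain ⟨E, π₂, hπ₂, hE, hE'⟩ := exists_regular_pressure (z := z) (F := F) hd hq1 hr hq hM hg
  have hJ : ∀ j k φ, pairS r (U k) (dd j φ) + pairS r (A j k) φ = 0 := fun j k =>
    LowCutContinuous.eq_zero (a := ((pairS r (U k)).comp (dd j) + pairS r (A j k)).toLinearMap)
      (fun φ => (tendsto_pairS_dd_lowCut hd hr1 hr (U k) j φ).add
        (tendsto_pairS_lowCut hd hr1 hr (A j k) φ)) hT fun χ => by
      change pairS r (U k) (dd j (resLap z χ)) + pairS r (A j k) (resLap z χ) = 0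
      rw [← resLap_dd, hU, hA, add_neg_cancel]
  have hdiv : ∀ φ, ∑ j, pairS r (U j) (dd j φ) + pairS r g φ = 0 := by
    have := LowCutContinuous.eq_zero
      (a := (∑ j, (pairS r (U j)).comp (dd j) + pairS r g).toLinearMap) (fun φ => by
        simpa using (tendsto_finsetSum Finset.univ fun j _ =>
          tendsto_pairS_dd_lowCut hd hr1 hr (U j) j φ).add (tendsto_pairS_lowCut hd hr1 hr g φ)) hT
      fun χ => by
        simp only [ContinuousLinearMap.coe_coe, add_apply, sum_apply,
          ContinuousLinearMap.comp_apply, ← resLap_dd, hU, sum_stokesFun_dd, neg_add_cancel]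
    simpa using this
  have hmom : ∀ k φ, -pairS r (U k) (lap φ) - pairS r P (dd k φ) + pairS r (E k) φ +
      z * pairS r (U k) φ - pairS r (comp k F) φ + ∑ j, pairS r (comp (j, k) f) (dd j φ) = 0 := by
    intro k
    have := LowCutContinuous.eq_zero
      (a := (-(pairS r (U k)).comp lap - (pairS r P).comp (dd k) + pairS r (E k) +
        z • pairS r (U k) - pairS r (comp k F) +
          ∑ j, (pairS r (comp (j, k) f)).comp (dd j)).toLinearMap) (fun φ => by
        simpa using (((((tendsto_pairS_lap_lowCut hd hr1 hr (U k) φ).neg.sub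
          (tendsto_pairS_dd_lowCut hd hr1 hr P k φ)).add
          (tendsto_pairS_lowCut hd hr1 hr (E k) φ)).add
          ((tendsto_pairS_lowCut hd hr1 hr (U k) φ).const_mul z)).sub
          (tendsto_pairS_lowCut hd hr1 hr (comp k F) φ)).add
          (tendsto_finsetSum Finset.univ fun j _ =>
            tendsto_pairS_dd_lowCut hd hr1 hr (comp (j, k) f) j φ)) coversLowCut_lap
      fun χ => by
        have h1 := hU k χ
        have h2 := hP (dd k χ)
        have h3 := hE' k χ
        have h4 : ∀ j l, dd j (dd l (dd k χ)) = dd j (dd k (dd l χ)) := fun j l => by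
          rw [dd_comm l k]
        simp only [stokesFun_apply, resLap_apply, map_sub, map_smul, smul_eq_mul] at h1
        simp only [lap_dd, h4] at h2
        simp only [ContinuousLinearMap.coe_coe, add_apply, sub_apply, neg_apply, smul_apply,
          sum_apply, ContinuousLinearMap.comp_apply, smul_eq_mul]
        linear_combination h1 - h2 + h3
    simpa using this
  refine ⟨ofComp U, P, π₂, ⟨ofComp fun p => A p.1 p.2, fun j k φ => ?_⟩,
    ⟨hπ₂, ofComp E, fun k ψ => ?_⟩, ⟨fun k φ => ?_, fun φ => ?_⟩⟩
  · have h1 := hJ j k (testSch φ)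
    rw [← integral_comp_mul, ← integral_comp_mul, comp_ofComp, comp_ofComp]
    simp only [pairS_apply, dd_apply, coe_testSch] at h1
    exact eq_neg_of_add_eq_zero_left h1
  · rw [hE, ← integral_comp_mul, comp_ofComp]
  · have h1 := hmom k (testSch φ)
    have h2 := hE k φ
    have h3 : ∫ x, (P x + π₂ x) * pd k φ x = (∫ x, P x * pd k φ x) + ∫ x, π₂ x * pd k φ x := by
      simp only [add_mul]
      exact integral_add
        (integrable_mul_test (locallyIntegrable_Lp P) (pd_continuous k φ) (pd_hasCompactSupport k φ))
        (integrable_mul_test hπ₂.locallyIntegrable (pd_continuous k φ) (pd_hasCompactSupport k φ))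
    simp only [pairS_apply, lap_apply, dd_apply, coe_testSch, testSch_apply, integral_comp_mul] at h1
    rw [h3]
    simp only [← integral_comp_mul k (ofComp U), comp_ofComp]
    linear_combination h1 - h2
  · have h1 := hdiv (testSch φ)
    simp only [pairS_apply, dd_apply, coe_testSch, testSch_apply] at h1
    simp only [← integral_comp_mul _ (ofComp U), comp_ofComp]
    linear_combination -h1

lemma IsStokesSolution.velocity_unique (hd : 0 < d) (hr1 : 1 < r) (hr : r ≠ ⊤)
    (hz : z ∈ Complex.slitPlane) {u v : LSp d (CVec d) q} {π ϖ : Sp d → ℂ}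
    (hu : IsStokesSolution z F f g u π) (hπ : LocallyIntegrable π)
    (hv : IsStokesSolution z F f g v ϖ) (hϖ : LocallyIntegrable ϖ) : u = v := by
  rw [← ofComp_comp u, ← ofComp_comp v]
  congr 1
  funext k
  refine Lp_ext_of_covers hd hr1 hr (coversLowCut_resLap hz) fun χ => ?_
  rw [hu.pairS_resLap hπ, hv.pairS_resLap hϖ]

lemma IsStokesSolution.pressure_unique {F : Sp d → CVec d} {f : Sp d → CMat d} {g : Sp d → ℂ}
    {u : Sp d → CVec d} {π ϖ : Sp d → ℂ}
    (hu : IsStokesSolution z F f g u π) (hπ : LocallyIntegrable π)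
    (hv : IsStokesSolution z F f g u ϖ) (hϖ : LocallyIntegrable ϖ) :
    ∃ c : ℂ, π =ᵐ[volume] fun x => ϖ x + c := by
  obtain ⟨c, hc⟩ := exists_ae_eq_const (hπ.sub hϖ) fun k φ => by
    have h1 := hu.momentum k φ
    have h2 := hv.momentum k φ
    have h3 : ∫ x, (π - ϖ) x * pd k φ x = (∫ x, π x * pd k φ x) - ∫ x, ϖ x * pd k φ x := by
      simp only [Pi.sub_apply, sub_mul]
      exact integral_sub
        (integrable_mul_test hπ (pd_continuous k φ) (pd_hasCompactSupport k φ))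
        (integrable_mul_test hϖ (pd_continuous k φ) (pd_hasCompactSupport k φ))
    rw [h3]
    linear_combination h2 - h1
  refine ⟨c, ?_⟩
  filter_upwards [hc] with x hx
  rw [← hx, Pi.sub_apply]
  ring

lemma MemHomW1.add_const {π : Sp d → ℂ} (h : MemHomW1 q π) (c : ℂ) :
    MemHomW1 q fun x => π x + c := by
  obtain ⟨h1, G, hG⟩ := h
  refine ⟨fun x R => ?_, G, fun j φ => ?_⟩
  · have : IsFiniteMeasure ((volume : Measure (Sp d)).restrict (Metric.ball x R)) :=
      ⟨by rw [Measure.restrict_apply_univ]; exact measure_ball_lt_top⟩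
    exact (h1 x R).add (memLp_const c)
  · rw [← hG j φ]
    have h2 := integral_dd j (testSch φ)
    simp only [dd_apply, coe_testSch] at h2
    simp only [add_mul]
    rw [integral_add (integrable_mul_test h1.locallyIntegrable (pd_continuous j φ)
      (pd_hasCompactSupport j φ)) (((pd_continuous j φ).integrable_of_hasCompactSupport
      (pd_hasCompactSupport j φ)).const_mul c), integral_const_mul, h2, mul_zero, add_zero]

lemma IsStokesSolution.norm_mul_le (hd : 0 < d) (hr1 : 1 < r) (hr : r ≠ ⊤) (hq : q ≠ ⊤)
    (hz : z ∈ Complex.slitPlane) (h : ResolventBounds d r C z) (hM : 0 ≤ M)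
    (hg : ∀ φ, ‖pairS r g φ‖ ≤ M * ∑ j, ‖toLr r (dd j φ)‖) {u : LSp d (CVec d) q} {π : Sp d → ℂ}
    (hu : IsStokesSolution z F f g u π) (hπ : LocallyIntegrable π) :
    ‖z‖ * ‖u‖ ≤ d * ((1 + d + d ^ 2) * C ^ 3) * (‖F‖ + √‖z‖ * ‖f‖ + ‖z‖ * M) := by
  have hz0 := norm_pos_of_mem_slitPlane hz
  have hC := h.nonneg
  have hk : ∀ k, ‖comp k u‖ ≤ (1 + d + d ^ 2) * C ^ 3 * (‖F‖ + √‖z‖ * ‖f‖ + ‖z‖ * M) / ‖z‖ :=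
    fun k => norm_le_of_pairS_le hd hr1 hr hq (coversLowCut_resLap hz) (by positivity) fun χ => by
      rw [hu.pairS_resLap hπ, div_mul_eq_mul_div, le_div_iff₀ hz0, mul_comm]
      exact norm_mul_stokesFun_le h hM hg k χ
  have h1 := (norm_ofComp_le fun k => comp k u).trans (Finset.sum_le_sum fun k _ => hk k)
  rw [ofComp_comp, Finset.sum_const, Finset.card_univ, Fintype.card_fin, nsmul_eq_mul,
    mul_div_assoc', le_div_iff₀ hz0] at h1
  linarith

lemma IsWeakJacobian.pairS_eq {u : LSp d (CVec d) q} {A : LSp d (CMat d) q}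
    (h : IsWeakJacobian u A) (j k : Fin d) (φ : Sch d) :
    pairS r (comp (j, k) A) φ = -pairS r (comp k u) (dd j φ) := by
  refine denseRange_testSch.induction_on (p := fun φ : Sch d =>
    pairS r (comp (j, k) A) φ = -pairS r (comp k u) (dd j φ)) φ ?_ fun ψ => ?_
  · exact isClosed_eq (by fun_prop) (by fun_prop)
  · have h1 := h j k ψ
    simp only [pairS_apply, integral_comp_mul, dd_apply, coe_testSch, testSch_apply]
    rw [h1, neg_neg]

lemma IsStokesSolution.sqrt_mul_le (hd : 0 < d) (hr1 : 1 < r) (hr : r ≠ ⊤) (hq : q ≠ ⊤)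
    (hz : z ∈ Complex.slitPlane) (h : ResolventBounds d r C z) {u : LSp d (CVec d) q}
    {A : LSp d (CMat d) q} {π : Sp d → ℂ} (hA : IsWeakJacobian u A)
    (hu : IsStokesSolution z F f g u π) (hπ : LocallyIntegrable π) :
    √‖z‖ * ‖A‖ ≤ d ^ 2 * ((1 + d + d ^ 2) * C ^ 3) * (‖F‖ + √‖z‖ * ‖f‖ + √‖z‖ * ‖g‖) := by
  have hz0 := Real.sqrt_pos.2 (norm_pos_of_mem_slitPlane hz)
  have hC := h.nonneg
  have hp : ∀ p, ‖comp p A‖ ≤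
      (1 + d + d ^ 2) * C ^ 3 * (‖F‖ + √‖z‖ * ‖f‖ + √‖z‖ * ‖g‖) / √‖z‖ :=
    fun ⟨j, k⟩ => norm_le_of_pairS_le hd hr1 hr hq (coversLowCut_resLap hz) (by positivity)
      fun χ => by
        rw [hA.pairS_eq, norm_neg, ← resLap_dd, hu.pairS_resLap hπ, div_mul_eq_mul_div,
          le_div_iff₀ hz0, mul_comm]
        exact sqrt_mul_stokesFun_dd_le h j k χ
  have h1 := (norm_ofComp_le fun p => comp p A).trans (Finset.sum_le_sum fun p _ => hp p)
  rw [ofComp_comp, Finset.sum_const, Finset.card_univ, Fintype.card_prod, Fintype.card_fin,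
    nsmul_eq_mul, mul_div_assoc', le_div_iff₀ hz0] at h1
  push_cast at h1
  linarith

lemma sector_subset_slitPlane {θ : ℝ} (hθ : 0 < θ) : Sector θ ⊆ Complex.slitPlane := by
  rintro z ⟨hz0, hz⟩
  rw [Complex.mem_slitPlane_iff_arg]
  refine ⟨fun h => ?_, hz0⟩
  rw [h, abs_of_pos Real.pi_pos] at hz
  linarith

end Solution

end Stokes

end

theorem theorem2p1 (d : ℕ) (hd : 2 ≤ d) (q : ℝ≥0∞) (hq1 : 1 < q) (hq : q < ⊤)
    (θ : ℝ) (hθ0 : 0 < θ) (hθ : θ < Real.pi / 2) :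
    ∃ C : ℝ, 0 < C ∧ ∀ z ∈ Stokes.Sector θ,
      ∀ (F : Stokes.LSp d (Stokes.CVec d) q) (f : Stokes.LSp d (Stokes.CMat d) q)
        (g : Stokes.LSp d ℂ q) (Λ : Stokes.NegHomSobolev d q), Stokes.Represents Λ g →
      (∃! u : Stokes.LSp d (Stokes.CVec d) q, Stokes.MemW1 u ∧
        ∃ π : Stokes.Sp d → ℂ, LocallyIntegrable π ∧ Stokes.IsStokesSolution z F f g u π) ∧
      ∀ (u : Stokes.LSp d (Stokes.CVec d) q) (Du : Stokes.LSp d (Stokes.CMat d) q)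
        (π : Stokes.Sp d → ℂ), Stokes.IsWeakJacobian u Du → LocallyIntegrable π →
        Stokes.IsStokesSolution z F f g u π →
        Real.sqrt ‖z‖ * ‖Du‖ ≤ C * (‖F‖ + Real.sqrt ‖z‖ * ‖f‖ + Real.sqrt ‖z‖ * ‖g‖) ∧
        ‖z‖ * ‖u‖ ≤ C * (‖F‖ + Real.sqrt ‖z‖ * ‖f‖ + ‖z‖ * ‖Λ‖) ∧
        ∃ (π₁ : Stokes.LSp d ℂ q) (π₂ : Stokes.Sp d → ℂ), Stokes.MemHomW1 q π₂ ∧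
          π =ᵐ[volume] fun x => π₁ x + π₂ x := by
  have : Fact (1 ≤ q) := ⟨hq1.le⟩
  have : ENNReal.HolderConjugate q q.conjExponent := .conjExponent hq1.le
  have hr1 : 1 < q.conjExponent :=
    (ENNReal.HolderConjugate.lt_top_iff_one_lt q q.conjExponent).1 hq
  have hr : q.conjExponent ≠ ⊤ :=
    (ENNReal.HolderConjugate.ne_top_iff_ne_one q.conjExponent q).2 hq1.ne'
  have hd0 : 0 < d := by omega
  have hd1 : (1 : ℝ) ≤ d := by exact_mod_cast hd0
  obtain ⟨C, hC⟩ := Stokes.exists_resolventBounds d (r := q.conjExponent) q hq.ne hr hθ0 hθ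
  -- `d ^ 2` counts the entries of the Jacobian and dominates the `d` components of the velocity. `1
  -- ≤ C` is known only once a point of the sector is given, so `max C 1` secures positivity
  -- beforehand.
  refine ⟨d ^ 2 * ((1 + d + d ^ 2) * max C 1 ^ 3), by positivity,
    fun z hz F f g Λ hΛ => ?_⟩
  have hb := hC z hz
  have hC0 := hb.nonneg
  rw [max_eq_left hb.one_le]
  have hzs := Stokes.sector_subset_slitPlane hθ0 hz
  have hg := hΛ.norm_pairS_le
  obtain ⟨u₀, π₁, π₂, hu₀, hπ₂, hsol⟩ := Stokes.exists_isStokesSolution (F := F) (f := f) hd0 hq1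
    hq.ne hr1 hr hzs hb (norm_nonneg Λ) hg
  have hπ₀ : LocallyIntegrable fun x => π₁ x + π₂ x :=
    (Stokes.locallyIntegrable_Lp π₁).add hπ₂.1.locallyIntegrable
  refine ⟨⟨u₀, ⟨hu₀, _, hπ₀, hsol⟩, fun u hu => ?_⟩, fun u Du π hDu hπ hu => ⟨?_, ?_, ?_⟩⟩
  · obtain ⟨-, π, hπ, hu⟩ := hu
    exact hu.velocity_unique hd0 hr1 hr hzs hπ hsol hπ₀
  · exact hu.sqrt_mul_le hd0 hr1 hr hq.ne hzs hb hDu hπ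
  · refine (hu.norm_mul_le hd0 hr1 hr hq.ne hzs hb (norm_nonneg Λ) hg hπ).trans ?_
    refine mul_le_mul_of_nonneg_right ?_ (by positivity)
    refine mul_le_mul_of_nonneg_right ?_ (by positivity)
    nlinarith
  -- The velocity is the constructed one, so the given pressure differs from the constructed one by
  -- a constant, which is absorbed into `π₂`.
  · obtain rfl := hu.velocity_unique hd0 hr1 hr hzs hπ hsol hπ₀
    obtain ⟨c, hc⟩ := hu.pressure_unique hπ hsol hπ₀
    refine ⟨π₁, fun x => π₂ x + c, hπ₂.add_const c, ?_⟩
    filter_upwards [hc] with x hx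
    rw [hx, add_assoc]
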